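/- Let $k$ be an algebraically closed field with $\operatorname{char} k \neq 2,3$. For $1\le n<d$ set $$A_{n,d}:=k[x_1,\dots,x_n]/\bigl(x_ix_j-\delta_{i,j}x_1^{d-n}\ (1\le i\le j\le n,\ (i,j)\neq(1,1)),\ x_1^{d-n+1}\bigr),$$ $A_{0,1}:=k$, $A_1^{sp}:=k[x_1,x_2]/(x_2^2,x_1^3)$ and $A_2^{sp}:=k[x_1,x_2]/(x_2^2-x_1^2,x_1^3)$. (1) Let $X,Y\subseteq\mathbb P^4_k$ be closed subschemes of dimension $0$ and degree $6$ that are non-degenerate (contained in no hyperplane) and arithmetically Gorenstein (the quotient of $k[x_0,\dots,x_4]$ by the homogeneous ideal of all forms vanishing on the scheme is a Gorenstein ring). Then $X$ and $Y$ are projectively equivalent, i.e. some element of $\mathrm{PGL}_5(k)$ carries $X$ onto $Y$, if and only if $X$ and $Y$ are isomorphic as $k$-schemes. (2) There are exactly $20$ isomorphism classes of Artinian Gorenstein (commutative) $k$-algebras of degree $6$ (that is, of dimension $6$ over $k$); they are represented by the pairwise non-isomorphic algebras $A_{0,1}^{\oplus 6}$, $A_{0,1}^{\oplus 4}\oplus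 A_{1,2}$, $A_{0,1}^{\oplus 3}\oplus A_{1,3}$, $A_{0,1}^{\oplus 2}\oplus A_{1,2}^{\oplus2}$, $A_{0,1}^{\oplus 2}\oplus A_{1,4}$, $A_{0,1}^{\oplus 2}\oplus A_{2,4}$, $A_{0,1}\oplus A_{1,2}\oplus A_{1,3}$, $A_{1,2}^{\oplus3}$, $A_{0,1}\oplus A_{1,5}$, $A_{0,1}\oplus A_{2,5}$, $A_{0,1}\oplus A_{3,5}$, $A_{1,2}\oplus A_{1,4}$, $A_{1,2}\oplus A_{2,4}$, $A_{1,3}^{\oplus 2}$, $A_{1,6}$, $A_{2,6}$, $A_{3,6}$, $A_{4,6}$, $A_1^{sp}$, $A_2^{sp}$. In particular $A_1^{sp}\not\cong A_2^{sp}$. (3) There are exactly $20$ isomorphism classes of $k$-schemes $X$ as in (1): each such $X$ is isomorphic over $k$ to $\operatorname{Spec} A$ for exactly one of the $20$ algebras $A$ in this list, and for each $A$ in the list $\operatorname{Spec} A$ is isomorphic over $k$ to such an $X$. -/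

import Mathlib

open CategoryTheory AlgebraicGeometry

universe u v

noncomputable section

namespace AGor

/-! ### Gorenstein rings -/

/-- A Noetherian ring is Gorenstein if each of its localizations at a maximal ideal has finite
injective dimension as a module over itself (such a local ring is then Cohen-Macaulay). -/
structure IsGorensteinRing (R : Type v) [CommRing R] : Prop where
  isNoetherianRing : IsNoetherianRing R
  finite_injectiveDimension : ∀ (m : Ideal R) [m.IsMaximal], ∃ n : ℕ,
    HasInjectiveDimensionLE
      (ModuleCat.of (Localization.AtPrime m) (Localization.AtPrime m)) n

/-! ### The projective space and its linear automorphisms -/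

attribute [local instance] MvPolynomial.gradedAlgebra

section Projective

variable (k : Type u) [Field k] (n : ℕ)

/-- The grading by degree of `k[x_0, …, x_n]`. -/
abbrev grading : ℕ → Submodule k (MvPolynomial (Fin (n + 1)) k) :=
  MvPolynomial.homogeneousSubmodule (Fin (n + 1)) k

/-- The projective space `P^n` over `k`. -/
abbrev PP : Scheme.{u} := Proj (grading k n)

/-- The structure morphism of `P^n` over `k`. -/
def PP.toSpec : PP k n ⟶ Spec (CommRingCat.of k) :=
  Proj.toSpecZero (grading k n) ≫
    Spec.map (CommRingCat.ofHom (algebraMap k (grading k n 0)))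

variable {k n}

/-- The linear substitution `x_i ↦ ∑ j, M i j x_j`. -/
def linSubst (M : Matrix (Fin (n + 1)) (Fin (n + 1)) k) :
    MvPolynomial (Fin (n + 1)) k →ₐ[k] MvPolynomial (Fin (n + 1)) k :=
  MvPolynomial.aeval fun i => ∑ j, MvPolynomial.C (M i j) * MvPolynomial.X j

lemma linSubst_mem (M : Matrix (Fin (n + 1)) (Fin (n + 1)) k) {d : ℕ}
    {F : MvPolynomial (Fin (n + 1)) k} (hF : F ∈ grading k n d) :
    linSubst M F ∈ grading k n d := by
  rw [MvPolynomial.mem_homogeneousSubmodule] at hF ⊢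
  have h := hF.aeval (fun i => ∑ j, MvPolynomial.C (M i j) * MvPolynomial.X j) (n := 1)
    (fun i => MvPolynomial.IsHomogeneous.sum _ _ _ fun j _ =>
      MvPolynomial.isHomogeneous_C_mul_X _ _)
  simpa [linSubst] using h

lemma linSubst_comp (M N : Matrix (Fin (n + 1)) (Fin (n + 1)) k)
    (F : MvPolynomial (Fin (n + 1)) k) :
    linSubst M (linSubst N F) = linSubst (N * M) F := by
  have h : (linSubst M).comp (linSubst N) = linSubst (N * M) := by
    ext i : 1
    simp only [linSubst, AlgHom.comp_apply, MvPolynomial.aeval_X, map_sum, map_mul,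
      MvPolynomial.aeval_C, Matrix.mul_apply, MvPolynomial.algebraMap_eq, Finset.mul_sum,
      Finset.sum_mul]
    rw [Finset.sum_comm]
    simp only [mul_assoc]
  exact DFunLike.congr_fun h F

lemma linSubst_one (F : MvPolynomial (Fin (n + 1)) k) :
    linSubst (1 : Matrix (Fin (n + 1)) (Fin (n + 1)) k) F = F := by
  have h : linSubst (1 : Matrix (Fin (n + 1)) (Fin (n + 1)) k) = AlgHom.id k _ := by
    ext i : 1
    simp [linSubst, Matrix.one_apply]
  exact DFunLike.congr_fun h F

/-- The linear substitution as a homomorphism of graded rings. -/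
def gradedLinSubst (M : Matrix (Fin (n + 1)) (Fin (n + 1)) k) :
    GradedRingHom (grading k n) (grading k n) where
  toRingHom := (linSubst M).toRingHom
  map_mem := linSubst_mem M

lemma irrelevant_le_map (φ : GL (Fin (n + 1)) k) :
    HomogeneousIdeal.irrelevant (grading k n) ≤
      (HomogeneousIdeal.irrelevant (grading k n)).map
        (gradedLinSubst (φ : Matrix (Fin (n + 1)) (Fin (n + 1)) k)) := by
  rw [HomogeneousIdeal.irrelevant_le]
  intro i hi F hF
  have h : linSubst (φ : Matrix (Fin (n + 1)) (Fin (n + 1)) k)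
      (linSubst ((φ⁻¹ : GL (Fin (n + 1)) k) : Matrix (Fin (n + 1)) (Fin (n + 1)) k) F) = F := by
    rw [linSubst_comp, Units.inv_mul, linSubst_one]
  rw [← h]
  exact Ideal.mem_map_of_mem (gradedLinSubst (φ : Matrix (Fin (n + 1)) (Fin (n + 1)) k))
    (HomogeneousIdeal.mem_irrelevant_of_mem _ hi (linSubst_mem _ hF))

/-- The automorphism of `P^n` given by an invertible matrix, i.e. by its class in `PGL_{n+1}`. -/
def projLinear (φ : GL (Fin (n + 1)) k) : PP k n ⟶ PP k n :=
  Proj.map (gradedLinSubst (φ : Matrix (Fin (n + 1)) (Fin (n + 1)) k)) (irrelevant_le_map φ)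

end Projective

/-! ### Closed subschemes of projective space -/

/-- A closed subscheme of `P^n` over `k`, given by a closed immersion. -/
structure ClosedSubscheme (k : Type u) [Field k] (n : ℕ) where
  /-- the underlying scheme -/
  X : Scheme.{u}
  /-- the closed immersion -/
  ι : X ⟶ PP k n
  /-- `ι` is a closed immersion -/
  isClosedImmersion : IsClosedImmersion ι

namespace ClosedSubscheme

variable {k : Type u} [Field k] {n : ℕ}

/-- The underlying abstract `k`-scheme. -/
def toOver (Z : ClosedSubscheme k n) : Over (Spec (CommRingCat.of k)) :=
  Over.mk (Z.ι ≫ PP.toSpec k n)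

/-- Two closed subschemes of `P^n` are projectively equivalent if some element of `PGL_{n+1}`
carries the first one onto the second one. -/
def ProjectivelyEquivalent (Z W : ClosedSubscheme k n) : Prop :=
  ∃ (φ : GL (Fin (n + 1)) k) (e : Z.X ≅ W.X), e.hom ≫ W.ι = Z.ι ≫ projLinear φ

/-- The restriction to `Z ∩ D₊(x_i)` of the regular function `F / x_i ^ d` on `D₊(x_i)`, for a
form `F` of degree `d`. -/
def restrictForm (Z : ClosedSubscheme k n) (i : Fin (n + 1)) (d : ℕ)
    (F : MvPolynomial (Fin (n + 1)) k) (hF : F ∈ grading k n d) :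
    Γ(Z.X, Z.ι ⁻¹ᵁ Proj.basicOpen (grading k n) (MvPolynomial.X i)) :=
  Z.ι.app (Proj.basicOpen (grading k n) (MvPolynomial.X i))
    (Proj.awayToSection (grading k n) (MvPolynomial.X i)
      (HomogeneousLocalization.Away.mk (grading k n)
        (MvPolynomial.isHomogeneous_X k i : MvPolynomial.X i ∈ grading k n 1) d F
        (by simpa using hF)))

/-- The form `F` of degree `d` vanishes on the scheme `Z`. -/
def Vanishes (Z : ClosedSubscheme k n) (d : ℕ) (F : MvPolynomial (Fin (n + 1)) k)
    (hF : F ∈ grading k n d) : Prop :=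
  ∀ i : Fin (n + 1), Z.restrictForm i d F hF = 0

/-- The homogeneous ideal `I_Z ⊆ k[x_0, …, x_n]`, generated by all forms vanishing on `Z`. -/
def homogeneousIdeal (Z : ClosedSubscheme k n) : Ideal (MvPolynomial (Fin (n + 1)) k) :=
  Ideal.span {F | ∃ (d : ℕ) (hF : F ∈ grading k n d), Z.Vanishes d F hF}

/-- The projective coordinate ring `S_Z = k[x_0, …, x_n] / I_Z`. -/
abbrev coordinateRing (Z : ClosedSubscheme k n) : Type u :=
  MvPolynomial (Fin (n + 1)) k ⧸ Z.homogeneousIdeal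

/-- `Z` is arithmetically Gorenstein if its projective coordinate ring is Gorenstein. -/
def IsArithmeticallyGorenstein (Z : ClosedSubscheme k n) : Prop :=
  IsGorensteinRing Z.coordinateRing

/-- `Z` is non-degenerate if it lies in no hyperplane of `P^n`. -/
def IsNonDegenerate (Z : ClosedSubscheme k n) : Prop :=
  ∀ (F : MvPolynomial (Fin (n + 1)) k) (hF : F ∈ grading k n 1), Z.Vanishes 1 F hF → F = 0

end ClosedSubscheme

/-- The ring homomorphism `k → Γ(X, O_X)` of a `k`-scheme `X`. -/
def globalSectionsHom {k : Type u} [Field k] (X : Over (Spec (CommRingCat.of k))) :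
    k →+* Γ(X.left, ⊤) :=
  ((Scheme.ΓSpecIso (CommRingCat.of k)).inv ≫ X.hom.appTop).hom

/-- The degree `dim_k Γ(X, O_X)` of a `0`-dimensional `k`-scheme `X` of finite type. -/
def degree {k : Type u} [Field k] (X : Over (Spec (CommRingCat.of k))) : ℕ :=
  letI := (globalSectionsHom X).toAlgebra
  Module.finrank k Γ(X.left, ⊤)

/-- The arithmetically Gorenstein, non-degenerate, closed subschemes of `P^n` over `k` of
dimension `0` and degree `d`. -/
structure IsAGPoint {k : Type u} [Field k] {n : ℕ} (d : ℕ) (Z : ClosedSubscheme k n) : Prop where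
  dim_eq : topologicalKrullDim Z.X = 0
  degree_eq : degree Z.toOver = d
  arithmeticallyGorenstein : Z.IsArithmeticallyGorenstein
  nonDegenerate : Z.IsNonDegenerate

/-! ### The twenty algebras -/

section Algebras

variable (k : Type u) [Field k]

/-- The ideal `(x_i x_j - δ_{ij} x_1^{d-n}, x_1^{d-n+1})`, `1 ≤ i ≤ j ≤ n`, `(i, j) ≠ (1, 1)`, of
`k[x_1, …, x_n]`; the variable `x_i` is `X (i - 1)`. -/
def idealA (n d : ℕ) [NeZero n] : Ideal (MvPolynomial (Fin n) k) :=
  Ideal.span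
    ({F | ∃ i j : Fin n, i ≤ j ∧ (i, j) ≠ (0, 0) ∧
        F = MvPolynomial.X i * MvPolynomial.X j
          - (if i = j then MvPolynomial.X 0 ^ (d - n) else 0)} ∪
      {MvPolynomial.X 0 ^ (d - n + 1)})

/-- The algebra `A_{n,d}`, of degree `d`, for `1 ≤ n < d`. -/
abbrev A (n d : ℕ) [NeZero n] : Type u := MvPolynomial (Fin n) k ⧸ idealA k n d

/-- The algebra `A_1^{sp} = k[x_1, x_2] / (x_2^2, x_1^3)`. -/
abbrev A₁sp : Type u :=
  MvPolynomial (Fin 2) k ⧸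
    (Ideal.span {MvPolynomial.X 1 ^ 2, MvPolynomial.X 0 ^ 3} : Ideal (MvPolynomial (Fin 2) k))

/-- The algebra `A_2^{sp} = k[x_1, x_2] / (x_2^2 - x_1^2, x_1^3)`. -/
abbrev A₂sp : Type u :=
  MvPolynomial (Fin 2) k ⧸
    (Ideal.span {MvPolynomial.X 1 ^ 2 - MvPolynomial.X 0 ^ 2, MvPolynomial.X 0 ^ 3} :
      Ideal (MvPolynomial (Fin 2) k))

/-- The twenty algebras; the algebra `A_{0,1}` is `k`, and `Fin m → B` is `B^{⊕ m}`. -/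
def models : Fin 20 → CommAlgCat.{u} k :=
  ![.of k (Fin 6 → k),
    .of k ((Fin 4 → k) × A k 1 2),
    .of k ((Fin 3 → k) × A k 1 3),
    .of k ((Fin 2 → k) × (Fin 2 → A k 1 2)),
    .of k ((Fin 2 → k) × A k 1 4),
    .of k ((Fin 2 → k) × A k 2 4),
    .of k (k × A k 1 2 × A k 1 3),
    .of k (Fin 3 → A k 1 2),
    .of k (k × A k 1 5),
    .of k (k × A k 2 5),
    .of k (k × A k 3 5),
    .of k (A k 1 2 × A k 1 4),
    .of k (A k 1 2 × A k 2 4),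
    .of k (Fin 2 → A k 1 3),
    .of k (A k 1 6),
    .of k (A k 2 6),
    .of k (A k 3 6),
    .of k (A k 4 6),
    .of k (A₁sp k),
    .of k (A₂sp k)]

variable {k} in
/-- The spectrum of a commutative `k`-algebra, as a `k`-scheme. -/
def specOver (B : CommAlgCat.{u} k) : Over (Spec (CommRingCat.of k)) :=
  Over.mk (Spec.map (CommRingCat.ofHom (algebraMap k B)))

end Algebras

end AGor

end

noncomputable section
namespace AGor

/-! ### Local rings of finite injective dimension -/

open Abelian IsLocalRing

/-! Embeddings. Finitely many points avoid some hyperplane, so a zero-dimensional subscheme Spec B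
of P^n lies in an affine chart; its homogeneous coordinates become elements v_0, …, v_n that
generate B and have 1 in their span V (`exists_chart`). If B has dimension n + 2 and the scheme is
nondegenerate, then V is a hyperplane ker μ with V·V = B, and the coordinate ring is the subring k ⊕
Vt ⊕ Bt² ⊕ Bt³ ⊕ … of B[t] (`IsChart.exists_isCone`). Modulo t its graded pieces are k, V/k and B/V,
paired into k by μ in degree 2. This is a perfect pairing exactly when (a, b) ↦ μ(ab) is
nondegenerate on B, and that is the condition for the coordinate ring to be Gorenstein
(`IsChart.isArithmeticallyGorenstein_iff`).

Two nondegenerate functionals on B differ by a unit of B. Multiplying all coordinates by a unit does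
not change the morphism to P^n, so an abstract isomorphism is induced by a linear change of
coordinates (`IsChart.projectivelyEquivalent_of_algEquiv`). Conversely, every Frobenius algebra of
dimension n + 2 ≥ 3 has a nondegenerate functional killing 1, and the kernel of that functional
gives an embedding (`exists_isChart_of_isFrobenius`).

Gorenstein against Frobenius. Finite injective dimension forces simple socles by Ext computations
(`mem_span_of_mem_socle`, and `mem_span_sup_of_mem_socle` after dividing by a regular element). In
the other direction a perfect pairing on Q or on Q/x makes homomorphisms extend, so the injective
dimension is at most 0 or 1 (`IsDualizing.hasInjectiveDimensionLE_zero`,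
`IsDualizing.hasInjectiveDimensionLE_one`).

Classification. A finite Gorenstein algebra is the product of its localizations, which are local
Frobenius algebras with residue field k. Let m be the maximal ideal of such a factor, of dimension
at most 6. If m² = 0, the factor is k or A_{1,2}. If m² is generated by a square x², the annihilator
of x carries a symmetric form with values in the socle, and diagonalizing it gives some A_{n,d}
(`exists_algEquiv_A_of_sq_le`). Otherwise dimension counting forces the Hilbert function (1, 2, 2,
1); multiplication then has a binary quadratic form in its kernel, and its being a square or a
product of independent factors separates A₁sp from A₂sp (`IsBalanced.nonempty_algEquiv`).

The local models are told apart by dimension, by the exponent of nilpotency, and by two properties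
of elements (`HasSquare`, `HasNull`). Idempotents give uniqueness of the factors of a product, and a
finite enumeration of multisets of total dimension 6 produces the twenty algebras. -/

lemma shortExact_mkQ {Q : Type v} [CommRing Q] {M N : Type v} [AddCommGroup M] [Module Q M]
    [AddCommGroup N] [Module Q N] (f : M →ₗ[Q] N) (hf : Function.Injective f) :
    (ModuleCat.shortComplexOfCompEqZero f (LinearMap.range f).mkQ
      f.exact_map_mkQ_range.linearMap_comp_eq_zero).ShortExact :=
  ModuleCat.shortComplex_shortExact _ f.exact_map_mkQ_range hf (Submodule.mkQ_surjective _)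

lemma ext_eq_zero_of_linearEquiv {Q : Type v} [CommRing Q] {M N : Type v} [AddCommGroup M]
    [Module Q M] [AddCommGroup N] [Module Q N] (e : M ≃ₗ[Q] N) {A : ModuleCat.{v} Q} {j : ℕ}
    (h : ∀ x : Ext (ModuleCat.of Q M) A j, x = 0) (x : Ext (ModuleCat.of Q N) A j) : x = 0 := by
  have h1 : (Ext.mk₀ (e.toModuleIso.hom)).comp x (zero_add j) = 0 := h _
  have h2 : (Ext.mk₀ (e.toModuleIso.inv)).comp
      ((Ext.mk₀ (e.toModuleIso.hom)).comp x (zero_add j)) (zero_add j) = x := by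
    rw [Ext.mk₀_comp_mk₀_assoc, Iso.inv_hom_id, Ext.mk₀_id_comp]
  rw [← h2, h1, Ext.comp_zero]

lemma nonempty_linearEquiv_of_isSimpleModule {Q : Type v} [CommRing Q] [IsLocalRing Q]
    (S : Type v) [AddCommGroup S] [Module Q S] [IsSimpleModule Q S] :
    Nonempty (S ≃ₗ[Q] (Q ⧸ maximalIdeal Q)) := by
  obtain ⟨m, hm, ⟨e⟩⟩ := isSimpleModule_iff_quot_maximal.mp (inferInstance : IsSimpleModule Q S)
  obtain rfl := IsLocalRing.eq_maximalIdeal hm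
  exact ⟨e⟩

/-- Over a local ring, if a module of finite injective dimension has no higher extensions by one
nonzero module of finite length, then it has none by any module of finite length. -/
lemma ext_eq_zero_of_isFiniteLength {Q : Type v} [CommRing Q] [IsLocalRing Q]
    (A : ModuleCat.{v} Q) (N : ℕ) [HasInjectiveDimensionLT A N]
    (M₀ : Type v) [AddCommGroup M₀] [Module Q M₀] (hM₀ : IsFiniteLength Q M₀) [Nontrivial M₀]
    (c : ℕ) (h : ∀ j > c, ∀ e : Ext (ModuleCat.of Q M₀) A j, e = 0) (j : ℕ) (hj : c < j)
    (M : Type v) [AddCommGroup M] [Module Q M] (hM : IsFiniteLength Q M)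
    (e : Ext (ModuleCat.of Q M) A j) : e = 0 := by
  -- Descending induction on the degree j, starting from the injective dimension bound; d measures
  -- the distance to it.
  suffices H : ∀ d j, N ≤ j + d → c < j → ∀ (M : Type v) [AddCommGroup M] [Module Q M],
      IsFiniteLength Q M → ∀ e : Ext (ModuleCat.of Q M) A j, e = 0 from
    H N j (by omega) hj M hM e
  intro d
  induction d with
  | zero =>
    intro j hN _ M _ _ _ e
    exact e.eq_zero_of_hasInjectiveDimensionLT N (by simpa using hN)
  | succ d ih =>
    intro j hN hj M _ _ hM
    have hsimple : ∀ e : Ext (ModuleCat.of Q (Q ⧸ maximalIdeal Q)) A j, e = 0 := by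
      have hfl := isFiniteLength_iff_isNoetherian_isArtinian.mp hM₀
      have := hfl.1
      have := hfl.2
      obtain ⟨S, hS⟩ := IsAtomic.exists_atom (Submodule Q M₀)
      have : IsSimpleModule Q S := isSimpleModule_iff_isAtom.mpr hS
      obtain ⟨i⟩ := nonempty_linearEquiv_of_isSimpleModule (Q := Q) S
      refine ext_eq_zero_of_linearEquiv i fun x => ?_
      have hex := shortExact_mkQ S.subtype S.injective_subtype
      -- For a simple S ⊆ M₀, the group Ext^j(S, A) sits between Ext^j(M₀, A), zero by hypothesis,
      -- and Ext^{j+1}(M₀/S, A), zero by induction. So Ext^j of the residue field vanishes, and a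
      -- composition series handles every module of finite length.
      have hz : hex.extClass.comp x (add_comm 1 j) = 0 :=
        ih (j + 1) (by omega) (by omega) _ (hM₀.of_surjective (Submodule.mkQ_surjective _)) _
      obtain ⟨y, hy⟩ := Ext.contravariant_sequence_exact₁ hex A x (add_comm 1 j) hz
      rw [← hy, h j hj y, Ext.comp_zero]
    induction hM with
    | of_subsingleton =>
      intro e
      rw [← Ext.mk₀_id_comp e, (ModuleCat.isZero_of_subsingleton (ModuleCat.of Q _)).eq_of_src
        (𝟙 _) 0, Ext.mk₀_zero, Ext.zero_comp]
    | @of_simple_quotient M _ _ S _ _ ihS =>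
      intro e
      have hex := shortExact_mkQ S.subtype S.injective_subtype
      obtain ⟨y, hy⟩ := Ext.contravariant_sequence_exact₂ hex A e (ihS _)
      obtain ⟨i⟩ := nonempty_linearEquiv_of_isSimpleModule (Q := Q) (M ⧸ S)
      have hy0 : y = 0 := ext_eq_zero_of_linearEquiv
        (i.symm.trans (Submodule.quotEquivOfEq _ _ S.range_subtype.symm)) hsimple y
      rw [← hy, hy0, Ext.comp_zero]

/-- The map from the residue field given by an element killed by the maximal ideal. -/
def residueMap {Q : Type v} [CommRing Q] [IsLocalRing Q] {M : Type v} [AddCommGroup M]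
    [Module Q M] (b : M) (hb : ∀ r ∈ maximalIdeal Q, r • b = 0) :
    (Q ⧸ maximalIdeal Q) →ₗ[Q] M :=
  Submodule.liftQ _ (LinearMap.toSpanSingleton Q M b) fun r hr => by simpa using hb r hr

lemma residueMap_injective {Q : Type v} [CommRing Q] [IsLocalRing Q] {M : Type v}
    [AddCommGroup M] [Module Q M] (b : M) (hb : ∀ r ∈ maximalIdeal Q, r • b = 0) (hb0 : b ≠ 0) :
    Function.Injective (residueMap b hb) := by
  rw [← LinearMap.ker_eq_bot, residueMap, Submodule.ker_liftQ_eq_bot]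
  intro r hr
  by_contra hr'
  have hu : IsUnit r := by simpa using hr'
  rw [LinearMap.mem_ker, LinearMap.toSpanSingleton_apply] at hr
  exact hb0 ((hu.smul_eq_zero).mp hr)

lemma residueMap_one {Q : Type v} [CommRing Q] [IsLocalRing Q] {M : Type v} [AddCommGroup M]
    [Module Q M] (b : M) (hb : ∀ r ∈ maximalIdeal Q, r • b = 0) :
    residueMap b hb (Submodule.Quotient.mk 1) = b :=
  (Submodule.liftQ_apply _ _ _).trans (one_smul Q b)

/-- An Artinian local ring of finite injective dimension over itself has a simple socle. -/
theorem mem_span_of_mem_socle {Q : Type v} [CommRing Q] [IsLocalRing Q] [IsArtinianRing Q] {N : ℕ}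
    (h : HasInjectiveDimensionLE (ModuleCat.of Q Q) N) {a b : Q}
    (ha : ∀ r ∈ maximalIdeal Q, r * a = 0) (hb : ∀ r ∈ maximalIdeal Q, r * b = 0) (hb0 : b ≠ 0) :
    ∃ q, a = q * b := by
  have hfl : IsFiniteLength Q Q := isFiniteLength_iff_isNoetherian_isArtinian.mpr
    ⟨inferInstance, inferInstance⟩
  have hex := shortExact_mkQ (residueMap b hb) (residueMap_injective b hb hb0)
  -- The free module Q has finite length and no higher Ext, so Ext^1(−, Q) vanishes on modules of
  -- finite length. Hence the map from the residue field to Q hitting a extends along the one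
  -- hitting b, to an endomorphism of Q, which is a multiplication.
  have hz : hex.extClass.comp (Ext.mk₀ (ModuleCat.ofHom (residueMap a ha))) (add_zero 1) = 0 :=
    ext_eq_zero_of_isFiniteLength (ModuleCat.of Q Q) (N + 1) Q hfl 0
      (fun j hj e => by
        obtain ⟨j, rfl⟩ := Nat.exists_eq_succ_of_ne_zero (Nat.pos_iff_ne_zero.mp hj)
        exact e.eq_zero_of_projective) 1 one_pos _
      (hfl.of_surjective (Submodule.mkQ_surjective _)) _
  obtain ⟨y, hy⟩ := Ext.contravariant_sequence_exact₁ hex _ _ (add_zero 1) hz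
  obtain ⟨g, rfl⟩ := (Ext.mk₀_bijective _ _).2 y
  rw [Ext.mk₀_comp_mk₀] at hy
  have hg := congrArg (fun φ => φ.hom (Submodule.Quotient.mk (1 : Q)))
    ((Ext.mk₀_bijective _ _).1 hy)
  have h1 : g.hom b = a := by
    exact (congrArg g.hom (residueMap_one b hb).symm).trans (hg.trans (residueMap_one a ha))
  refine ⟨g.hom 1, ?_⟩
  have h2 : g.hom (b • (1 : Q)) = b • g.hom 1 := g.hom.map_smul b 1
  rw [← h1, mul_comm]
  simpa using h2

/-- If `x` is a regular element of a local ring `Q` of finite injective dimension over itself and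
`Q / x` is Artinian, then `Q / x` has a simple socle. -/
theorem mem_span_sup_of_mem_socle {Q : Type v} [CommRing Q] [IsLocalRing Q] {N : ℕ}
    (h : HasInjectiveDimensionLE (ModuleCat.of Q Q) N) {x : Q} (hx : x ∈ maximalIdeal Q)
    (hreg : ∀ q, x * q = 0 → q = 0) (hfl : IsFiniteLength Q (Q ⧸ Ideal.span {x})) {a b : Q}
    (ha : ∀ r ∈ maximalIdeal Q, r * a ∈ Ideal.span {x})
    (hb : ∀ r ∈ maximalIdeal Q, r * b ∈ Ideal.span {x}) (hb0 : b ∉ Ideal.span {x}) :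
    ∃ q, a - q * b ∈ Ideal.span {x} := by
  let mulx : Q →ₗ[Q] Q := LinearMap.mulLeft Q x
  have hinj : Function.Injective mulx := by
    rw [← LinearMap.ker_eq_bot, LinearMap.ker_eq_bot']
    exact hreg
  have hT := shortExact_mkQ mulx hinj
  have hrange : LinearMap.range mulx = Ideal.span {x} := by
    ext y
    simp [mulx, Ideal.mem_span_singleton', mul_comm]
  let D := Q ⧸ LinearMap.range mulx
  replace hfl : IsFiniteLength Q D := (Submodule.quotEquivOfEq _ _ hrange.symm).isFiniteLength hfl
  rw [← hrange] at ha hb hb0 ⊢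
  have hnt : Nontrivial D := by
    refine Submodule.Quotient.nontrivial_iff.mpr fun h => hb0 ?_
    rw [h]
    trivial
  have ha' : ∀ r ∈ maximalIdeal Q, r • (Submodule.Quotient.mk a : D) = 0 := fun r hr => by
    rw [← Submodule.Quotient.mk_smul, Submodule.Quotient.mk_eq_zero]
    exact ha r hr
  have hb' : ∀ r ∈ maximalIdeal Q, r • (Submodule.Quotient.mk b : D) = 0 := fun r hr => by
    rw [← Submodule.Quotient.mk_smul, Submodule.Quotient.mk_eq_zero]
    exact hb r hr
  have hb0' : (Submodule.Quotient.mk b : D) ≠ 0 := by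
    rwa [Ne, Submodule.Quotient.mk_eq_zero]
  have hS := shortExact_mkQ (residueMap _ hb') (residueMap_injective _ hb' hb0')
  -- The resolution 0 → Q → Q → D → 0 gives Ext^j(D, Q) = 0 for j ≥ 2, and D serves as the test
  -- module of finite length.
  have hvan := ext_eq_zero_of_isFiniteLength (ModuleCat.of Q Q) (N + 1) D hfl 1 (fun j hj e => by
    obtain ⟨j, rfl⟩ := Nat.exists_eq_add_of_lt hj
    obtain ⟨y, hy⟩ := Ext.contravariant_sequence_exact₃ hT _ e
      (Ext.eq_zero_of_projective (n := 1 + j) _) (n₀ := 1 + j) (by omega)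
    rw [← hy]
    have hproj : ∀ (i : ℕ) (_ : 0 < i) (y : Ext (ModuleCat.of Q Q) (ModuleCat.of Q Q) i),
        y = 0 := fun i hi y => by
      obtain ⟨i, rfl⟩ := Nat.exists_eq_succ_of_ne_zero hi.ne'
      exact y.eq_zero_of_projective
    rw [hproj _ (by omega) y, Ext.comp_zero])
  let f : ModuleCat.of Q (Q ⧸ maximalIdeal Q) ⟶ ModuleCat.of Q D :=
    ModuleCat.ofHom (residueMap _ ha')
  -- The rest imitates the previous theorem with Ext^1(−, Q) in place of Hom(−, D). The class α of f
  -- in Ext^1 of the residue field extends along s to a class e on D, since the obstruction lies in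
  -- an Ext^2.
  let α := (Ext.mk₀ f).comp hT.extClass (zero_add 1)
  obtain ⟨e, he⟩ := Ext.contravariant_sequence_exact₁ hS _ α (n₁ := 2) rfl
    (hvan 2 one_lt_two _ (hfl.of_surjective (Submodule.mkQ_surjective _)) _)
  have hxD : (x • 𝟙 (ModuleCat.of Q D)) = 0 := by
    refine ModuleCat.hom_ext (LinearMap.ext fun d => ?_)
    obtain ⟨d, rfl⟩ := Submodule.Quotient.mk_surjective _ d
    exact (Submodule.Quotient.mk_eq_zero _).mpr ⟨d, rfl⟩
  have hmulx : ModuleCat.ofHom mulx = x • 𝟙 (ModuleCat.of Q Q) := by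
    ext
    simp [mulx]
  -- Since x kills D it kills e, so e is the image under the connecting map of an endomorphism g of
  -- D.
  have hex0 : e.comp (Ext.mk₀ (ModuleCat.ofHom mulx)) (add_zero 1) = 0 := by
    rw [hmulx, Ext.mk₀_smul, Ext.comp_smul, Ext.comp_mk₀_id, ← Ext.mk₀_id_comp e,
      ← Ext.smul_comp, ← Ext.mk₀_smul]
    erw [hxD]
    rw [Ext.mk₀_zero, Ext.zero_comp]
  obtain ⟨g, hg⟩ := Ext.covariant_sequence_exact₁ (ModuleCat.of Q D) hT e hex0 (zero_add 1)
  obtain ⟨g, rfl⟩ := (Ext.mk₀_bijective _ _).2 g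
  let s : ModuleCat.of Q (Q ⧸ maximalIdeal Q) ⟶ ModuleCat.of Q D :=
    ModuleCat.ofHom (residueMap _ hb')
  have hδ : (Ext.mk₀ (f - s ≫ g)).comp hT.extClass (zero_add 1) = 0 := by
    rw [sub_eq_add_neg, Ext.mk₀_add, Ext.mk₀_neg, Ext.add_comp, Ext.neg_comp, ← sub_eq_add_neg,
      sub_eq_zero, ← Ext.mk₀_comp_mk₀_assoc]
    erw [hg, he]
  obtain ⟨y, hy⟩ := Ext.covariant_sequence_exact₃ _ hT _ (zero_add 1) hδ
  obtain ⟨y, rfl⟩ := (Ext.mk₀_bijective _ _).2 y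
  -- The difference of f and s ≫ g lifts to a map from the residue field to Q; x kills its image and
  -- is regular, so the lift is zero.
  have hy0 : y = 0 := by
    refine ModuleCat.hom_ext (LinearMap.ext fun t => hreg _ ?_)
    obtain ⟨t, rfl⟩ := Submodule.Quotient.mk_surjective _ t
    have : y.hom (x • Submodule.Quotient.mk t) = x • y.hom (Submodule.Quotient.mk t) :=
      y.hom.map_smul x _
    rw [← Submodule.Quotient.mk_smul, (Submodule.Quotient.mk_eq_zero _).mpr
      (show x • t ∈ maximalIdeal Q from Ideal.mul_mem_right t _ hx), map_zero] at this
    exact this.symm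
  rw [hy0, Ext.mk₀_zero, Ext.zero_comp] at hy
  have hfs : f = s ≫ g := by
    rw [← sub_eq_zero]
    apply (Ext.mk₀_bijective _ _).1
    rw [← hy, Ext.mk₀_zero]
  have h1 := congrArg (fun φ => φ.hom (Submodule.Quotient.mk (1 : Q))) hfs
  have h2 : (Submodule.Quotient.mk a : D) = g.hom (Submodule.Quotient.mk b) := by
    exact (residueMap_one _ ha').symm.trans (h1.trans (congrArg g.hom (residueMap_one _ hb')))
  obtain ⟨q, hq⟩ := Submodule.Quotient.mk_surjective _ (g.hom (Submodule.Quotient.mk (1 : Q)))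
  refine ⟨q, ?_⟩
  rw [← Submodule.Quotient.mk_eq_zero, Submodule.Quotient.mk_sub, sub_eq_zero, h2]
  have h3 : g.hom (b • (Submodule.Quotient.mk (1 : Q) : D)) = b • g.hom (Submodule.Quotient.mk 1) :=
    g.hom.map_smul b _
  rw [← hq, ← Submodule.Quotient.mk_smul, ← Submodule.Quotient.mk_smul, smul_eq_mul, mul_one,
    smul_eq_mul, mul_comm] at h3
  exact h3

end AGor
end

noncomputable section
namespace AGor

/-! ### Gorenstein rings from dualizing functionals -/

open IsLocalRing

/-- A functional `μ` on the `k`-algebra `Q` induces a perfect pairing on `Q / x`. -/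
def IsDualizing {k : Type u} [Field k] {Q : Type v} [CommRing Q] [Algebra k Q] (x : Q)
    (μ : Q →ₗ[k] k) : Prop :=
  ∀ q, (∀ c, μ (q * c) = 0) ↔ q ∈ Ideal.span {x}

section

variable {k : Type u} [Field k] {Q : Type v} [CommRing Q] [Algebra k Q] {x : Q} {μ : Q →ₗ[k] k}

lemma IsDualizing.apply_eq_zero (h : IsDualizing x μ) {q : Q} (hq : q ∈ Ideal.span {x}) :
    μ q = 0 := by
  simpa using (h q).2 hq 1

/-- Every functional on `Q / x` is represented by an element. -/
lemma IsDualizing.exists_eq (h : IsDualizing x μ) [Module.Finite k (Q ⧸ Ideal.span {x})]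
    (g : Q →ₗ[k] k) (hg : ∀ q ∈ Ideal.span {x}, g q = 0) : ∃ q, ∀ c, g c = μ (q * c) := by
  let D := Q ⧸ Ideal.span {x}
  let lift (f : Q →ₗ[k] k) (hf : ∀ q ∈ Ideal.span {x}, f q = 0) : D →ₗ[k] k :=
    Submodule.liftQ ((Ideal.span {x}).restrictScalars k) f hf
  let μ' : D →ₗ[k] k := lift μ fun q hq => h.apply_eq_zero hq
  have hμ' : ∀ q : Q, μ' (Ideal.Quotient.mk _ q) = μ q := fun q => rfl
  let φ : D →ₗ[k] Module.Dual k D := (LinearMap.mul k D).compr₂ μ'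
  have hφ : ∀ a b : D, φ a b = μ' (a * b) := fun a b => rfl
  have hinj : Function.Injective φ := by
    rw [← LinearMap.ker_eq_bot, LinearMap.ker_eq_bot']
    intro d hd
    obtain ⟨q, rfl⟩ := Ideal.Quotient.mk_surjective d
    rw [Ideal.Quotient.eq_zero_iff_mem, ← h]
    intro c
    rw [← hμ', map_mul, ← hφ, hd, LinearMap.zero_apply]
  have hsurj : Function.Surjective φ :=
    (LinearMap.injective_iff_surjective_of_finrank_eq_finrank Subspace.dual_finrank_eq.symm).1 hinj
  obtain ⟨d, hd⟩ := hsurj (lift g hg)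
  obtain ⟨q, rfl⟩ := Ideal.Quotient.mk_surjective d
  refine ⟨q, fun c => ?_⟩
  rw [← hμ', map_mul, ← hφ, hd]
  rfl

/-- A homomorphism from a submodule of a free module to `Q` extends modulo `x`. -/
lemma IsDualizing.exists_extend_mod (h : IsDualizing x μ) [Module.Finite k (Q ⧸ Ideal.span {x})]
    {F : Type*} [AddCommGroup F] [Module Q F] [Module.Free Q F] [Module.Finite Q F]
    (K : Submodule Q F) (hK : ∀ f, x • f ∈ K → ∃ f' ∈ K, x • f = x • f') (f : K →ₗ[Q] Q) :
    ∃ G : F →ₗ[Q] Q, ∀ a : K, f a - G a ∈ Ideal.span {x} := by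
  let : Module k F := Module.compHom F (algebraMap k Q)
  have : IsScalarTower k Q F := IsScalarTower.of_algebraMap_smul fun _ _ => rfl
  let X : Submodule k F := (LinearMap.range (LinearMap.lsmul Q F x)).restrictScalars k
  let p : K.restrictScalars k →ₗ[k] F ⧸ X := X.mkQ ∘ₗ (K.restrictScalars k).subtype
  let g₀ : Module.Dual k (K.restrictScalars k) := μ ∘ₗ f.restrictScalars k
  -- By `hK`, f maps K ∩ xF into xQ, where μ vanishes. So μ ∘ f factors through the image of K in
  -- F/xF and extends k-linearly to all of F/xF.
  have hg₀ : g₀ ∈ LinearMap.range p.dualMap := by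
    rw [LinearMap.range_dualMap_eq_dualAnnihilator_ker, Submodule.mem_dualAnnihilator]
    rintro ⟨a, ha⟩ hpa
    obtain ⟨b, rfl⟩ : a ∈ X := (Submodule.Quotient.mk_eq_zero X).mp hpa
    obtain ⟨b', hb', hbb'⟩ := hK b ha
    have : (⟨LinearMap.lsmul Q F x b, ha⟩ : K) = x • ⟨b', hb'⟩ := Subtype.ext hbb'
    refine (congrArg (fun a => μ (f a)) this).trans (h.apply_eq_zero ?_)
    rw [map_smul]
    exact Ideal.mul_mem_right _ _ (Ideal.mem_span_singleton_self x)
  obtain ⟨g, hg⟩ := hg₀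
  let b := Module.Free.chooseBasis Q F
  have hrep : ∀ i, ∃ q, ∀ c : Q, g (X.mkQ (c • b i)) = μ (q * c) := fun i => by
    refine h.exists_eq
      (g ∘ₗ X.mkQ ∘ₗ (LinearMap.toSpanSingleton Q F (b i)).restrictScalars k) fun q hq => ?_
    obtain ⟨r, rfl⟩ := Ideal.mem_span_singleton'.mp hq
    have : X.mkQ ((r * x) • b i) = 0 :=
      (Submodule.Quotient.mk_eq_zero X).mpr ⟨r • b i, by simp [smul_smul, mul_comm]⟩
    simp only [LinearMap.comp_apply, LinearMap.coe_restrictScalars,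
      LinearMap.toSpanSingleton_apply, this, map_zero]
  choose q hq using hrep
  let G : F →ₗ[Q] Q := b.constr ℕ q
  have hG : ∀ a, g (X.mkQ a) = μ (G a) := by
    intro a
    rw [← b.sum_repr a]
    simp only [map_sum, hq, map_smul, G, Module.Basis.constr_basis, smul_eq_mul]
    exact Finset.sum_congr rfl fun i _ => by rw [mul_comm]
  -- Only μ ∘ f = μ ∘ G on K is known so far; because K is stable under Q, testing on c • a for all
  -- c upgrades it to a congruence modulo x.
  refine ⟨G, fun a => (h _).1 fun c => ?_⟩
  have h1 : g (X.mkQ (c • a : K)) = μ (f (c • a)) := LinearMap.congr_fun hg (c • a)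
  have h2 := hG (c • a : K)
  rw [h1] at h2
  simp only [map_smul, Submodule.coe_smul, smul_eq_mul] at h2
  rw [sub_mul, map_sub, mul_comm, h2, mul_comm, sub_self]

/-- A finite-dimensional algebra with a perfect pairing is self-injective. -/
lemma IsDualizing.baer (h : IsDualizing (0 : Q) μ)
    [Module.Finite k (Q ⧸ Ideal.span {(0 : Q)})] : Module.Baer Q Q := by
  intro I g
  obtain ⟨G, hG⟩ := h.exists_extend_mod I (fun f _ => ⟨0, zero_mem _, by simp⟩) g
  refine ⟨G, fun a ha => ?_⟩
  have := hG ⟨a, ha⟩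
  rw [Ideal.span_singleton_eq_bot.mpr rfl, Ideal.mem_bot, sub_eq_zero] at this
  exact this.symm

lemma IsDualizing.hasInjectiveDimensionLE_zero (h : IsDualizing (0 : Q) μ)
    [Module.Finite k (Q ⧸ Ideal.span {(0 : Q)})] :
    HasInjectiveDimensionLE (ModuleCat.of Q Q) 0 := by
  have := h.baer.injective
  have := (Module.injective_iff_injective_object Q Q).mp this
  change HasInjectiveDimensionLT _ (0 + 1)
  infer_instance

/-- If `x` is a regular element in the Jacobson radical, the extension modulo `x` can be
improved to an extension. -/
lemma IsDualizing.exists_extend (h : IsDualizing x μ) [Module.Finite k (Q ⧸ Ideal.span {x})]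
    [IsNoetherianRing Q] (hx : x ∈ Ideal.jacobson (⊥ : Ideal Q)) (hreg : ∀ q, x * q = 0 → q = 0)
    {F : Type*} [AddCommGroup F] [Module Q F] [Module.Free Q F] [Module.Finite Q F]
    (K : Submodule Q F) (hK : ∀ f, x • f ∈ K → f ∈ K) (f : K →ₗ[Q] Q) :
    ∃ G : F →ₗ[Q] Q, ∀ a : K, f a = G a := by
  let res : (F →ₗ[Q] Q) →ₗ[Q] (K →ₗ[Q] Q) := LinearMap.lcomp Q Q K.subtype
  have hinj : Function.Injective (LinearMap.mulLeft Q x) := by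
    rw [← LinearMap.ker_eq_bot, LinearMap.ker_eq_bot']
    exact hreg
  suffices H : (⊤ : Submodule Q (K →ₗ[Q] Q)) ≤ LinearMap.range res by
    obtain ⟨G, rfl⟩ := H (Submodule.mem_top : f ∈ _)
    exact ⟨G, fun a => rfl⟩
  -- Nakayama for Hom(K, Q): every f is a restriction plus x times another homomorphism, the
  -- division by x being possible because x is regular.
  refine Submodule.le_of_le_smul_of_le_jacobson_bot (I := Ideal.span {x}) Module.Finite.fg_top
    ((Ideal.span_singleton_le_iff_mem _).mpr hx) fun f _ => ?_
  obtain ⟨G, hG⟩ := h.exists_extend_mod K (fun f hf => ⟨f, hK f hf, rfl⟩) f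
  have hrange : ∀ a, (f - res G) a ∈ LinearMap.range (LinearMap.mulLeft Q x) := fun a => by
    obtain ⟨r, hr⟩ := Ideal.mem_span_singleton'.mp (hG a)
    exact ⟨r, by rw [LinearMap.mulLeft_apply, mul_comm, hr]; rfl⟩
  let e := LinearEquiv.ofInjective _ hinj
  let f₁ : K →ₗ[Q] Q := e.symm.toLinearMap ∘ₗ LinearMap.codRestrict _ (f - res G) hrange
  have hf₁ : f - res G = x • f₁ := by
    ext a
    have := congrArg Subtype.val (e.apply_symm_apply ⟨_, hrange a⟩)
    exact this.symm
  rw [← sub_add_cancel f (res G), add_comm, hf₁]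
  exact Submodule.add_mem_sup ⟨G, rfl⟩
    (Submodule.smul_mem_smul (Ideal.mem_span_singleton_self x) Submodule.mem_top)

/-- Embed Q in an injective E and check Baer's criterion for E/Q. Given I → E/Q, cover I by a free
module F with kernel K and lift to F → E. The lift sends K into Q, this restriction extends to F → Q
by `exists_extend`, and subtracting the extension gives a lift I → E. The extension lemma applies
because F/K ≅ I ⊆ Q has no x-torsion. -/
theorem IsDualizing.hasInjectiveDimensionLE_one (h : IsDualizing x μ)
    [Module.Finite k (Q ⧸ Ideal.span {x})] [IsNoetherianRing Q]
    (hx : x ∈ Ideal.jacobson (⊥ : Ideal Q)) (hreg : ∀ q, x * q = 0 → q = 0) :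
    HasInjectiveDimensionLE (ModuleCat.of Q Q) 1 := by
  obtain ⟨E, hE, ι, hι⟩ := EnoughInjectives.presentation (ModuleCat.of Q Q)
  have hιinj : Function.Injective ι.hom := (ModuleCat.mono_iff_injective ι).mp hι
  have hS := shortExact_mkQ ι.hom hιinj
  have hEinj : Module.Injective Q E := Module.injective_module_of_injective_object Q E
  let C := E ⧸ LinearMap.range ι.hom
  have hC : Module.Baer Q C := by
    intro I g
    obtain ⟨n, π, hπ⟩ := Module.Finite.exists_fin' Q I
    obtain ⟨h₁, hh₁⟩ := Module.projective_lifting_property (LinearMap.range ι.hom).mkQ (g ∘ₗ π)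
      (Submodule.mkQ_surjective _)
    have hh₁' : ∀ a, (Submodule.Quotient.mk (h₁ a) : C) = g (π a) :=
      fun a => LinearMap.congr_fun hh₁ a
    let K := LinearMap.ker π
    have hK : ∀ f, x • f ∈ K → f ∈ K := fun f hf => by
      rw [LinearMap.mem_ker] at hf ⊢
      rw [map_smul] at hf
      exact Subtype.ext (hreg _ (congrArg Subtype.val hf))
    have hr : ∀ a : K, h₁ a ∈ LinearMap.range ι.hom := fun a => by
      rw [← Submodule.Quotient.mk_eq_zero, hh₁', LinearMap.mem_ker.mp a.2, map_zero]
    let e := LinearEquiv.ofInjective _ hιinj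
    obtain ⟨G, hG⟩ := h.exists_extend hx hreg K hK
      (e.symm.toLinearMap ∘ₗ LinearMap.codRestrict _ (h₁ ∘ₗ K.subtype) hr)
    have hker : LinearMap.ker π ≤ LinearMap.ker (h₁ - ι.hom ∘ₗ G) := fun a ha => by
      have h2 := congrArg Subtype.val (e.apply_symm_apply ⟨_, hr ⟨a, ha⟩⟩)
      rw [LinearMap.mem_ker, LinearMap.sub_apply, sub_eq_zero, LinearMap.comp_apply,
        ← hG ⟨a, ha⟩]
      exact h2.symm
    let g' : I →ₗ[Q] E := (Submodule.liftQ _ _ hker) ∘ₗ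
      (π.quotKerEquivOfSurjective hπ).symm.toLinearMap
    have hg' : ∀ a, g' (π a) = h₁ a - ι.hom (G a) := fun a => by
      have : (π.quotKerEquivOfSurjective hπ).symm (π a) = Submodule.Quotient.mk a := by
        rw [LinearEquiv.symm_apply_eq]
        rfl
      simp only [g', LinearMap.comp_apply, LinearEquiv.coe_coe, this]
      rfl
    obtain ⟨φ, hφ⟩ := Module.Baer.of_injective hEinj I g'
    refine ⟨(LinearMap.range ι.hom).mkQ ∘ₗ φ, fun a ha => ?_⟩
    obtain ⟨f, hf⟩ := hπ ⟨a, ha⟩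
    rw [LinearMap.comp_apply, hφ a ha, ← hf, hg', map_sub, ← hh₁']
    refine sub_eq_self.mpr ?_
    exact (Submodule.Quotient.mk_eq_zero _).mpr ⟨_, rfl⟩
  have hCinj : Injective (ModuleCat.of Q C) :=
    (Module.injective_iff_injective_object Q C).mp hC.injective
  exact hS.hasInjectiveDimensionLT_X₁ 1 (inferInstanceAs (HasInjectiveDimensionLT
    (ModuleCat.of Q C) 1)) (inferInstanceAs (HasInjectiveDimensionLT E 2))

variable (k) in
/-- The quotient of the localization at a prime by an element. -/
def localizationQuotient (x : Q) (p : Ideal Q) [p.IsPrime] :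
    Q →ₐ[k] Localization.AtPrime p ⧸ Ideal.span {algebraMap Q (Localization.AtPrime p) x} :=
  (Ideal.Quotient.mkₐ k _).comp (IsScalarTower.toAlgHom k Q (Localization.AtPrime p))

lemma localizationQuotient_eq_zero_iff (p : Ideal Q) [p.IsPrime] (r : Q) :
    localizationQuotient k x p r = 0 ↔ ∃ s ∉ p, s * r ∈ Ideal.span {x} := by
  have h1 : localizationQuotient k x p r = 0 ↔
      algebraMap Q (Localization.AtPrime p) r ∈
        (Ideal.span {x}).map (algebraMap Q (Localization.AtPrime p)) := by
    rw [Ideal.map_span, Set.image_singleton]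
    exact Ideal.Quotient.eq_zero_iff_mem
  rw [h1, IsLocalization.algebraMap_mem_map_algebraMap_iff p.primeCompl]
  rfl

/-- Q/x is Artinian, so s^n = s^{n+1} y modulo x for some n and y; once s is inverted, y is its
inverse, and no denominators are needed. -/
lemma localizationQuotient_surjective (p : Ideal Q) [p.IsPrime]
    [Module.Finite k (Q ⧸ Ideal.span {x})] :
    Function.Surjective (localizationQuotient k x p) := by
  intro d
  obtain ⟨q, rfl⟩ := Ideal.Quotient.mk_surjective d
  obtain ⟨⟨r, s⟩, hrs⟩ := IsLocalization.surj p.primeCompl q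
  have : IsArtinianRing (Q ⧸ Ideal.span {x}) := IsArtinianRing.of_finite k _
  obtain ⟨n, y, hy⟩ := IsArtinian.exists_pow_succ_smul_dvd (R := Q ⧸ Ideal.span {x})
    (M := Q ⧸ Ideal.span {x}) (Ideal.Quotient.mk _ (s : Q)) 1
  obtain ⟨y, rfl⟩ := Ideal.Quotient.mk_surjective y
  have h1 : localizationQuotient k x p (s * y - 1) = 0 := by
    refine (localizationQuotient_eq_zero_iff p _).2
      ⟨s ^ n, fun hs => s.2 (Ideal.IsPrime.mem_of_pow_mem ‹_› _ hs), ?_⟩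
    rw [← Ideal.Quotient.eq_zero_iff_mem]
    simp only [smul_eq_mul, mul_one] at hy
    simp only [map_mul, map_sub, map_pow, mul_sub, mul_one, ← mul_assoc, ← pow_succ,
      hy, sub_self]
  rw [map_sub, map_mul, map_one, sub_eq_zero] at h1
  have h2 : (Ideal.Quotient.mk _ q) * localizationQuotient k x p s =
      localizationQuotient k x p r := by
    rw [← show Ideal.Quotient.mk _ (algebraMap Q _ r) = localizationQuotient k x p r from rfl,
      ← hrs, map_mul]
    rfl
  refine ⟨r * y, ?_⟩
  rw [map_mul, ← h2, mul_assoc, h1, mul_one]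

lemma finite_localization_quotient (p : Ideal Q) [p.IsPrime]
    [Module.Finite k (Q ⧸ Ideal.span {x})] : Module.Finite k
      (Localization.AtPrime p ⧸ Ideal.span {algebraMap Q (Localization.AtPrime p) x}) := by
  have hle : ∀ q ∈ Ideal.span {x}, localizationQuotient k x p q = 0 := fun q hq =>
    (localizationQuotient_eq_zero_iff p q).2
      ⟨1, fun h => Ideal.IsPrime.ne_top ‹_› ((Ideal.eq_top_iff_one _).2 h), by simpa using hq⟩
  refine Module.Finite.of_surjective
    (Ideal.Quotient.liftₐ (Ideal.span {x}) _ hle).toLinearMap fun d => ?_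
  obtain ⟨q, rfl⟩ := localizationQuotient_surjective (k := k) p d
  exact ⟨Ideal.Quotient.mk _ q, rfl⟩

lemma localization_mul_eq_zero (hreg : ∀ q, x * q = 0 → q = 0) (p : Ideal Q) [p.IsPrime]
    (q : Localization.AtPrime p) (hq : algebraMap Q _ x * q = 0) : q = 0 := by
  obtain ⟨r, s, rfl⟩ := IsLocalization.exists_mk'_eq p.primeCompl q
  rw [← IsLocalization.mk'_one (M := p.primeCompl), ← IsLocalization.mk'_mul,
    IsLocalization.mk'_eq_zero_iff] at hq
  obtain ⟨t, ht⟩ := hq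
  rw [IsLocalization.mk'_eq_zero_iff]
  exact ⟨t, hreg _ (by rw [← ht]; ring)⟩

/-- Dualizing functionals localize. -/
lemma IsDualizing.exists_localization (h : IsDualizing x μ)
    [Module.Finite k (Q ⧸ Ideal.span {x})] [IsNoetherianRing Q] (p : Ideal Q) [p.IsPrime] :
    ∃ μ' : Localization.AtPrime p →ₗ[k] k, IsDualizing (algebraMap Q _ x) μ' := by
  let L := Localization.AtPrime p
  let I : Ideal L := Ideal.span {algebraMap Q L x}
  let π : Q →ₐ[k] L ⧸ I := localizationQuotient k x p
  have hπ0 : ∀ r, π r = 0 ↔ ∃ s ∉ p, s * r ∈ Ideal.span {x} := localizationQuotient_eq_zero_iff p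
  have hsurj : Function.Surjective π := localizationQuotient_surjective p
  -- The kernel of π is finitely generated, so one denominator s outside p moves all of it into (x).
  obtain ⟨s, hs, hsJ⟩ : ∃ s ∉ p, ∀ r, π r = 0 → s * r ∈ Ideal.span {x} := by
    obtain ⟨T, hT⟩ := (inferInstance : IsNoetherian Q Q).noetherian (RingHom.ker π)
    have hT' : ∀ r ∈ T, π r = 0 := fun r hr => by
      have : r ∈ RingHom.ker π := hT ▸ Submodule.subset_span hr
      exact this
    have key : ∀ T' : Finset Q, (∀ r ∈ T', π r = 0) → ∃ s ∉ p, ∀ r ∈ T', s * r ∈ Ideal.span {x} := by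
      classical
      intro T'
      induction T' using Finset.induction_on with
      | empty => exact fun _ => ⟨1, fun h => Ideal.IsPrime.ne_top ‹_› ((Ideal.eq_top_iff_one _).2 h),
          by simp⟩
      | insert a T' _ ih =>
        intro hT'
        obtain ⟨s, hs, hs'⟩ := ih fun r hr => hT' r (Finset.mem_insert_of_mem hr)
        obtain ⟨t, ht, ht'⟩ := (hπ0 a).1 (hT' a (Finset.mem_insert_self _ _))
        refine ⟨s * t, fun h => (Ideal.IsPrime.mem_or_mem ‹_› h).elim hs ht, fun r hr => ?_⟩
        rcases Finset.mem_insert.mp hr with rfl | hr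
        · rw [mul_assoc]
          exact Ideal.mul_mem_left _ _ ht'
        · rw [mul_comm s, mul_assoc]
          exact Ideal.mul_mem_left _ _ (hs' r hr)
    obtain ⟨s, hs, hsT⟩ := key T hT'
    refine ⟨s, hs, fun r hr => ?_⟩
    have hr' : r ∈ Submodule.span Q (T : Set Q) := by rw [hT]; exact hr
    induction hr' using Submodule.span_induction with
    | mem r hr' => exact hsT r hr'
    | zero => simp
    | add a b ha hb iha ihb =>
      rw [mul_add]
      exact add_mem (iha (by rw [hT] at ha; exact ha)) (ihb (by rw [hT] at hb; exact hb))
    | smul c a ha iha =>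
      rw [smul_eq_mul, mul_left_comm]
      exact Ideal.mul_mem_left _ _ (iha (by rw [hT] at ha; exact ha))
  -- Multiplying by s before applying μ kills the kernel of π, so the functional descends to the
  -- quotient of the localization.
  let μs : Q →ₗ[k] k := μ ∘ₗ LinearMap.mulLeft k s
  have hμs : LinearMap.ker π.toLinearMap ≤ LinearMap.ker μs := fun r hr =>
    h.apply_eq_zero (hsJ r hr)
  let ν : L ⧸ I →ₗ[k] k := (Submodule.liftQ _ μs hμs) ∘ₗ
    (π.toLinearMap.quotKerEquivOfSurjective hsurj).symm.toLinearMap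
  have hν : ∀ r, ν (π r) = μ (s * r) := fun r => by
    have : (π.toLinearMap.quotKerEquivOfSurjective hsurj).symm (π r) = Submodule.Quotient.mk r := by
      rw [LinearEquiv.symm_apply_eq]
      rfl
    simp only [ν, LinearMap.comp_apply, LinearEquiv.coe_coe, this]
    rfl
  refine ⟨ν ∘ₗ (Ideal.Quotient.mkₐ k I).toLinearMap, fun q => ⟨fun hq => ?_, fun hq c => ?_⟩⟩
  · obtain ⟨r, hr⟩ := hsurj (Ideal.Quotient.mk I q)
    rw [← Ideal.Quotient.eq_zero_iff_mem]
    refine hr.symm.trans ((hπ0 r).2 ⟨s, hs, (h _).1 fun c => ?_⟩)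
    rw [mul_assoc, ← hν, map_mul, hr]
    exact hq (algebraMap Q L c)
  · have : Ideal.Quotient.mk I (q * c) = 0 :=
      Ideal.Quotient.eq_zero_iff_mem.mpr (Ideal.mul_mem_right _ _ hq)
    exact (congrArg ν this).trans (map_zero ν)

end

/-- A Noetherian algebra is Gorenstein of dimension at most one if every maximal ideal contains a
regular element whose quotient carries a perfect pairing. -/
theorem isGorensteinRing_of_isDualizing (k : Type u) [Field k] (R : Type v) [CommRing R]
    [Algebra k R] [IsNoetherianRing R]
    (h : ∀ (p : Ideal R) [p.IsMaximal], ∃ x ∈ p, (∀ q, x * q = 0 → q = 0) ∧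
      Module.Finite k (R ⧸ Ideal.span {x}) ∧ ∃ μ : R →ₗ[k] k, IsDualizing x μ) :
    IsGorensteinRing R where
  isNoetherianRing := inferInstance
  finite_injectiveDimension p _ := by
    obtain ⟨x, hxp, hreg, hfin, μ, hμ⟩ := h p
    obtain ⟨μ', hμ'⟩ := hμ.exists_localization p
    have := finite_localization_quotient (k := k) (x := x) p
    have : IsNoetherianRing (Localization.AtPrime p) :=
      IsLocalization.isNoetherianRing p.primeCompl _ inferInstance
    refine ⟨1, hμ'.hasInjectiveDimensionLE_one ?_ ?_⟩
    · rw [IsLocalRing.jacobson_eq_maximalIdeal _ bot_ne_top]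
      exact (IsLocalization.AtPrime.to_map_mem_maximal_iff _ p x).mpr hxp
    · exact localization_mul_eq_zero hreg p

/-- A commutative algebra is Frobenius if it carries a nondegenerate functional. -/
def IsFrobenius (k : Type u) [Field k] (B : Type v) [CommRing B] [Algebra k B] : Prop :=
  ∃ μ : B →ₗ[k] k, ∀ a, (∀ b, μ (a * b) = 0) → a = 0

/-- A nondegenerate functional is dualizing for x = 0; it localizes, and the localizations are then
self-injective. -/
theorem IsFrobenius.isGorensteinRing {k : Type u} [Field k] {B : Type v} [CommRing B] [Algebra k B]
    [Module.Finite k B] (h : IsFrobenius k B) : IsGorensteinRing B where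
  isNoetherianRing := IsNoetherianRing.of_finite k B
  finite_injectiveDimension p _ := by
    obtain ⟨μ, hμ⟩ := h
    have : IsNoetherianRing B := IsNoetherianRing.of_finite k B
    have hd : IsDualizing (0 : B) μ := fun q => by
      rw [Ideal.span_singleton_eq_bot.mpr rfl, Ideal.mem_bot]
      exact ⟨hμ q, fun h => by simp [h]⟩
    obtain ⟨μ', hμ'⟩ := hd.exists_localization p
    have hfin := finite_localization_quotient (k := k) (x := (0 : B)) p
    rw [map_zero] at hμ' hfin
    exact ⟨0, hμ'.hasInjectiveDimensionLE_zero⟩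

end AGor
end

noncomputable section
namespace AGor
open IsLocalRing

/-! ### Socles of Gorenstein algebras -/

section

variable {k : Type u} [Field k] {R : Type v} [CommRing R] [Algebra k R] {x : R}

/-- This is `mem_span_sup_of_mem_socle` for the localization at p with denominators cleared, so that
later arguments can stay in R. -/
lemma IsGorensteinRing.exists_mul_sub_mul_mem (hR : IsGorensteinRing R) {p : Ideal R}
    [p.IsMaximal] (hx : x ∈ p) (hreg : ∀ q, x * q = 0 → q = 0)
    [Module.Finite k (R ⧸ Ideal.span {x})] {a b : R} (ha : ∀ r ∈ p, r * a ∈ Ideal.span {x})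
    (hb : ∀ r ∈ p, r * b ∈ Ideal.span {x}) (hb0 : ∀ s ∉ p, s * b ∉ Ideal.span {x}) :
    ∃ s ∉ p, ∃ r, s * a - r * b ∈ Ideal.span {x} := by
  let L := Localization.AtPrime p
  have hN := hR.isNoetherianRing
  have : IsNoetherianRing L := IsLocalization.isNoetherianRing p.primeCompl _ inferInstance
  have hfin := finite_localization_quotient (k := k) (x := x) p
  obtain ⟨n, hn⟩ := hR.finite_injectiveDimension p
  have hmem : ∀ r, algebraMap R L r ∈ Ideal.span {algebraMap R L x} ↔
      ∃ s ∉ p, s * r ∈ Ideal.span {x} := fun r => by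
    rw [← localizationQuotient_eq_zero_iff (k := k) p r, ← Ideal.Quotient.eq_zero_iff_mem]
    rfl
  have hmax : ∀ a, (∀ r ∈ p, r * a ∈ Ideal.span {x}) →
      ∀ r ∈ maximalIdeal L, r * algebraMap R L a ∈ Ideal.span {algebraMap R L x} := by
    intro a ha r hr
    obtain ⟨r, s, rfl⟩ := IsLocalization.exists_mk'_eq p.primeCompl r
    have hr' : r ∈ p := (IsLocalization.AtPrime.mk'_mem_maximal_iff L p r s).mp hr
    rw [IsLocalization.mk'_eq_mul_mk'_one, mul_right_comm, mul_comm, ← map_mul]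
    exact Ideal.mul_mem_left _ _ ((hmem _).2
      ⟨1, fun h => Ideal.IsPrime.ne_top inferInstance ((Ideal.eq_top_iff_one _).2 h), by simpa using ha r hr'⟩)
  have hfl : IsFiniteLength L (L ⧸ Ideal.span {algebraMap R L x}) := by
    rw [isFiniteLength_iff_isNoetherian_isArtinian]
    have : IsArtinian k (L ⧸ Ideal.span {algebraMap R L x}) := inferInstance
    exact ⟨inferInstance, isArtinian_of_tower k this⟩
  obtain ⟨q, hq⟩ := mem_span_sup_of_mem_socle hn
    ((IsLocalization.AtPrime.to_map_mem_maximal_iff L p x).mpr hx)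
    (localization_mul_eq_zero hreg p) hfl (hmax a ha) (hmax b hb)
    (fun h => by obtain ⟨s, hs, h⟩ := (hmem b).1 h; exact hb0 s hs h)
  obtain ⟨r, s, rfl⟩ := IsLocalization.exists_mk'_eq p.primeCompl q
  have h1 : algebraMap R L (s * a - r * b) ∈ Ideal.span {algebraMap R L x} := by
    have h2 := Ideal.mul_mem_left _ (algebraMap R L s) hq
    rwa [mul_sub, ← mul_assoc, IsLocalization.mk'_spec', ← map_mul, ← map_mul, ← map_sub] at h2
  obtain ⟨t, ht, h⟩ := (hmem _).1 h1
  exact ⟨t * s, fun h => (Ideal.IsPrime.mem_or_mem inferInstance h).elim ht s.2, t * r,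
    by rwa [mul_sub, ← mul_assoc, ← mul_assoc] at h⟩

/-- Take the least power of the maximal ideal that kills a. An element r of the preceding power with
r a ≠ 0 moves a into the socle. -/
lemma exists_mul_mem_socle [IsLocalRing R] [IsArtinianRing R] {a : R} (ha : a ≠ 0) :
    ∃ r, r * a ≠ 0 ∧ ∀ s ∈ maximalIdeal R, s * (r * a) = 0 := by
  classical
  have hnil : ∃ N, ∀ r ∈ maximalIdeal R ^ N, r * a = 0 := by
    obtain ⟨N, hN⟩ := IsArtinianRing.isNilpotent_jacobson_bot (R := R)
    rw [IsLocalRing.jacobson_eq_maximalIdeal _ bot_ne_top] at hN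
    exact ⟨N, fun r hr => by rw [hN] at hr; rw [(Submodule.mem_bot R).mp hr, zero_mul]⟩
  have h0 : Nat.find hnil ≠ 0 := fun h => by
    have := Nat.find_spec hnil
    rw [h] at this
    exact ha (by simpa using this 1 (by simp))
  obtain ⟨N, hN⟩ := Nat.exists_eq_succ_of_ne_zero h0
  have := Nat.find_min hnil (m := N) (by omega)
  push Not at this
  obtain ⟨r, hr, hra⟩ := this
  refine ⟨r, hra, fun s hs => ?_⟩
  rw [← mul_assoc]
  refine Nat.find_spec hnil _ ?_
  rw [hN, Nat.succ_eq_add_one, pow_succ']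
  exact Ideal.mul_mem_mul hs hr

/-- A finite local algebra of finite injective dimension over itself is Frobenius. -/
theorem isFrobenius_of_hasInjectiveDimensionLE [IsLocalRing R] [Module.Finite k R] {n : ℕ}
    (h : HasInjectiveDimensionLE (ModuleCat.of R R) n) : IsFrobenius k R := by
  have : IsArtinianRing R := IsArtinianRing.of_finite k R
  obtain ⟨r₀, hb0, hb⟩ := exists_mul_mem_socle (one_ne_zero (α := R))
  obtain ⟨μ, hμ, -⟩ := Submodule.exists_le_ker_of_notMem (K := k) (p := (⊥ : Submodule k R)) hb0
  -- μ is chosen nonzero on one socle element. If the ideal of a nonzero a were in the kernel, it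
  -- would contain a nonzero socle element, hence the chosen one, as the socle is simple.
  refine ⟨μ, fun a ha => ?_⟩
  by_contra ha0
  obtain ⟨r, hr0, hr⟩ := exists_mul_mem_socle ha0
  obtain ⟨q, hq⟩ := mem_span_of_mem_socle h hb hr hr0
  refine hμ ?_
  rw [hq, ← ha (q * r)]
  congr 1
  ring

end

end AGor
end

noncomputable section
namespace AGor
attribute [local instance] MvPolynomial.gradedAlgebra

/-! ### Morphisms from affine schemes to projective space -/

open HomogeneousLocalization

section EvalMap

variable {k : Type u} [Field k] {n : ℕ} {B : Type u} [CommRing B] [Algebra k B]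

/-- Evaluation at a tuple `v` of the degree-zero fractions with denominator a power of `ℓ`. -/
def evalAway (v : Fin (n + 1) → B) (ℓ : MvPolynomial (Fin (n + 1)) k)
    (hu : IsUnit (MvPolynomial.aeval v ℓ)) : Away (grading k n) ℓ →+* B :=
  (IsLocalization.Away.lift (S := Localization.Away ℓ) ℓ
    (g := (MvPolynomial.aeval v : MvPolynomial (Fin (n + 1)) k →ₐ[k] B).toRingHom) hu).comp
    (algebraMap (Away (grading k n) ℓ) (Localization.Away ℓ))

/-- The value F(v)/ℓ(v)^d is stated without inverses; together with `eq_evalAway` this characterizes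
`evalAway`, and the compatibilities below use only this. -/
lemma evalAway_mk (v : Fin (n + 1) → B) {ℓ : MvPolynomial (Fin (n + 1)) k} {m : ℕ}
    (hℓ : ℓ ∈ grading k n m) (hu : IsUnit (MvPolynomial.aeval v ℓ)) (d : ℕ)
    (F : MvPolynomial (Fin (n + 1)) k) (hF : F ∈ grading k n (d • m)) :
    evalAway v ℓ hu (Away.mk (grading k n) hℓ d F hF) * MvPolynomial.aeval v ℓ ^ d =
      MvPolynomial.aeval v F := by
  have h1 : algebraMap (Away (grading k n) ℓ) (Localization.Away ℓ)
      (Away.mk (grading k n) hℓ d F hF) = Localization.mk F (⟨ℓ ^ d, d, rfl⟩ : Submonoid.powers ℓ) := rfl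
  have h2 : MvPolynomial.aeval v ℓ ^ d = IsLocalization.Away.lift (S := Localization.Away ℓ) ℓ
      (g := (MvPolynomial.aeval v : MvPolynomial (Fin (n + 1)) k →ₐ[k] B).toRingHom) hu
      (algebraMap _ _ (ℓ ^ d)) := by
    rw [IsLocalization.Away.lift_eq, map_pow]
    rfl
  have h3 : (Localization.mk F (⟨ℓ ^ d, d, rfl⟩ : Submonoid.powers ℓ) : Localization.Away ℓ) * algebraMap _ _ (ℓ ^ d) =
      algebraMap _ _ F := by
    rw [Localization.mk_eq_mk']
    exact IsLocalization.mk'_spec _ _ _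
  rw [evalAway, RingHom.comp_apply, h1, h2, ← map_mul, h3, IsLocalization.Away.lift_eq]
  rfl

lemma eq_evalAway (v : Fin (n + 1) → B) {ℓ : MvPolynomial (Fin (n + 1)) k} {m : ℕ}
    (hℓ : ℓ ∈ grading k n m) (hu : IsUnit (MvPolynomial.aeval v ℓ))
    (θ : Away (grading k n) ℓ →+* B)
    (h : ∀ d F hF, θ (Away.mk (grading k n) hℓ d F hF) * MvPolynomial.aeval v ℓ ^ d =
      MvPolynomial.aeval v F) : θ = evalAway v ℓ hu := by
  ext a
  obtain ⟨d, F, hF, rfl⟩ := Away.mk_surjective _ hℓ a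
  exact (hu.pow d).mul_right_cancel ((h d F hF).trans (evalAway_mk v hℓ hu d F hF).symm)

lemma evalAway_comp_awayMap (v : Fin (n + 1) → B) {ℓ ℓ' x : MvPolynomial (Fin (n + 1)) k}
    {m m' : ℕ} (hℓ : ℓ ∈ grading k n m) (hℓ' : ℓ' ∈ grading k n m') (hx : x = ℓ * ℓ')
    (hu : IsUnit (MvPolynomial.aeval v ℓ)) (hu' : IsUnit (MvPolynomial.aeval v x)) :
    (evalAway v x hu').comp (awayMap (grading k n) hℓ' hx) = evalAway v ℓ hu := by
  refine eq_evalAway v hℓ hu _ fun d F hF => ?_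
  subst hx
  rw [RingHom.comp_apply, awayMap_mk]
  have h := evalAway_mk v (SetLike.mul_mem_graded hℓ hℓ') hu' d (F * ℓ' ^ d)
    (by rw [smul_add]; exact SetLike.mul_mem_graded hF (SetLike.pow_mem_graded d hℓ'))
  rw [map_mul] at hu'
  refine ((isUnit_of_mul_isUnit_right hu').pow d).mul_right_cancel ?_
  rw [mul_assoc, ← mul_pow, ← map_mul, h, map_mul, map_pow]

/-- The tuple obtained by a linear substitution. -/
def substTuple (M : Matrix (Fin (n + 1)) (Fin (n + 1)) k) (v : Fin (n + 1) → B) :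
    Fin (n + 1) → B :=
  fun i => MvPolynomial.aeval v (linSubst M (MvPolynomial.X i))

lemma aeval_substTuple (M : Matrix (Fin (n + 1)) (Fin (n + 1)) k) (v : Fin (n + 1) → B)
    (F : MvPolynomial (Fin (n + 1)) k) :
    MvPolynomial.aeval (substTuple M v) F = MvPolynomial.aeval v (linSubst M F) := by
  have : (MvPolynomial.aeval (substTuple M v) : MvPolynomial (Fin (n + 1)) k →ₐ[k] B) =
      (MvPolynomial.aeval v).comp (linSubst M) := by
    ext i
    simp [substTuple]
  rw [this, AlgHom.comp_apply]

lemma gradedLinSubst_apply (M : Matrix (Fin (n + 1)) (Fin (n + 1)) k)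
    (F : MvPolynomial (Fin (n + 1)) k) : gradedLinSubst M F = linSubst M F := rfl

lemma evalAway_comp_map (M : Matrix (Fin (n + 1)) (Fin (n + 1)) k) (v : Fin (n + 1) → B)
    {ℓ : MvPolynomial (Fin (n + 1)) k} {m : ℕ} (hℓ : ℓ ∈ grading k n m)
    (hu : IsUnit (MvPolynomial.aeval (substTuple M v) ℓ))
    (hu' : IsUnit (MvPolynomial.aeval v (gradedLinSubst M ℓ))) :
    (evalAway v (gradedLinSubst M ℓ) hu').comp (Away.map (gradedLinSubst M) ℓ) =
      evalAway (substTuple M v) ℓ hu := by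
  refine eq_evalAway _ hℓ hu _ fun d F hF => ?_
  rw [RingHom.comp_apply, Away.map_mk, aeval_substTuple, aeval_substTuple]
  exact evalAway_mk v ((gradedLinSubst M).map_mem hℓ) hu' d _ ((gradedLinSubst M).map_mem hF)

lemma aeval_smul_of_isHomogeneous {σ : Type*} (v : σ → B) (b : B) {F : MvPolynomial σ k} {d : ℕ}
    (hF : F.IsHomogeneous d) :
    MvPolynomial.aeval (fun i => b * v i) F = b ^ d * MvPolynomial.aeval v F := by
  rw [MvPolynomial.aeval_def, MvPolynomial.aeval_def, MvPolynomial.eval₂_eq, MvPolynomial.eval₂_eq,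
    Finset.mul_sum]
  refine Finset.sum_congr rfl fun s hs => ?_
  have hs' : ∑ i ∈ s.support, s i = d := by
    rw [← hF (MvPolynomial.mem_support_iff.mp hs), Finsupp.weight_apply]
    simp [Finsupp.sum]
  simp only [mul_pow, Finset.prod_mul_distrib, Finset.prod_pow_eq_pow_sum, hs']
  ring

lemma evalAway_mul (v : Fin (n + 1) → B) (b : B)
    {ℓ : MvPolynomial (Fin (n + 1)) k} {m : ℕ} (hℓ : ℓ ∈ grading k n m)
    (hu : IsUnit (MvPolynomial.aeval v ℓ))
    (hu' : IsUnit (MvPolynomial.aeval (fun i => b * v i) ℓ)) (hb : IsUnit b) :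
    evalAway (fun i => b * v i) ℓ hu' = evalAway v ℓ hu := by
  refine eq_evalAway _ hℓ hu _ fun d F hF => ?_
  have h := evalAway_mk (fun i => b * v i) hℓ hu' d F hF
  rw [aeval_smul_of_isHomogeneous v b hF, aeval_smul_of_isHomogeneous v b hℓ, mul_pow, ← pow_mul,
    mul_left_comm, smul_eq_mul, mul_comm d m] at h
  exact (hb.pow (m * d)).mul_left_cancel h

lemma comp_evalAway {C : Type u} [CommRing C] [Algebra k C] (g : B →ₐ[k] C) (v : Fin (n + 1) → B)
    {ℓ : MvPolynomial (Fin (n + 1)) k} {m : ℕ} (hℓ : ℓ ∈ grading k n m)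
    (hu : IsUnit (MvPolynomial.aeval v ℓ))
    (hu' : IsUnit (MvPolynomial.aeval (fun i => g (v i)) ℓ)) :
    (g : B →+* C).comp (evalAway v ℓ hu) = evalAway (fun i => g (v i)) ℓ hu' := by
  have hg : ∀ F : MvPolynomial (Fin (n + 1)) k,
      MvPolynomial.aeval (fun i => g (v i)) F = g (MvPolynomial.aeval v F) := fun F =>
    (MvPolynomial.comp_aeval_apply v g F).symm
  refine eq_evalAway _ hℓ hu' _ fun d F hF => ?_
  rw [hg, hg, RingHom.comp_apply, ← map_pow]
  exact (map_mul g _ _).symm.trans (congrArg g (evalAway_mk v hℓ hu d F hF))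

lemma isUnit_aeval_comp {C : Type u} [CommRing C] [Algebra k C] (g : B →ₐ[k] C)
    {v : Fin (n + 1) → B} {ℓ : MvPolynomial (Fin (n + 1)) k}
    (hu : IsUnit (MvPolynomial.aeval v ℓ)) :
    IsUnit (MvPolynomial.aeval (fun i => g (v i)) ℓ) := by
  have : MvPolynomial.aeval (fun i => g (v i)) ℓ = g (MvPolynomial.aeval v ℓ) :=
    (MvPolynomial.comp_aeval_apply v g ℓ).symm
  rw [this]
  exact hu.map g

/-- The morphism `Spec B ⟶ P^n` with homogeneous coordinates `v`. -/
def evalMap (v : Fin (n + 1) → B) {ℓ : MvPolynomial (Fin (n + 1)) k} {m : ℕ}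
    (hℓ : ℓ ∈ grading k n m) (hm : 0 < m) (hu : IsUnit (MvPolynomial.aeval v ℓ)) :
    Spec (CommRingCat.of B) ⟶ PP k n :=
  Spec.map (CommRingCat.ofHom (evalAway v ℓ hu)) ≫ Proj.awayι (grading k n) ℓ hℓ hm

lemma evalMap_eq_mul (v : Fin (n + 1) → B) {ℓ ℓ' x : MvPolynomial (Fin (n + 1)) k} {m m' m'' : ℕ}
    (hℓ : ℓ ∈ grading k n m) (hm : 0 < m) (hu : IsUnit (MvPolynomial.aeval v ℓ))
    (hℓ' : ℓ' ∈ grading k n m') (hx : x = ℓ * ℓ') (hu' : IsUnit (MvPolynomial.aeval v x))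
    (hx' : x ∈ grading k n m'') (hm'' : 0 < m'') (h : m'' = m + m') :
    evalMap v hℓ hm hu = evalMap v hx' hm'' hu' := by
  subst h
  rw [evalMap, ← evalAway_comp_awayMap v hℓ hℓ' hx hu hu', CommRingCat.ofHom_comp, Spec.map_comp,
    Category.assoc, Proj.SpecMap_awayMap_awayι]
  rfl

/-- `evalMap` does not depend on the denominator. -/
lemma evalMap_eq (v : Fin (n + 1) → B) {ℓ ℓ' : MvPolynomial (Fin (n + 1)) k} {m m' : ℕ}
    (hℓ : ℓ ∈ grading k n m) (hm : 0 < m) (hu : IsUnit (MvPolynomial.aeval v ℓ))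
    (hℓ' : ℓ' ∈ grading k n m') (hm' : 0 < m') (hu' : IsUnit (MvPolynomial.aeval v ℓ')) :
    evalMap v hℓ hm hu = evalMap v hℓ' hm' hu' := by
  have hu'' : IsUnit (MvPolynomial.aeval v (ℓ * ℓ')) := by
    rw [map_mul]
    exact hu.mul hu'
  rw [evalMap_eq_mul v hℓ hm hu hℓ' rfl hu'' (SetLike.mul_mem_graded hℓ hℓ') (by omega) rfl,
    evalMap_eq_mul v hℓ' hm' hu' hℓ (mul_comm _ _) hu'' (SetLike.mul_mem_graded hℓ hℓ')
      (by omega) (add_comm _ _)]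

lemma evalMap_mul (v : Fin (n + 1) → B) (b : B)
    {ℓ : MvPolynomial (Fin (n + 1)) k} {m : ℕ} (hℓ : ℓ ∈ grading k n m) (hm : 0 < m)
    (hu : IsUnit (MvPolynomial.aeval v ℓ))
    (hu' : IsUnit (MvPolynomial.aeval (fun i => b * v i) ℓ)) (hb : IsUnit b) :
    evalMap (fun i => b * v i) hℓ hm hu' = evalMap v hℓ hm hu := by
  rw [evalMap, evalAway_mul v b hℓ hu hu' hb, evalMap]

lemma SpecMap_comp_evalMap {C : Type u} [CommRing C] [Algebra k C] (g : B →ₐ[k] C)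
    (v : Fin (n + 1) → B) {ℓ : MvPolynomial (Fin (n + 1)) k} {m : ℕ} (hℓ : ℓ ∈ grading k n m)
    (hm : 0 < m) (hu : IsUnit (MvPolynomial.aeval v ℓ)) :
    Spec.map (CommRingCat.ofHom (g : B →+* C)) ≫ evalMap v hℓ hm hu =
      evalMap (fun i => g (v i)) hℓ hm (isUnit_aeval_comp g hu) := by
  rw [evalMap, evalMap, ← comp_evalAway g v hℓ hu (isUnit_aeval_comp g hu),
    CommRingCat.ofHom_comp, Spec.map_comp, Category.assoc]

lemma awayι_comp_projLinear (φ : GL (Fin (n + 1)) k)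
    {ℓ : MvPolynomial (Fin (n + 1)) k} {m : ℕ} (hℓ : ℓ ∈ grading k n m) (hm : 0 < m) :
    Proj.awayι (grading k n) (gradedLinSubst (φ : Matrix (Fin (n + 1)) (Fin (n + 1)) k) ℓ)
        ((gradedLinSubst (φ : Matrix (Fin (n + 1)) (Fin (n + 1)) k)).map_mem hℓ) hm ≫
          projLinear φ =
      Spec.map (CommRingCat.ofHom
        (Away.map (gradedLinSubst (φ : Matrix (Fin (n + 1)) (Fin (n + 1)) k)) ℓ)) ≫
        Proj.awayι (grading k n) ℓ hℓ hm :=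
  Proj.awayι_comp_map (gradedLinSubst (φ : Matrix (Fin (n + 1)) (Fin (n + 1)) k))
    (irrelevant_le_map φ) hm ℓ hℓ

/-- The denominators on both sides are independent: `evalMap_eq` first replaces ℓ' by the
substituted form of ℓ, for which the square of charts commutes. -/
lemma evalMap_comp_projLinear (φ : GL (Fin (n + 1)) k) (v : Fin (n + 1) → B)
    {ℓ ℓ' : MvPolynomial (Fin (n + 1)) k} {m m' : ℕ} (hℓ : ℓ ∈ grading k n m) (hm : 0 < m)
    (hu : IsUnit (MvPolynomial.aeval
      (substTuple (φ : Matrix (Fin (n + 1)) (Fin (n + 1)) k) v) ℓ))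
    (hℓ' : ℓ' ∈ grading k n m') (hm' : 0 < m') (hu' : IsUnit (MvPolynomial.aeval v ℓ')) :
    evalMap v hℓ' hm' hu' ≫ projLinear φ =
      evalMap (substTuple (φ : Matrix (Fin (n + 1)) (Fin (n + 1)) k) v) hℓ hm hu := by
  have hu'' : IsUnit (MvPolynomial.aeval v
      (gradedLinSubst (φ : Matrix (Fin (n + 1)) (Fin (n + 1)) k) ℓ)) := by
    rwa [gradedLinSubst_apply, ← aeval_substTuple]
  have hℓ'' : gradedLinSubst (φ : Matrix (Fin (n + 1)) (Fin (n + 1)) k) ℓ ∈ grading k n m :=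
    linSubst_mem _ hℓ
  rw [evalMap_eq v hℓ' hm' hu' hℓ'' hm hu'', evalMap,
    evalMap, ← evalAway_comp_map (φ : Matrix (Fin (n + 1)) (Fin (n + 1)) k) v hℓ hu hu'',
    CommRingCat.ofHom_comp, Spec.map_comp, Category.assoc, Category.assoc, awayι_comp_projLinear]

lemma evalAway_fromZeroRingHom (v : Fin (n + 1) → B) {ℓ : MvPolynomial (Fin (n + 1)) k}
    (hu : IsUnit (MvPolynomial.aeval v ℓ)) (c : k) :
    evalAway v ℓ hu (fromZeroRingHom (grading k n) _ (algebraMap k (grading k n 0) c)) =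
      algebraMap k B c := by
  have h : algebraMap (Away (grading k n) ℓ) (Localization.Away ℓ)
      (fromZeroRingHom (grading k n) _ (algebraMap k (grading k n 0) c)) =
      algebraMap _ _ (algebraMap k (MvPolynomial (Fin (n + 1)) k) c) := by
    rw [← Localization.mk_one_eq_algebraMap]
    rfl
  rw [evalAway, RingHom.comp_apply, h, IsLocalization.Away.lift_eq]
  exact MvPolynomial.aeval_C v c

lemma evalMap_toSpec (v : Fin (n + 1) → B) {ℓ : MvPolynomial (Fin (n + 1)) k} {m : ℕ}
    (hℓ : ℓ ∈ grading k n m) (hm : 0 < m) (hu : IsUnit (MvPolynomial.aeval v ℓ)) :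
    evalMap v hℓ hm hu ≫ PP.toSpec k n = Spec.map (CommRingCat.ofHom (algebraMap k B)) := by
  rw [evalMap, PP.toSpec, Category.assoc, Proj.awayι_toSpecZero_assoc, ← Spec.map_comp,
    ← Spec.map_comp]
  congr 1
  ext c
  exact evalAway_fromZeroRingHom v hu c

end EvalMap

end AGor
end

noncomputable section
namespace AGor
attribute [local instance] MvPolynomial.gradedAlgebra

/-! ### Forms vanishing on a subscheme with given coordinates -/

open HomogeneousLocalization

section Vanishing

variable {k : Type u} [Field k] {n : ℕ} {B : Type u} [CommRing B] [Algebra k B]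

lemma le_awayι_preimage {ℓ : MvPolynomial (Fin (n + 1)) k} {m : ℕ}
    (hℓ : ℓ ∈ grading k n m) (hm : 0 < m) :
    ⊤ ≤ Proj.awayι (grading k n) ℓ hℓ hm ⁻¹ᵁ Proj.basicOpen (grading k n) ℓ := by
  rw [← Proj.opensRange_awayι (grading k n) ℓ hℓ hm, Scheme.Hom.preimage_opensRange]

/-- Under the isomorphism of D₊(ℓ) with the spectrum of degree-zero fractions, a fraction regarded
as a section pulls back to itself. -/
lemma awayToSection_comp_awayι {ℓ : MvPolynomial (Fin (n + 1)) k} {m : ℕ}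
    (hℓ : ℓ ∈ grading k n m) (hm : 0 < m) :
    Proj.awayToSection (grading k n) ℓ ≫
      (Proj.awayι (grading k n) ℓ hℓ hm).appLE (Proj.basicOpen (grading k n) ℓ) ⊤
        (le_awayι_preimage hℓ hm) = (Scheme.ΓSpecIso _).inv := by
  have h1 := Proj.basicOpenToSpec_app_top (grading k n) ℓ
  have h2 : Proj.awayToSection (grading k n) ℓ ≫ (Proj.basicOpen (grading k n) ℓ).topIso.inv =
      (Scheme.ΓSpecIso _).inv ≫ (Proj.basicOpenToSpec (grading k n) ℓ).appTop := by
    rw [Iso.eq_inv_comp]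
    exact h1.symm
  have h3 : (Proj.basicOpen (grading k n) ℓ).ι.appLE (Proj.basicOpen (grading k n) ℓ) ⊤
      (by simp) = (Proj.basicOpen (grading k n) ℓ).topIso.inv := by
    rw [Scheme.Opens.ι_appLE]
    rfl
  have h5 := Scheme.Hom.appLE_comp_appLE (Proj.basicOpenIsoSpec (grading k n) ℓ hℓ hm).inv
    (Proj.basicOpen (grading k n) ℓ).ι (Proj.basicOpen (grading k n) ℓ) ⊤ ⊤ (by simp) (by simp)
  refine (congrArg (Proj.awayToSection (grading k n) ℓ ≫ ·) h5.symm).trans ?_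
  simp only [h3]
  rw [reassoc_of% h2, ← Proj.basicOpenIsoSpec_hom (grading k n) ℓ hℓ hm]
  have h4 : (Proj.basicOpenIsoSpec (grading k n) ℓ hℓ hm).hom.appTop ≫
      (Proj.basicOpenIsoSpec (grading k n) ℓ hℓ hm).inv.appTop = 𝟙 _ := by
    rw [← Scheme.Hom.comp_appTop, Iso.inv_hom_id, Scheme.Hom.id_appTop]
  have h6 : (Proj.basicOpenIsoSpec (grading k n) ℓ hℓ hm).inv.appLE ⊤ ⊤ (by simp) =
      (Proj.basicOpenIsoSpec (grading k n) ℓ hℓ hm).inv.appTop := Scheme.Hom.appLE_eq_app _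
  refine (congrArg (fun t => (Scheme.ΓSpecIso _).inv ≫
    (Proj.basicOpenIsoSpec (grading k n) ℓ hℓ hm).hom.appTop ≫ t) h6).trans ?_
  rw [h4, Category.comp_id]

lemma evalMap_app_eq_zero_iff (w : Fin (n + 1) → B) {ℓ : MvPolynomial (Fin (n + 1)) k} {m : ℕ}
    (hℓ : ℓ ∈ grading k n m) (hm : 0 < m) (hu : IsUnit (MvPolynomial.aeval w ℓ))
    (a : Away (grading k n) ℓ) :
    (evalMap w hℓ hm hu).app (Proj.basicOpen (grading k n) ℓ)
      (Proj.awayToSection (grading k n) ℓ a) = 0 ↔ evalAway w ℓ hu a = 0 := by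
  have htop : ⊤ ≤ evalMap w hℓ hm hu ⁻¹ᵁ Proj.basicOpen (grading k n) ℓ := by
    rw [evalMap, Scheme.Hom.comp_preimage]
    intro x _
    exact le_awayι_preimage hℓ hm trivial
  have h1 : Proj.awayToSection (grading k n) ℓ ≫
      (evalMap w hℓ hm hu).appLE (Proj.basicOpen (grading k n) ℓ) ⊤ htop =
      CommRingCat.ofHom (evalAway w ℓ hu) ≫ (Scheme.ΓSpecIso _).inv := by
    have h5 := Scheme.Hom.appLE_comp_appLE (Spec.map (CommRingCat.ofHom (evalAway w ℓ hu)))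
      (Proj.awayι (grading k n) ℓ hℓ hm) (Proj.basicOpen (grading k n) ℓ) ⊤ ⊤
      (le_awayι_preimage hℓ hm) le_rfl
    refine (congrArg (Proj.awayToSection (grading k n) ℓ ≫ ·) h5.symm).trans ?_
    rw [reassoc_of% awayToSection_comp_awayι hℓ hm, Scheme.ΓSpecIso_inv_naturality]
    exact congrArg _ (Scheme.Hom.appLE_eq_app _)
  have h2 := congrArg (fun φ => φ.hom a) h1
  have hinj : Function.Injective
      ((Spec (CommRingCat.of B)).presheaf.map (homOfLE htop).op) := by
    have : IsIso ((Spec (CommRingCat.of B)).presheaf.map (homOfLE htop).op) := by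
      have : IsIso (homOfLE htop) := ⟨homOfLE le_top, rfl, rfl⟩
      infer_instance
    exact ConcreteCategory.injective_of_mono_of_preservesPullback _
  have hinj' : Function.Injective (Scheme.ΓSpecIso (CommRingCat.of B)).inv :=
    (Scheme.ΓSpecIso (CommRingCat.of B)).commRingCatIsoToRingEquiv.symm.injective
  constructor
  · intro h
    apply hinj'
    rw [map_zero]
    refine h2.symm.trans ?_
    refine (congrArg ((Spec (CommRingCat.of B)).presheaf.map (homOfLE htop).op) h).trans ?_
    exact map_zero _
  · intro h
    apply hinj
    rw [map_zero]
    refine h2.trans ?_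
    exact (congrArg (Scheme.ΓSpecIso (CommRingCat.of B)).inv h).trans (map_zero _)

lemma mem_evalMap_preimage (v : Fin (n + 1) → B) {ℓ : MvPolynomial (Fin (n + 1)) k} {m : ℕ}
    (hℓ : ℓ ∈ grading k n m) (hm : 0 < m) (hu : IsUnit (MvPolynomial.aeval v ℓ))
    (i : Fin (n + 1)) (p : PrimeSpectrum B)
    (hp : (p : Spec (CommRingCat.of B)) ∈ evalMap v hℓ hm hu ⁻¹ᵁ
      Proj.basicOpen (grading k n) (MvPolynomial.X i)) : v i ∉ p.asIdeal := by
  rw [evalMap, Scheme.Hom.comp_preimage, Proj.awayι_preimage_basicOpen (grading k n) hℓ hm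
    (MvPolynomial.isHomogeneous_X k i : MvPolynomial.X i ∈ grading k n 1) one_pos] at hp
  intro hv
  refine hp ?_
  change evalAway v ℓ hu _ ∈ p.asIdeal
  have h := evalAway_mk v hℓ hu 1 (MvPolynomial.X i ^ m)
    (by simpa using (MvPolynomial.isHomogeneous_X k i).pow m)
  have h' : evalAway v ℓ hu (Away.mk (grading k n) hℓ 1 (MvPolynomial.X i ^ m)
    (by simpa using (MvPolynomial.isHomogeneous_X k i).pow m)) * MvPolynomial.aeval v ℓ ^ 1 ∈
      p.asIdeal := by
    rw [h, map_pow, MvPolynomial.aeval_X]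
    exact Ideal.pow_mem_of_mem _ hv m hm
  exact (p.2.mem_or_mem h').resolve_right fun h0 =>
    p.2.ne_top (Ideal.eq_top_of_isUnit_mem _ h0 (hu.pow 1))

variable (Z : ClosedSubscheme k n) (e : Z.X ≅ Spec (CommRingCat.of B)) (v : Fin (n + 1) → B)
  {ℓ : MvPolynomial (Fin (n + 1)) k} {m : ℕ} (hℓ : ℓ ∈ grading k n m) (hm : 0 < m)
  (hu : IsUnit (MvPolynomial.aeval v ℓ)) (hι : Z.ι = e.hom ≫ evalMap v hℓ hm hu)

include hι in
-- The open part of Z where x_i ≠ 0 is the spectrum of the localization of B at v_i, and F/x_i^d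
-- becomes F(v)/v_i^d there. It vanishes exactly when a power of v_i kills F(v).
lemma restrictForm_eq_zero_iff (i : Fin (n + 1)) (d : ℕ) (F : MvPolynomial (Fin (n + 1)) k)
    (hF : F ∈ grading k n d) :
    Z.restrictForm i d F hF = 0 ↔ ∃ N, v i ^ N * MvPolynomial.aeval v F = 0 := by
  let C := Localization.Away (v i)
  let g : B →ₐ[k] C := IsScalarTower.toAlgHom k B C
  let w : Fin (n + 1) → C := fun t => g (v t)
  have hX : (MvPolynomial.X i : MvPolynomial (Fin (n + 1)) k) ∈ grading k n 1 :=
    MvPolynomial.isHomogeneous_X k i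
  have hwi : IsUnit (MvPolynomial.aeval w (MvPolynomial.X i : MvPolynomial (Fin (n + 1)) k)) := by
    rw [MvPolynomial.aeval_X]
    exact IsLocalization.Away.algebraMap_isUnit (v i)
  let j : Spec (CommRingCat.of C) ⟶ Z.X :=
    Spec.map (CommRingCat.ofHom (algebraMap B C)) ≫ e.inv
  have : IsOpenImmersion (Spec.map (CommRingCat.ofHom (algebraMap B C))) :=
    IsOpenImmersion.of_isLocalization (v i)
  have hj : IsOpenImmersion j := inferInstance
  have hjι : j ≫ Z.ι = evalMap w hX one_pos hwi := by
    rw [hι, Category.assoc, Iso.inv_hom_id_assoc]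
    refine (SpecMap_comp_evalMap g v hℓ hm hu).trans (evalMap_eq _ _ _ _ _ _ _)
  let U := Z.ι ⁻¹ᵁ Proj.basicOpen (grading k n) (MvPolynomial.X i)
  have hU : U ≤ j.opensRange := by
    intro z hz
    have hz' : e.hom z ∈ evalMap v hℓ hm hu ⁻¹ᵁ
        Proj.basicOpen (grading k n) (MvPolynomial.X i) := by
      have hz2 : Z.ι z ∈ Proj.basicOpen (grading k n) (MvPolynomial.X i) := hz
      rw [hι, Scheme.Hom.comp_apply] at hz2
      exact hz2
    have hv := mem_evalMap_preimage v hℓ hm hu i _ hz'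
    have hr : (e.hom z : PrimeSpectrum B) ∈ Set.range (PrimeSpectrum.comap (algebraMap B C)) := by
      rw [PrimeSpectrum.localization_away_comap_range C (v i)]
      exact hv
    obtain ⟨q, hq⟩ := hr
    refine ⟨q, ?_⟩
    refine (Scheme.Hom.comp_apply (Spec.map (CommRingCat.ofHom (algebraMap B C))) e.inv _).trans ?_
    refine (congrArg e.inv hq).trans ?_
    rw [← Scheme.Hom.comp_apply, Iso.hom_inv_id]
    rfl
  have hiso : IsIso (j.app U) := Scheme.Hom.isIso_app j U hU
  have hinj : Function.Injective (j.app U) :=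
    ConcreteCategory.injective_of_mono_of_preservesPullback _
  have h0 : Z.restrictForm i d F hF = 0 ↔ j.app U (Z.restrictForm i d F hF) = 0 :=
    ⟨fun h => (congrArg (j.app U) h).trans (map_zero _), fun h => hinj (h.trans (map_zero _).symm)⟩
  have h1 : j.app U (Z.restrictForm i d F hF) =
      (j ≫ Z.ι).app (Proj.basicOpen (grading k n) (MvPolynomial.X i))
        (Proj.awayToSection (grading k n) (MvPolynomial.X i)
          (Away.mk (grading k n) hX d F (by simpa using hF))) := by
    rw [Scheme.Hom.comp_app]
    rfl
  have hFd : F ∈ grading k n (d • 1) := by simpa using hF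
  have h2 : (j ≫ Z.ι).app (Proj.basicOpen (grading k n) (MvPolynomial.X i))
        (Proj.awayToSection (grading k n) (MvPolynomial.X i)
          (Away.mk (grading k n) hX d F hFd)) = 0 ↔
        evalAway w (MvPolynomial.X i) hwi (Away.mk (grading k n) hX d F hFd) = 0 := by
    have := evalMap_app_eq_zero_iff w hX one_pos hwi (Away.mk (grading k n) hX d F hFd)
    rw [← hjι] at this
    exact this
  refine (h0.trans (Eq.congr h1 rfl)).trans (h2.trans ?_)
  have h3 := evalAway_mk w hX hwi d F hFd
  have h4 : MvPolynomial.aeval w F = algebraMap B C (MvPolynomial.aeval v F) :=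
    (MvPolynomial.comp_aeval_apply v g F).symm
  have h5 : evalAway w (MvPolynomial.X i) hwi (Away.mk (grading k n) hX d F hFd) = 0 ↔
      algebraMap B C (MvPolynomial.aeval v F) = 0 := by
    rw [← h4, ← h3, (hwi.pow d).mul_left_eq_zero]
  rw [h5, IsLocalization.map_eq_zero_iff (Submonoid.powers (v i))]
  constructor
  · rintro ⟨⟨_, N, rfl⟩, hN⟩
    exact ⟨N, hN⟩
  · rintro ⟨N, hN⟩
    exact ⟨⟨_, N, rfl⟩, hN⟩

include hι in
/-- A form vanishes on `Z` if and only if it vanishes on the homogeneous coordinates. -/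
lemma vanishes_iff (d : ℕ) (F : MvPolynomial (Fin (n + 1)) k) (hF : F ∈ grading k n d) :
    Z.Vanishes d F hF ↔ MvPolynomial.aeval v F = 0 := by
  constructor
  · intro h
    have h' : ∀ i, ∃ N, v i ^ N * MvPolynomial.aeval v F = 0 := fun i =>
      (restrictForm_eq_zero_iff Z e v hℓ hm hu hι i d F hF).1 (h i)
    -- The annihilator of F(v) contains a power of every v_i, so its radical contains ℓ(v), because
    -- ℓ has positive degree. As ℓ(v) is a unit, the annihilator is everything.
    let I : Ideal B := Submodule.annihilator (Ideal.span {MvPolynomial.aeval v F})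
    have hI : ∀ i, v i ∈ I.radical := fun i => by
      obtain ⟨N, hN⟩ := h' i
      exact ⟨N, (Submodule.mem_annihilator_span_singleton _ _).mpr hN⟩
    have hlI : MvPolynomial.aeval v ℓ ∈ I.radical := by
      rw [MvPolynomial.aeval_def, MvPolynomial.eval₂_eq]
      refine Ideal.sum_mem _ fun s hs => Ideal.mul_mem_left _ _ ?_
      have hs' := hℓ (MvPolynomial.mem_support_iff.mp hs)
      have hs0 : s ≠ 0 := by
        rintro rfl
        simp at hs'
        omega
      obtain ⟨i, hi⟩ := Finsupp.support_nonempty_iff.mpr hs0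
      exact Ideal.mem_of_dvd _ (Finset.dvd_prod_of_mem _ hi) (Ideal.pow_mem_of_mem _ (hI i) _
        (Nat.pos_of_ne_zero (Finsupp.mem_support_iff.mp hi)))
    have htop : I = ⊤ := Ideal.radical_eq_top.mp (Ideal.eq_top_of_isUnit_mem _ hlI hu)
    have h1 : (1 : B) ∈ I := htop ▸ Submodule.mem_top
    simpa using (Submodule.mem_annihilator_span_singleton _ _).mp h1
  · intro h i
    rw [restrictForm_eq_zero_iff Z e v hℓ hm hu hι]
    exact ⟨0, by rw [h, mul_zero]⟩

include hι in
lemma homogeneousIdeal_eq : Z.homogeneousIdeal =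
    Ideal.span {F | ∃ d : ℕ, F ∈ grading k n d ∧ MvPolynomial.aeval v F = 0} := by
  rw [ClosedSubscheme.homogeneousIdeal]
  congr 1
  ext F
  constructor
  · rintro ⟨d, hF, h⟩
    exact ⟨d, hF, (vanishes_iff Z e v hℓ hm hu hι d F hF).1 h⟩
  · rintro ⟨d, hF, h⟩
    exact ⟨d, hF, (vanishes_iff Z e v hℓ hm hu hι d F hF).2 h⟩

include hι in
lemma isNonDegenerate_iff : Z.IsNonDegenerate ↔ LinearIndependent k v := by
  have hlin : ∀ F : MvPolynomial (Fin (n + 1)) k, F ∈ grading k n 1 ↔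
      ∃ c : Fin (n + 1) → k, F = ∑ i, c i • MvPolynomial.X i := by
    intro F
    rw [grading, MvPolynomial.homogeneousSubmodule_one_eq_span_X, Submodule.mem_span_range_iff_exists_fun]
    simp only [eq_comm]
  rw [Fintype.linearIndependent_iff]
  constructor
  · intro h c hc
    have hF : (∑ i, c i • MvPolynomial.X i : MvPolynomial (Fin (n + 1)) k) ∈ grading k n 1 :=
      (hlin _).2 ⟨c, rfl⟩
    have h0 := h _ hF ((vanishes_iff Z e v hℓ hm hu hι 1 _ hF).2 (by simpa using hc))
    exact Fintype.linearIndependent_iff.mp (MvPolynomial.linearIndependent_X (Fin (n + 1)) k) c h0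
  · intro h F hF hv
    rw [vanishes_iff Z e v hℓ hm hu hι] at hv
    obtain ⟨c, rfl⟩ := (hlin F).1 hF
    have h0 := h c (by simpa using hv)
    simp [h0]

end Vanishing

end AGor
end

noncomputable section
namespace AGor
attribute [local instance] MvPolynomial.gradedAlgebra

/-! ### Affine coordinates on finite subschemes -/

open HomogeneousLocalization

section Charts

variable {k : Type u} [Field k] {n : ℕ}

lemma algebraMap_grading_zero_surjective :
    Function.Surjective (algebraMap k (grading k n 0)) := by
  rintro ⟨F, hF⟩
  refine ⟨MvPolynomial.coeff 0 F, Subtype.ext ?_⟩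
  have h : F.totalDegree = 0 := (MvPolynomial.totalDegree_zero_iff_isHomogeneous (p := F)).mpr hF
  exact (MvPolynomial.totalDegree_eq_zero_iff_eq_C.mp h).symm

instance : IsScalarTower k (grading k n 0) (MvPolynomial (Fin (n + 1)) k) :=
  ⟨fun c a F => smul_mul_assoc c (a : MvPolynomial (Fin (n + 1)) k) F⟩

instance : Algebra.FiniteType (grading k n 0) (MvPolynomial (Fin (n + 1)) k) :=
  Algebra.FiniteType.of_restrictScalars_finiteType k _ _

instance : IsProper (PP.toSpec k n) := by
  have : IsClosedImmersion (Spec.map (CommRingCat.ofHom (algebraMap k (grading k n 0)))) :=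
    IsClosedImmersion.spec_of_surjective _ algebraMap_grading_zero_surjective
  rw [PP.toSpec]
  infer_instance

lemma mem_of_forall_X_mem {σ : Type*} {I : Ideal (MvPolynomial σ k)}
    (h : ∀ i, MvPolynomial.X i ∈ I) {d : ℕ} (hd : 0 < d) {F : MvPolynomial σ k}
    (hF : F.IsHomogeneous d) : F ∈ I := by
  rw [F.as_sum]
  refine Ideal.sum_mem _ fun s hs => ?_
  have hs' := hF (MvPolynomial.mem_support_iff.mp hs)
  have hs0 : s ≠ 0 := by
    rintro rfl
    simp at hs'
    omega
  obtain ⟨i, hi⟩ := Finsupp.support_nonempty_iff.mpr hs0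
  rw [MvPolynomial.monomial_eq]
  refine Ideal.mul_mem_left _ _ ?_
  exact Ideal.mem_of_dvd _ (Finset.dvd_prod_of_mem _ hi) (Ideal.pow_mem_of_mem _ (h i) _
        (Nat.pos_of_ne_zero (Finsupp.mem_support_iff.mp hi)))

/-- Finitely many points of projective space lie outside some hyperplane. -/
lemma exists_linear_form [Infinite k] {ι : Type*} [Finite ι] (x : ι → PP k n) :
    ∃ ℓ ∈ grading k n 1, ∀ i, x i ∈ Proj.basicOpen (grading k n) ℓ := by
  let p : ι → Ideal (MvPolynomial (Fin (n + 1)) k) := fun i =>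
    (show ProjectiveSpectrum (grading k n) from x i).asHomogeneousIdeal.toIdeal
  let W : ι → Submodule k (grading k n 1) := fun i =>
    ((p i).restrictScalars k).comap (grading k n 1).subtype
  -- A relevant homogeneous prime cannot contain all linear forms; and a vector space over an
  -- infinite field is not a finite union of proper subspaces.
  have hW : ∀ i, W i ≠ ⊤ := fun i hi => by
    refine (show ProjectiveSpectrum (grading k n) from x i).not_irrelevant_le ?_
    rw [HomogeneousIdeal.irrelevant_le]
    intro d hd F hF
    refine mem_of_forall_X_mem (I := p i) (fun j => ?_) hd hF
    have hj : (⟨MvPolynomial.X j, MvPolynomial.isHomogeneous_X k j⟩ : grading k n 1) ∈ W i := by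
      rw [hi]
      trivial
    exact hj
  have hne : (⋃ i, (W i : Set (grading k n 1))) ≠ Set.univ := fun h => by
    obtain ⟨i, hi⟩ := Subspace.exists_eq_top_of_iUnion_eq_univ h
    exact hW i hi
  obtain ⟨ℓ, hℓ⟩ := (Set.ne_univ_iff_exists_notMem _).mp hne
  refine ⟨ℓ, ℓ.2, fun i hi => hℓ ?_⟩
  exact Set.mem_iUnion.mpr ⟨i, hi⟩

lemma isArtinianScheme_of_dim_zero (Z : ClosedSubscheme k n)
    (h : topologicalKrullDim Z.X = 0) : IsArtinianScheme Z.X := by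
  have := Z.isClosedImmersion
  have : IsLocallyNoetherian Z.X := LocallyOfFiniteType.isLocallyNoetherian (Z.ι ≫ PP.toSpec k n)
  have : IsLocallyArtinian Z.X := IsLocallyArtinian.of_topologicalKrullDim_le_zero h.le
  have : CompactSpace Z.X :=
    QuasiCompact.compactSpace_of_compactSpace (Z.ι ≫ PP.toSpec k n)
  exact {}

/-- The fraction `F / ℓ ^ d` as a polynomial in the fractions `x_i / ℓ`. -/
lemma map_mk_eq_aeval {B : Type u} [CommRing B] [Algebra k B]
    {ℓ : MvPolynomial (Fin (n + 1)) k} (hℓ : ℓ ∈ grading k n 1) (θ : Away (grading k n) ℓ →+* B)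
    (hθ : ∀ c, θ (fromZeroRingHom (grading k n) _ (algebraMap k (grading k n 0) c)) =
      algebraMap k B c) (d : ℕ) (F : MvPolynomial (Fin (n + 1)) k) (hF : F ∈ grading k n (d • 1)) :
    θ (Away.mk (grading k n) hℓ d F hF) = MvPolynomial.aeval
      (fun i => θ (Away.mk (grading k n) hℓ 1 (MvPolynomial.X i)
        (by simpa using MvPolynomial.isHomogeneous_X k i))) F := by
  let : Algebra k (Away (grading k n) ℓ) :=
    ((fromZeroRingHom (grading k n) _).comp (algebraMap k (grading k n 0))).toAlgebra
  let θ' : Away (grading k n) ℓ →ₐ[k] B := { θ with commutes' := hθ }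
  let val : Away (grading k n) ℓ →ₐ[k] Localization.Away ℓ :=
    { algebraMap (Away (grading k n) ℓ) (Localization.Away ℓ) with
      commutes' := fun c => by
        change algebraMap (Away (grading k n) ℓ) (Localization.Away ℓ)
          (fromZeroRingHom (grading k n) _ (algebraMap k (grading k n 0) c)) = _
        rw [IsScalarTower.algebraMap_apply k (MvPolynomial (Fin (n + 1)) k) (Localization.Away ℓ),
          ← Localization.mk_one_eq_algebraMap]
        rfl }
  let t : Fin (n + 1) → Away (grading k n) ℓ := fun i => Away.mk (grading k n) hℓ 1
    (MvPolynomial.X i) (by simpa using MvPolynomial.isHomogeneous_X k i)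
  let inv : Localization.Away ℓ := Localization.mk 1 (⟨ℓ, 1, pow_one ℓ⟩ : Submonoid.powers ℓ)
  have hinv : inv * algebraMap _ _ ℓ = 1 := by
    rw [← Localization.mk_one_eq_algebraMap, Localization.mk_mul]
    simpa using Localization.mk_self (⟨ℓ, 1, pow_one ℓ⟩ : Submonoid.powers ℓ)
  have hval : ∀ d F hF, val (Away.mk (grading k n) hℓ d F hF) = inv ^ d * algebraMap _ _ F := by
    intro d F hF
    have h1 : val (Away.mk (grading k n) hℓ d F hF) =
      Localization.mk F (⟨ℓ ^ d, d, rfl⟩ : Submonoid.powers ℓ) := rfl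
    rw [h1, ← Localization.mk_one_eq_algebraMap, Localization.mk_pow, Localization.mk_mul]
    simp only [one_pow, one_mul, mul_one]
    congr 1
  -- Checked in the full localization at ℓ, where F(x_0/ℓ, …, x_n/ℓ) = F/ℓ^d by homogeneity.
  have key : Away.mk (grading k n) hℓ d F hF = MvPolynomial.aeval t F := by
    apply HomogeneousLocalization.val_injective
    change val (Away.mk (grading k n) hℓ d F hF) = val (MvPolynomial.aeval t F)
    have h2 : val (MvPolynomial.aeval t F) = MvPolynomial.aeval (fun i => val (t i)) F :=
      MvPolynomial.comp_aeval_apply t val F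
    have h3 : (fun i => val (t i)) = fun i => inv * algebraMap (MvPolynomial (Fin (n + 1)) k)
        (Localization.Away ℓ) (MvPolynomial.X i) := by
      ext i
      rw [hval, pow_one]
    have h4 : MvPolynomial.aeval (fun i => algebraMap (MvPolynomial (Fin (n + 1)) k)
        (Localization.Away ℓ) (MvPolynomial.X i)) F = algebraMap _ _ F := by
      have := MvPolynomial.comp_aeval_apply (R := k)
        (MvPolynomial.X : Fin (n + 1) → MvPolynomial (Fin (n + 1)) k)
        (IsScalarTower.toAlgHom k (MvPolynomial (Fin (n + 1)) k) (Localization.Away ℓ)) F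
      rw [MvPolynomial.aeval_X_left_apply] at this
      exact this.symm
    rw [h2, h3, hval, aeval_smul_of_isHomogeneous _ inv
      (d := d) (by simpa using hF), h4]
  rw [key]
  exact MvPolynomial.comp_aeval_apply t θ' F

/-- A closed subscheme of dimension zero is the spectrum of an algebra generated by homogeneous
coordinates on which some linear form takes the value one. -/
theorem exists_chart [Infinite k] (Z : ClosedSubscheme k n) (h : topologicalKrullDim Z.X = 0) :
    ∃ (B : Type u) (_ : CommRing B) (_ : Algebra k B) (v : Fin (n + 1) → B)
      (ℓ : MvPolynomial (Fin (n + 1)) k) (hℓ : ℓ ∈ grading k n 1)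
      (hu : IsUnit (MvPolynomial.aeval v ℓ)) (e : Z.X ≅ Spec (CommRingCat.of B)),
      MvPolynomial.aeval v ℓ = 1 ∧ Z.ι = e.hom ≫ evalMap v hℓ one_pos hu ∧
      Algebra.adjoin k (Set.range v) = ⊤ := by
  have := Z.isClosedImmersion
  have := isArtinianScheme_of_dim_zero Z h
  -- Z has finitely many points, so it lies in one chart D₊(ℓ) and is closed there, i.e. a quotient
  -- of the ring of the chart.
  obtain ⟨ℓ, hℓ, hZ⟩ := exists_linear_form Z.ι
  have hrange : Set.range Z.ι ⊆ Set.range (Proj.awayι (grading k n) ℓ hℓ one_pos) := by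
    rintro _ ⟨z, rfl⟩
    have := hZ z
    rw [← Proj.opensRange_awayι (grading k n) ℓ hℓ one_pos] at this
    exact this
  let f := IsOpenImmersion.lift (Proj.awayι (grading k n) ℓ hℓ one_pos) Z.ι hrange
  have hf : f ≫ Proj.awayι (grading k n) ℓ hℓ one_pos = Z.ι := IsOpenImmersion.lift_fac _ _ _
  have : IsClosedImmersion (f ≫ Proj.awayι (grading k n) ℓ hℓ one_pos) := by rwa [hf]
  have hcl : IsClosedImmersion f :=
    IsClosedImmersion.of_comp f (Proj.awayι (grading k n) ℓ hℓ one_pos)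
  obtain ⟨I, e, he⟩ := (IsClosedImmersion.Spec_iff (f := f)).mp hcl
  let B := Away (grading k n) ℓ ⧸ I
  let θ : Away (grading k n) ℓ →+* B := Ideal.Quotient.mk I
  let : Algebra k B :=
    (θ.comp ((fromZeroRingHom (grading k n) _).comp (algebraMap k (grading k n 0)))).toAlgebra
  let v : Fin (n + 1) → B := fun i => θ (Away.mk (grading k n) hℓ 1 (MvPolynomial.X i)
        (by simpa using MvPolynomial.isHomogeneous_X k i))
  have hv : ∀ d F hF, θ (Away.mk (grading k n) hℓ d F hF) = MvPolynomial.aeval v F :=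
    map_mk_eq_aeval hℓ θ fun _ => rfl
  have h1 : MvPolynomial.aeval v ℓ = 1 := by
    rw [← hv 1 ℓ (by simpa using hℓ), ← map_one θ]
    congr 1
    ext
    rw [Away.val_mk, HomogeneousLocalization.val_one]
    simp only [pow_one]
    exact Localization.mk_self_mk ℓ (Submonoid.mem_powers ℓ)
  refine ⟨B, inferInstance, this, v, ℓ, hℓ, h1 ▸ isUnit_one, e, h1, ?_, ?_⟩
  · have hθ : θ = evalAway v ℓ (h1 ▸ isUnit_one) :=
      eq_evalAway v hℓ _ θ fun d F hF => by rw [h1, one_pow, mul_one, hv]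
    rw [← hf, he, evalMap, ← hθ, Category.assoc]
  · rw [Algebra.adjoin_range_eq_range_aeval, AlgHom.range_eq_top]
    intro b
    obtain ⟨a, rfl⟩ := Ideal.Quotient.mk_surjective b
    obtain ⟨d, F, hF, rfl⟩ := Away.mk_surjective _ hℓ a
    exact ⟨F, (hv d F hF).symm⟩

variable {B : Type u} [CommRing B] [Algebra k B]

lemma evalAway_surjective (v : Fin (n + 1) → B) {ℓ : MvPolynomial (Fin (n + 1)) k}
    (hℓ : ℓ ∈ grading k n 1) (hu : IsUnit (MvPolynomial.aeval v ℓ))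
    (h1 : MvPolynomial.aeval v ℓ = 1) (hv : Algebra.adjoin k (Set.range v) = ⊤) :
    Function.Surjective (evalAway v ℓ hu) := by
  intro b
  have hb : b ∈ Algebra.adjoin k (Set.range v) := hv ▸ Algebra.mem_top
  rw [← RingHom.mem_range]
  induction hb using Algebra.adjoin_induction with
  | mem x hx =>
    obtain ⟨i, rfl⟩ := hx
    refine ⟨Away.mk (grading k n) hℓ 1 (MvPolynomial.X i)
      (by simpa using MvPolynomial.isHomogeneous_X k i), ?_⟩
    have := evalAway_mk v hℓ hu 1 (MvPolynomial.X i)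
      (by simpa using MvPolynomial.isHomogeneous_X k i)
    rwa [h1, one_pow, mul_one, MvPolynomial.aeval_X] at this
  | algebraMap c => exact ⟨_, evalAway_fromZeroRingHom v hu c⟩
  | add x y _ _ hx hy => exact add_mem hx hy
  | mul x y _ _ hx hy => exact mul_mem hx hy

/-- A finite subscheme of projective space given by coordinates generating its algebra. -/
lemma isClosedImmersion_evalMap [Module.Finite k B] (v : Fin (n + 1) → B)
    {ℓ : MvPolynomial (Fin (n + 1)) k}
    (hℓ : ℓ ∈ grading k n 1) (hu : IsUnit (MvPolynomial.aeval v ℓ))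
    (h1 : MvPolynomial.aeval v ℓ = 1) (hv : Algebra.adjoin k (Set.range v) = ⊤) :
    IsClosedImmersion (evalMap v hℓ one_pos hu) := by
  -- Finite over k and P^n separated: the morphism to P^n is finite, so its image is closed. Inside
  -- the chart it is already a closed immersion.
  have h2 : IsFinite (evalMap v hℓ one_pos hu ≫ PP.toSpec k n) := by
    rw [evalMap_toSpec, IsFinite.SpecMap_iff]
    exact RingHom.finite_algebraMap.mpr inferInstance
  have h3 : IsFinite (evalMap v hℓ one_pos hu) := IsFinite.of_comp _ (PP.toSpec k n)
  have h4 : IsClosedImmersion (Spec.map (CommRingCat.ofHom (evalAway v ℓ hu))) :=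
    IsClosedImmersion.spec_of_surjective _ (evalAway_surjective v hℓ hu h1 hv)
  have h5 : IsPreimmersion (evalMap v hℓ one_pos hu) := by
    rw [evalMap]
    infer_instance
  exact IsClosedImmersion.of_isPreimmersion _ (evalMap v hℓ one_pos hu).isClosedMap.isClosed_range

end Charts

end AGor
end

noncomputable section
namespace AGor
attribute [local instance] MvPolynomial.gradedAlgebra

/-! ### Finite schemes and their algebras -/

section Finite

variable {k : Type u} [Field k]

lemma degree_eq_finrank {X : Over (Spec (CommRingCat.of k))} {B : CommAlgCat.{u} k}
    (i : X ≅ specOver B) : degree X = Module.finrank k B := by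
  let j : Spec (CommRingCat.of B) ⟶ X.left := i.inv.left
  have hj : IsIso j := inferInstanceAs (IsIso ((Over.forget _).map i.inv))
  let f : Γ(X.left, ⊤) ⟶ CommRingCat.of B := j.appTop ≫ (Scheme.ΓSpecIso (.of B)).hom
  have hf : IsIso f := by
    have : IsIso j.appTop := inferInstanceAs (IsIso (Scheme.Γ.map j.op))
    exact IsIso.comp_isIso
  let φ : Γ(X.left, ⊤) ≃+* B := (asIso f).commRingCatIsoToRingEquiv
  have h : ∀ c, φ (globalSectionsHom X c) = algebraMap k B c := by
    have : ((Scheme.ΓSpecIso (CommRingCat.of k)).inv ≫ X.hom.appTop) ≫ f =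
        CommRingCat.ofHom (algebraMap k B) := by
      have h1 : X.hom.appTop ≫ j.appTop =
          (Spec.map (CommRingCat.ofHom (algebraMap k B))).appTop := by
        rw [← Scheme.Hom.comp_appTop]
        congr 1
        exact Over.w i.inv
      rw [Category.assoc]
      change _ ≫ X.hom.appTop ≫ j.appTop ≫ _ = _
      rw [reassoc_of% h1, Scheme.ΓSpecIso_naturality, Iso.inv_hom_id_assoc]
    intro c
    exact congrArg (fun g => g.hom c) this
  let := (globalSectionsHom X).toAlgebra
  exact LinearEquiv.finrank_eq
    (AlgEquiv.ofRingEquiv (f := φ) h).toLinearEquiv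

lemma nonempty_specOver_iso_iff {B C : CommAlgCat.{u} k} :
    Nonempty (specOver B ≅ specOver C) ↔ Nonempty (B ≃ₐ[k] C) := by
  constructor
  · rintro ⟨i⟩
    let j : Spec (CommRingCat.of B) ≅ Spec (CommRingCat.of C) := (Over.forget _).mapIso i
    let φ : CommRingCat.of C ≅ CommRingCat.of B := (Scheme.Spec.preimageIso j).unop
    have hφ : Spec.map φ.hom = j.hom := Scheme.Spec.map_preimage j.hom
    refine ⟨(AlgEquiv.ofRingEquiv (f := φ.commRingCatIsoToRingEquiv) fun c => ?_).symm⟩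
    have h : CommRingCat.ofHom (algebraMap k C) ≫ φ.hom = CommRingCat.ofHom (algebraMap k B) := by
      apply Spec.map_injective
      rw [Spec.map_comp, hφ]
      exact Over.w i.hom
    exact congrArg (fun g => g.hom c) h
  · rintro ⟨g⟩
    let φ : CommRingCat.of C ≅ CommRingCat.of B := g.symm.toRingEquiv.toCommRingCatIso
    refine ⟨Over.isoMk (Scheme.Spec.mapIso φ.op) ?_⟩
    change Spec.map φ.hom ≫ Spec.map (CommRingCat.ofHom (algebraMap k C)) =
      Spec.map (CommRingCat.ofHom (algebraMap k B))
    rw [← Spec.map_comp]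
    congr 1
    ext c
    exact g.symm.commutes c

lemma topologicalKrullDim_Spec (B : Type u) [CommRing B] [Nontrivial B] [IsArtinianRing B] :
    topologicalKrullDim (Spec (CommRingCat.of B)) = 0 := by
  rw [← ringKrullDimZero_iff_ringKrullDim_eq_zero.mp (inferInstance : Ring.KrullDimLE 0 B)]
  exact PrimeSpectrum.topologicalKrullDim_eq_ringKrullDim B

end Finite

section Coordinates

variable {k : Type u} [Field k] {n : ℕ} {B : Type u} [CommRing B] [Algebra k B]

/-- The tuple `v` generates the `k`-algebra `B`, a linear combination of it is `1`, and `Z` is the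
image of `Spec B` under the morphism with homogeneous coordinates `v`. -/
def IsChart (Z : ClosedSubscheme k n) (v : Fin (n + 1) → B) : Prop :=
  ∃ (ℓ : MvPolynomial (Fin (n + 1)) k) (hℓ : ℓ ∈ grading k n 1)
    (hu : IsUnit (MvPolynomial.aeval v ℓ)) (e : Z.X ≅ Spec (CommRingCat.of B)),
    MvPolynomial.aeval v ℓ = 1 ∧ Z.ι = e.hom ≫ evalMap v hℓ one_pos hu ∧
    Algebra.adjoin k (Set.range v) = ⊤

variable {Z : ClosedSubscheme k n} {v : Fin (n + 1) → B}

lemma IsChart.adjoin_eq_top (h : IsChart Z v) : Algebra.adjoin k (Set.range v) = ⊤ := by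
  obtain ⟨ℓ, hℓ, hu, e, h1, hι, hv⟩ := h
  exact hv

lemma aeval_mem_span_of_mem_grading_one {ℓ : MvPolynomial (Fin (n + 1)) k}
    (hℓ : ℓ ∈ grading k n 1) (v : Fin (n + 1) → B) :
    MvPolynomial.aeval v ℓ ∈ Submodule.span k (Set.range v) := by
  rw [grading, MvPolynomial.homogeneousSubmodule_one_eq_span_X,
    Submodule.mem_span_range_iff_exists_fun] at hℓ
  obtain ⟨c, rfl⟩ := hℓ
  simp only [map_sum, map_smul, MvPolynomial.aeval_X]
  exact Submodule.sum_mem _ fun i _ =>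
    Submodule.smul_mem _ _ (Submodule.subset_span ⟨i, rfl⟩)

lemma IsChart.one_mem_span (h : IsChart Z v) : (1 : B) ∈ Submodule.span k (Set.range v) := by
  obtain ⟨ℓ, hℓ, hu, e, h1, hι, hv⟩ := h
  rw [← h1]
  exact aeval_mem_span_of_mem_grading_one hℓ v

lemma IsChart.isNonDegenerate_iff (h : IsChart Z v) :
    Z.IsNonDegenerate ↔ LinearIndependent k v := by
  obtain ⟨ℓ, hℓ, hu, e, h1, hι, hv⟩ := h
  exact AGor.isNonDegenerate_iff Z e v hℓ one_pos hu hι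

lemma IsChart.homogeneousIdeal_eq (h : IsChart Z v) : Z.homogeneousIdeal =
    Ideal.span {F | ∃ d : ℕ, F ∈ grading k n d ∧ MvPolynomial.aeval v F = 0} := by
  obtain ⟨ℓ, hℓ, hu, e, h1, hι, hv⟩ := h
  exact AGor.homogeneousIdeal_eq Z e v hℓ one_pos hu hι

lemma IsChart.nonempty_iso (h : IsChart Z v) :
    Nonempty (Z.toOver ≅ specOver (CommAlgCat.of k B)) := by
  obtain ⟨ℓ, hℓ, hu, e, h1, hι, hv⟩ := h
  refine ⟨Over.isoMk e ?_⟩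
  change e.hom ≫ Spec.map (CommRingCat.ofHom (algebraMap k B)) = Z.ι ≫ PP.toSpec k n
  rw [hι, Category.assoc, evalMap_toSpec]

lemma IsChart.degree_eq (h : IsChart Z v) : degree Z.toOver = Module.finrank k B := by
  obtain ⟨i⟩ := h.nonempty_iso
  exact degree_eq_finrank i

/-- The unit b only rescales homogeneous coordinates, which `evalMap` does not see. -/
lemma IsChart.projectivelyEquivalent (h : IsChart Z v) {C : Type u} [CommRing C] [Algebra k C]
    {W : ClosedSubscheme k n} {w : Fin (n + 1) → C} (hW : IsChart W w) (g : C ≃ₐ[k] B)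
    (φ : GL (Fin (n + 1)) k) {b : B} (hb : IsUnit b)
    (hg : ∀ i, g (w i) = b * substTuple (φ : Matrix (Fin (n + 1)) (Fin (n + 1)) k) v i) :
    Z.ProjectivelyEquivalent W := by
  obtain ⟨ℓ, hℓ, hu, e, h1, hι, hv⟩ := h
  obtain ⟨ℓ', hℓ', hu', e', h1', hι', hv'⟩ := hW
  let γ : CommRingCat.of C ≅ CommRingCat.of B := g.toRingEquiv.toCommRingCatIso
  refine ⟨φ, e ≪≫ (Scheme.Spec.mapIso γ.op) ≪≫ e'.symm, ?_⟩
  have hs : Spec.map (CommRingCat.ofHom ((g : C →ₐ[k] B) : C →+* B)) ≫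
      evalMap w hℓ' one_pos hu' = evalMap v hℓ one_pos hu ≫ projLinear φ := by
    have hw : (fun i => (g : C →ₐ[k] B) (w i)) =
      fun i => b * substTuple (φ : Matrix (Fin (n + 1)) (Fin (n + 1)) k) v i := funext hg
    have h2 := isUnit_aeval_comp (g : C →ₐ[k] B) hu'
    have h3 := h2
    rw [hw, aeval_smul_of_isHomogeneous _ b hℓ', IsUnit.mul_iff] at h3
    rw [SpecMap_comp_evalMap, evalMap_comp_projLinear φ v hℓ' one_pos h3.2,
      ← evalMap_mul _ b hℓ' one_pos h3.2 (hw ▸ h2) hb]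
    congr 1
  simp only [Iso.trans_hom, Iso.symm_hom, Category.assoc, hι, hι', Iso.inv_hom_id_assoc]
  rw [← hs]
  rfl

lemma IsChart.nonempty_iso_of_projectivelyEquivalent (h : IsChart Z v)
    {W : ClosedSubscheme k n} (hZW : Z.ProjectivelyEquivalent W) :
    Nonempty (Z.toOver ≅ W.toOver) := by
  obtain ⟨ℓ, hℓ, hu, e, h1, hι, hv⟩ := h
  obtain ⟨φ, i, hi⟩ := hZW
  refine ⟨Over.isoMk i ?_⟩
  change i.hom ≫ W.ι ≫ PP.toSpec k n = Z.ι ≫ PP.toSpec k n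
  have h2 : linSubst (φ : Matrix (Fin (n + 1)) (Fin (n + 1)) k)
      (linSubst ((φ⁻¹ : GL (Fin (n + 1)) k) : Matrix (Fin (n + 1)) (Fin (n + 1)) k) ℓ) = ℓ := by
    rw [linSubst_comp, Units.inv_mul, linSubst_one]
  have h3 := evalMap_comp_projLinear φ v (linSubst_mem _ hℓ) one_pos
    (by rwa [aeval_substTuple, h2]) hℓ one_pos hu
  rw [reassoc_of% hi, hι, Category.assoc, Category.assoc, reassoc_of% h3, evalMap_toSpec,
    evalMap_toSpec]

/-- The closed subscheme with homogeneous coordinates `v`. -/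
lemma exists_isChart_of_adjoin_eq_top [Module.Finite k B] (v : Fin (n + 1) → B)
    (hv : Algebra.adjoin k (Set.range v) = ⊤) (h1 : (1 : B) ∈ Submodule.span k (Set.range v)) :
    ∃ Z : ClosedSubscheme k n, IsChart Z v := by
  obtain ⟨c, hc⟩ := (Submodule.mem_span_range_iff_exists_fun k).mp h1
  have hX : MvPolynomial.aeval v
      (∑ i, c i • MvPolynomial.X i : MvPolynomial (Fin (n + 1)) k) = 1 := by
    simpa only [map_sum, map_smul, MvPolynomial.aeval_X] using hc
  have hℓ : (∑ i, c i • MvPolynomial.X i : MvPolynomial (Fin (n + 1)) k) ∈ grading k n 1 :=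
    Submodule.sum_mem _ fun i _ =>
      Submodule.smul_mem _ _ (MvPolynomial.isHomogeneous_X k i)
  have hu := isUnit_one (M := B)
  rw [← hX] at hu
  exact ⟨⟨_, evalMap v hℓ one_pos hu, isClosedImmersion_evalMap v hℓ hu hX hv⟩,
    _, hℓ, hu, Iso.refl _, hX, (Category.id_comp _).symm, hv⟩

lemma IsChart.topologicalKrullDim_eq_zero (h : IsChart Z v) [Nontrivial B] [IsArtinianRing B] :
    topologicalKrullDim Z.X = 0 := by
  obtain ⟨ℓ, hℓ, hu, e, h1, hι, hv⟩ := h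
  rw [← topologicalKrullDim_Spec B]
  exact IsHomeomorph.topologicalKrullDim_eq _ (e.hom.homeomorph).isHomeomorph

end Coordinates

end AGor
end

noncomputable section
namespace AGor
open Polynomial

/-! ### The cone over a finite scheme spanning a hyperplane of its algebra -/

section

variable {k : Type u} [Field k] {B S : Type u} [CommRing B] [Algebra k B] [CommRing S] [Algebra k S]

/-- `S` is identified with the polynomials over `B` whose coefficients in degree `0` and `1` lie
in `k` and in the kernel of `μ`. -/
structure IsCone (Ψ : S →ₐ[k] B[X]) (μ : B →ₗ[k] k) : Prop where
  injective : Function.Injective Ψ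
  map_one : μ 1 = 0
  mem_range_iff : ∀ p, (∃ s, Ψ s = p) ↔ (∃ c, p.coeff 0 = algebraMap k B c) ∧ μ (p.coeff 1) = 0

namespace IsCone

variable {Ψ : S →ₐ[k] B[X]} {μ : B →ₗ[k] k}

lemma map_algebraMap (h : IsCone Ψ μ) (c : k) : μ (algebraMap k B c) = 0 := by
  rw [Algebra.algebraMap_eq_smul_one, map_smul, h.map_one, smul_zero]

lemma coeff_zero (h : IsCone Ψ μ) (s : S) : ∃ c, (Ψ s).coeff 0 = algebraMap k B c :=
  ((h.mem_range_iff _).1 ⟨s, rfl⟩).1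

lemma coeff_one (h : IsCone Ψ μ) (s : S) : μ ((Ψ s).coeff 1) = 0 :=
  ((h.mem_range_iff _).1 ⟨s, rfl⟩).2

lemma exists_eq_mul_X (h : IsCone Ψ μ) {b : B} (hb : μ b = 0) : ∃ s, Ψ s = C b * X :=
  (h.mem_range_iff _).2 ⟨⟨0, by simp⟩, by simpa using hb⟩

lemma exists_eq_mul_X_pow (h : IsCone Ψ μ) (p : B[X]) : ∃ s, Ψ s = p * X ^ 2 :=
  (h.mem_range_iff _).2 ⟨⟨0, by simp⟩, by simp [coeff_mul_X_pow']⟩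

lemma exists_eq_X_sub_C (h : IsCone Ψ μ) (c : k) : ∃ s, Ψ s = X - C (algebraMap k B c) :=
  (h.mem_range_iff _).2 ⟨⟨-c, by simp⟩, by simpa [coeff_C] using h.map_one⟩

lemma mul_eq_zero (h : IsCone Ψ μ) {c : k} {x : S} (hx : Ψ x = X - C (algebraMap k B c)) (q : S)
    (hq : x * q = 0) : q = 0 := by
  apply h.injective
  have := congrArg Ψ hq
  rw [map_mul, hx, map_zero, mul_comm] at this
  rw [map_zero]
  exact (monic_X_sub_C _).mul_left_eq_zero_iff.mp this

lemma mem_span_iff (h : IsCone Ψ μ) {x : S} {p : B[X]} (hx : Ψ x = p) (s : S) :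
    s ∈ Ideal.span {x} ↔ ∃ q : B[X], Ψ s = p * q ∧
      (∃ c, q.coeff 0 = algebraMap k B c) ∧ μ (q.coeff 1) = 0 := by
  rw [Ideal.mem_span_singleton]
  constructor
  · rintro ⟨r, rfl⟩
    exact ⟨Ψ r, by rw [map_mul, hx], h.coeff_zero r, h.coeff_one r⟩
  · rintro ⟨q, hq, hq'⟩
    obtain ⟨r, rfl⟩ := (h.mem_range_iff q).2 hq'
    exact ⟨r, h.injective (by rw [hq, map_mul, hx])⟩

/-- Division by t lowers degrees: the quotient must again have constant term in k and linear term in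
ker μ. So S/t has graded pieces k, ker μ/k and B/ker μ. -/
lemma mem_span_X_iff (h : IsCone Ψ μ) {x : S} (hx : Ψ x = X) (s : S) :
    s ∈ Ideal.span {x} ↔ (Ψ s).coeff 0 = 0 ∧ (∃ c, (Ψ s).coeff 1 = algebraMap k B c) ∧
      μ ((Ψ s).coeff 2) = 0 := by
  rw [h.mem_span_iff hx]
  constructor
  · rintro ⟨q, hq, hq'⟩
    rw [hq]
    simpa [coeff_X_mul] using hq'
  · rintro ⟨h0, h1, h2⟩
    obtain ⟨q, hq⟩ := X_dvd_iff.mpr h0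
    rw [hq, coeff_X_mul] at h1 h2
    exact ⟨q, hq, h1, h2⟩

/-- Away from the vertex of the cone the fibre is all of Spec B: the quotient q of a division by t −
c satisfies the two coefficient conditions automatically, since s_0 = −c q_0 and s_1 = q_0 − c q_1
with c invertible. -/
lemma mem_span_X_sub_C_iff (h : IsCone Ψ μ) {c : k} (hc : c ≠ 0) {x : S}
    (hx : Ψ x = X - C (algebraMap k B c)) (s : S) :
    s ∈ Ideal.span {x} ↔ (Ψ s).eval (algebraMap k B c) = 0 := by
  rw [h.mem_span_iff hx]
  constructor
  · rintro ⟨q, hq, hq'⟩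
    simp [hq]
  · intro h0
    obtain ⟨q, hq⟩ := dvd_iff_isRoot.mpr h0
    refine ⟨q, hq, ?_⟩
    obtain ⟨a, ha⟩ := h.coeff_zero s
    have h1 := h.coeff_one s
    rw [hq, mul_comm, mul_coeff_zero] at ha
    rw [hq, mul_comm, coeff_mul_X_sub_C] at h1
    have h0 : q.coeff 0 = algebraMap k B (-(a * c⁻¹)) := by
      rw [map_neg, map_mul, ← ha]
      simp only [coeff_sub, coeff_X_zero, coeff_C_zero, zero_sub, mul_neg, neg_mul, neg_neg, mul_assoc, ← map_mul,
        mul_inv_cancel₀ hc, _root_.map_one, mul_one]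
    refine ⟨⟨_, h0⟩, ?_⟩
    rw [h0, map_sub, h.map_algebraMap, zero_sub, neg_eq_zero, mul_comm, ← Algebra.smul_def,
      map_smul, smul_eq_mul] at h1
    exact (_root_.mul_eq_zero.mp h1).resolve_left hc

lemma finite_quotient {x : S} {M : Type*} [AddCommGroup M] [Module k M] [Module.Finite k M]
    (f : S →ₗ[k] M) (hf : ∀ s, f s = 0 → s ∈ Ideal.span {x}) :
    Module.Finite k (S ⧸ Ideal.span {x}) := by
  have h1 : Module.Finite k (S ⧸ LinearMap.ker f) :=
    Module.Finite.equiv f.quotKerEquivRange.symm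
  let g : S →ₗ[k] S ⧸ Ideal.span {x} := (Ideal.Quotient.mkₐ k (Ideal.span {x})).toLinearMap
  have hg : LinearMap.ker f ≤ LinearMap.ker g := fun s hs =>
    Ideal.Quotient.eq_zero_iff_mem.mpr (hf s hs)
  refine Module.Finite.of_surjective (Submodule.liftQ _ g hg) fun d => ?_
  obtain ⟨s, rfl⟩ := Ideal.Quotient.mk_surjective d
  exact ⟨Submodule.Quotient.mk s, rfl⟩

/-- The coefficient of degree `i`. -/
def coeffMap (Ψ : S →ₐ[k] B[X]) (i : ℕ) : S →ₗ[k] B :=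
  ((lcoeff B i).restrictScalars k) ∘ₗ Ψ.toLinearMap

lemma finite_quotient_X [Module.Finite k B] (h : IsCone Ψ μ) {x : S} (hx : Ψ x = X) :
    Module.Finite k (S ⧸ Ideal.span {x}) := by
  refine finite_quotient ((coeffMap Ψ 0).prod ((coeffMap Ψ 1).prod (coeffMap Ψ 2))) fun s hs => ?_
  have h0 : coeffMap Ψ 0 s = 0 := congrArg Prod.fst hs
  have h1 : coeffMap Ψ 1 s = 0 := congrArg (fun q => q.2.1) hs
  have h2 : coeffMap Ψ 2 s = 0 := congrArg (fun q => q.2.2) hs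
  exact (h.mem_span_X_iff hx s).2 ⟨h0, ⟨0, by rw [_root_.map_zero]; exact h1⟩,
    (congrArg μ h2).trans (_root_.map_zero μ)⟩

/-- The functional b ↦ μ(ab) vanishes on ker μ, so it is a scalar multiple of μ, and nondegeneracy
turns this into a being that scalar. -/
lemma eq_algebraMap_of_forall (hμ : ∀ a, (∀ b, μ (a * b) = 0) → a = 0)
    {a : B} (ha : ∀ b, μ b = 0 → μ (a * b) = 0) : ∃ c, a = algebraMap k B c := by
  by_cases h0 : ∃ b₀, μ b₀ ≠ 0
  · obtain ⟨b₀, hb₀⟩ := h0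
    refine ⟨μ (a * b₀) / μ b₀, ?_⟩
    rw [← sub_eq_zero]
    refine hμ _ fun b => ?_
    have h1 := ha (b - (μ b / μ b₀) • b₀) (by simp [hb₀])
    rw [mul_sub, map_sub, mul_smul_comm, map_smul, smul_eq_mul, sub_eq_zero] at h1
    rw [sub_mul, map_sub, h1, ← Algebra.smul_def, map_smul, smul_eq_mul]
    ring
  · push Not at h0
    exact ⟨0, by rw [_root_.map_zero]; exact hμ a fun b => h0 _⟩

/-- By the Nullstellensatz each maximal ideal contains some t − c, which is regular because it is
monic. For c ≠ 0 the quotient is B with its functional μ. For c = 0 the functional is μ of the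
coefficient of t²: it pairs degree 0 with degree 2, and degree 1 with itself. -/
theorem isGorensteinRing [IsAlgClosed k] [Module.Finite k B] [Algebra.FiniteType k S]
    (h : IsCone Ψ μ) (hμ : ∀ a, (∀ b, μ (a * b) = 0) → a = 0) : IsGorensteinRing S := by
  have : IsNoetherianRing S := Algebra.FiniteType.isNoetherianRing k S
  refine isGorensteinRing_of_isDualizing k S fun p _ => ?_
  obtain ⟨t, ht⟩ := h.exists_eq_X_sub_C 0
  let := Ideal.Quotient.field p
  have : Module.Finite k (S ⧸ p) := finite_of_finite_type_of_isJacobsonRing k (S ⧸ p)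
  obtain ⟨c, hc⟩ := (IsAlgClosed.algebraMap_bijective_of_isIntegral (k := k) (K := S ⧸ p)).2
    (Ideal.Quotient.mk p t)
  let x : S := t - algebraMap k S c
  have hxp : x ∈ p := by
    rw [← Ideal.Quotient.eq_zero_iff_mem, map_sub, ← hc, sub_eq_zero]
    rfl
  have hx : Ψ x = X - C (algebraMap k B c) := by
    simp only [x, map_sub, ht, AlgHom.commutes, _root_.map_zero, sub_zero]
    rfl
  refine ⟨x, hxp, h.mul_eq_zero hx, ?_⟩
  by_cases hc0 : c = 0
  · rw [hc0, _root_.map_zero, C_0, sub_zero] at hx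
    refine ⟨h.finite_quotient_X hx, μ ∘ₗ coeffMap Ψ 2, fun q => ?_⟩
    rw [h.mem_span_X_iff hx]
    constructor
    · intro hq
      have hq' : ∀ s, μ ((Ψ q * Ψ s).coeff 2) = 0 := fun s => by
        rw [← map_mul]
        exact hq s
      -- Testing against Bt², against (ker μ)t and against 1 isolates in turn the coefficients of
      -- degree 0, 1 and 2.
      have h0 : (Ψ q).coeff 0 = 0 := by
        refine hμ _ fun b => ?_
        obtain ⟨s, hs⟩ := h.exists_eq_mul_X_pow (C b)
        have := hq' s
        rw [hs, ← mul_assoc, coeff_mul_X_pow', if_pos le_rfl, coeff_mul_C] at this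
        simpa using this
      refine ⟨h0, eq_algebraMap_of_forall hμ fun b hb => ?_, ?_⟩
      · obtain ⟨s, hs⟩ := h.exists_eq_mul_X hb
        have := hq' s
        rwa [hs, ← mul_assoc, coeff_mul_X, coeff_mul_C] at this
      · have := hq' 1
        rwa [_root_.map_one, mul_one] at this
    · rintro hq s
      have := (h.mem_span_X_iff hx (q * s)).1
        (Ideal.mul_mem_right _ _ ((h.mem_span_X_iff hx q).2 hq))
      exact this.2.2
  · let ev : S →ₗ[k] B := ((leval (algebraMap k B c)).restrictScalars k) ∘ₗ Ψ.toLinearMap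
    have hev : ∀ s, ev s = (Ψ s).eval (algebraMap k B c) := fun s => rfl
    refine ⟨finite_quotient ev fun s hs => (h.mem_span_X_sub_C_iff hc0 hx s).2 hs,
      μ ∘ₗ ev, fun q => ?_⟩
    rw [h.mem_span_X_sub_C_iff hc0 hx]
    constructor
    · intro hq
      refine hμ _ fun b => ?_
      obtain ⟨s, hs⟩ := h.exists_eq_mul_X_pow (C (b * algebraMap k B (c⁻¹ ^ 2)))
      have := hq s
      rw [LinearMap.comp_apply, hev, map_mul, eval_mul, hs] at this
      simp only [eval_mul, eval_C, eval_pow, eval_X, mul_assoc, ← map_pow, ← map_mul] at this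
      simpa only [← mul_pow, inv_mul_cancel₀ hc0, one_pow, _root_.map_one, mul_one] using this
    · intro hq s
      rw [LinearMap.comp_apply, hev, map_mul, eval_mul, hq, zero_mul, _root_.map_zero]

/-- If μ(aB) = 0, then at is a socle element of S/t at the vertex, and so is b₀t², which is nonzero
there. A simple socle makes at a multiple of b₀t² modulo t after inverting elements outside the
vertex. Comparing coefficients of t shows that a is a scalar, and μ(ab₀) = 0 with μ(b₀) ≠ 0 forces a
= 0. -/
theorem eq_zero_of_isGorensteinRing [Module.Finite k B] (h : IsCone Ψ μ)
    (hS : IsGorensteinRing S) {b₀ : B} (hb₀ : μ b₀ ≠ 0) {a : B} (ha : ∀ b, μ (a * b) = 0) :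
    a = 0 := by
  have : Nontrivial B := ⟨b₀, 0, fun h => hb₀ (by rw [h, _root_.map_zero])⟩
  obtain ⟨x, hx⟩ := h.exists_eq_X_sub_C 0
  have hreg := h.mul_eq_zero hx
  rw [_root_.map_zero, C_0, sub_zero] at hx
  have := h.finite_quotient_X hx
  let ε : S →+* B := (constantCoeff (R := B)).comp Ψ.toRingHom
  have hε : ∀ s, ε s = (Ψ s).coeff 0 := fun s => rfl
  let p : Ideal S := RingHom.ker ε
  have hinv : ∀ s ∉ p, ∃ c : k, c ≠ 0 ∧ (Ψ s).coeff 0 = algebraMap k B c := fun s hs => by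
    obtain ⟨c, hc⟩ := h.coeff_zero s
    refine ⟨c, ?_, hc⟩
    rintro rfl
    exact hs (by rw [RingHom.mem_ker, hε, hc, _root_.map_zero])
  have hp : p.IsMaximal := by
    rw [Ideal.isMaximal_iff]
    refine ⟨fun h1 => one_ne_zero ((_root_.map_one ε).symm.trans h1), fun J s hJ hs hsJ => ?_⟩
    obtain ⟨c, hc0, hc⟩ := hinv s hs
    have h1 : 1 - algebraMap k S c⁻¹ * s ∈ p := by
      rw [RingHom.mem_ker, map_sub, _root_.map_one, map_mul, hε s, hc, hε (algebraMap k S c⁻¹),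
        AlgHom.commutes]
      rw [show (algebraMap k B[X] c⁻¹).coeff 0 = algebraMap k B c⁻¹ from coeff_C_zero,
        ← map_mul, inv_mul_cancel₀ hc0, _root_.map_one, sub_self]
    have := add_mem (hJ h1) (Ideal.mul_mem_left J (algebraMap k S c⁻¹) hsJ)
    rwa [sub_add_cancel] at this
  have ha0 : μ a = 0 := by simpa using ha 1
  obtain ⟨α, hα⟩ := h.exists_eq_mul_X ha0
  obtain ⟨β, hβ⟩ := h.exists_eq_mul_X_pow (C b₀)
  have hp' : ∀ r ∈ p, (Ψ r).coeff 0 = 0 := fun r hr => hr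
  obtain ⟨s, hs, r, hsr⟩ := hS.exists_mul_sub_mul_mem (k := k) (x := x) (p := p)
    (by rw [RingHom.mem_ker, hε, hx, coeff_X_zero]) hreg (a := α) (b := β)
    (fun r hr => by
      rw [h.mem_span_X_iff hx, map_mul, hα, ← mul_assoc, coeff_mul_X, coeff_mul_X, coeff_mul_C,
        coeff_mul_C, hp' r hr, zero_mul, mul_comm _ a]
      exact ⟨by simp, ⟨0, by simp⟩, ha _⟩)
    (fun r hr => by
      rw [h.mem_span_X_iff hx, map_mul, hβ, ← mul_assoc]
      exact ⟨by simp, ⟨0, by simp [coeff_mul_X_pow']⟩,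
        by simp [coeff_mul_X_pow', hp' r hr]⟩)
    (fun s hs => by
      rw [h.mem_span_X_iff hx, map_mul, hβ, ← mul_assoc]
      obtain ⟨c, hc0, hc⟩ := hinv s hs
      rintro ⟨-, -, h2⟩
      rw [coeff_mul_X_pow', if_pos le_rfl, coeff_mul_C, Nat.sub_self, hc, ← Algebra.smul_def,
        map_smul, smul_eq_mul] at h2
      exact (mul_ne_zero hc0 hb₀) h2)
  obtain ⟨c, hc0, hc⟩ := hinv s hs
  rw [h.mem_span_X_iff hx, map_sub, map_mul, map_mul, hα, hβ, ← mul_assoc, ← mul_assoc] at hsr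
  obtain ⟨-, ⟨d, hd⟩, -⟩ := hsr
  rw [coeff_sub, coeff_mul_X, coeff_mul_X_pow', if_neg (by norm_num), sub_zero, coeff_mul_C,
    hc] at hd
  have ha' : a = algebraMap k B (c⁻¹ * d) := by
    rw [map_mul, ← hd, ← mul_assoc, ← map_mul, inv_mul_cancel₀ hc0, _root_.map_one, one_mul]
  have h3 := ha b₀
  rw [ha', ← Algebra.smul_def, map_smul, smul_eq_mul] at h3
  rw [ha', (_root_.mul_eq_zero.mp h3).resolve_right hb₀, _root_.map_zero]

end IsCone

end

end AGor
end

noncomputable section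
namespace AGor
attribute [local instance] MvPolynomial.gradedAlgebra

/-! ### Arithmetically Gorenstein subschemes and Frobenius functionals -/

section

variable {k : Type u} [Field k] {n : ℕ} {B : Type u} [CommRing B] [Algebra k B]

open Polynomial in
/-- The homomorphism `x_i ↦ v_i t` -/
def coneMap (v : Fin (n + 1) → B) : MvPolynomial (Fin (n + 1)) k →ₐ[k] B[X] :=
  MvPolynomial.aeval fun i => X * C (v i)

lemma coneMap_of_mem (v : Fin (n + 1) → B) {d : ℕ} {F : MvPolynomial (Fin (n + 1)) k}
    (hF : F ∈ grading k n d) :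
    coneMap v F = Polynomial.X ^ d * Polynomial.C (MvPolynomial.aeval v F) := by
  rw [coneMap, aeval_smul_of_isHomogeneous _ _ hF]
  congr 1
  exact (MvPolynomial.comp_aeval_apply v (Polynomial.CAlgHom (R := k) (A := B)) F).symm

lemma coeff_coneMap (v : Fin (n + 1) → B) (F : MvPolynomial (Fin (n + 1)) k) (d : ℕ) :
    (coneMap v F).coeff d =
      MvPolynomial.aeval v (MvPolynomial.homogeneousComponent d F) := by
  conv_lhs => rw [← MvPolynomial.sum_homogeneousComponent F]
  rw [map_sum, Polynomial.finsetSum_coeff]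
  have h : ∀ i, (coneMap v (MvPolynomial.homogeneousComponent i F)).coeff d =
      if d = i then MvPolynomial.aeval v (MvPolynomial.homogeneousComponent d F) else 0 := by
    intro i
    rw [coneMap_of_mem v (MvPolynomial.homogeneousComponent_isHomogeneous i F),
      mul_comm, Polynomial.coeff_C_mul_X_pow]
    split_ifs with hd
    · rw [hd]
    · rfl
  simp only [h, Finset.sum_ite_eq, Finset.mem_range]
  split_ifs with hd
  · rfl
  · rw [MvPolynomial.homogeneousComponent_eq_zero _ _ (by omega), map_zero]

/-- The variable t records degrees, so the homogeneous components of an element of the kernel vanish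
at v separately. -/
lemma ker_coneMap (v : Fin (n + 1) → B) : RingHom.ker (coneMap v) =
    Ideal.span {F | ∃ d : ℕ, F ∈ grading k n d ∧ MvPolynomial.aeval v F = 0} := by
  apply le_antisymm
  · intro F hF
    rw [← MvPolynomial.sum_homogeneousComponent F]
    refine Ideal.sum_mem _ fun d _ => Ideal.subset_span
      ⟨d, MvPolynomial.homogeneousComponent_isHomogeneous d F, ?_⟩
    rw [← coeff_coneMap, (RingHom.mem_ker).mp hF, Polynomial.coeff_zero]
  · rw [Ideal.span_le]
    rintro F ⟨d, hF, h⟩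
    rw [SetLike.mem_coe, RingHom.mem_ker, coneMap_of_mem v hF, h, Polynomial.C_0, mul_zero]

lemma isCoatom_ker {V : Type*} [AddCommGroup V] [Module k V] {μ : V →ₗ[k] k} (hμ : μ ≠ 0) :
    IsCoatom (LinearMap.ker μ) :=
  LinearMap.isCoatom_ker_of_surjective (LinearMap.surjective hμ)

/-- As 1 ∈ ker μ, the product contains ker μ, a hyperplane. Equality would make the hyperplane
closed under multiplication, hence all of B, which it generates. -/
lemma ker_mul_ker_eq_top {μ : B →ₗ[k] k} (hμ : μ ≠ 0) (h1 : μ 1 = 0)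
    (hgen : Algebra.adjoin k (LinearMap.ker μ : Set B) = ⊤) :
    LinearMap.ker μ * LinearMap.ker μ = ⊤ := by
  refine (isCoatom_ker hμ).2 _ (lt_of_le_of_ne ?_ fun h => hμ ?_)
  · intro x hx
    rw [← mul_one x]
    exact Submodule.mul_mem_mul hx h1
  · ext x
    have hx : x ∈ Algebra.adjoin k (LinearMap.ker μ : Set B) := hgen ▸ Algebra.mem_top
    induction hx using Algebra.adjoin_induction with
    | mem x hx => exact hx
    | algebraMap c => rw [Algebra.algebraMap_eq_smul_one, map_smul, h1, smul_zero]; rfl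
    | add x y _ _ hx hy => rw [map_add, hx, hy]; simp
    | mul x y _ _ hx hy =>
      have : x * y ∈ LinearMap.ker μ * LinearMap.ker μ := Submodule.mul_mem_mul hx hy
      rw [← h] at this
      exact this

variable {Z : ClosedSubscheme k n} {v : Fin (n + 1) → B}

/-- Degrees 0 and 1 of the image are k and ker μ by construction; from degree 2 on everything
occurs, because ker μ · ker μ = B and t itself lies in the image. -/
lemma IsChart.exists_isCone (h : IsChart Z v) {μ : B →ₗ[k] k} (hμ : μ ≠ 0)
    (hv : LinearMap.ker μ = Submodule.span k (Set.range v)) :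
    ∃ Ψ : Z.coordinateRing →ₐ[k] Polynomial B, IsCone Ψ μ := by
  have hker : RingHom.ker (coneMap v) = Z.homogeneousIdeal :=
    (ker_coneMap v).trans h.homogeneousIdeal_eq.symm
  let Ψ : Z.coordinateRing →ₐ[k] Polynomial B := Ideal.Quotient.liftₐ _ (coneMap v)
    fun F hF => by rw [← hker] at hF; exact hF
  have hΨ : ∀ F, Ψ (Ideal.Quotient.mk _ F) = coneMap v F := fun F => rfl
  have h1 : μ 1 = 0 := by
    rw [← LinearMap.mem_ker, hv]
    exact h.one_mem_span
  have hgen : Algebra.adjoin k (LinearMap.ker μ : Set B) = ⊤ := by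
    rw [hv, Algebra.adjoin_span, h.adjoin_eq_top]
  refine ⟨Ψ, ?_, h1, fun p => ⟨?_, ?_⟩⟩
  · rw [injective_iff_map_eq_zero]
    intro s hs
    obtain ⟨F, rfl⟩ := Ideal.Quotient.mk_surjective s
    rw [Ideal.Quotient.eq_zero_iff_mem, ← hker]
    exact hs
  · rintro ⟨s, rfl⟩
    obtain ⟨F, rfl⟩ := Ideal.Quotient.mk_surjective s
    rw [hΨ, coeff_coneMap, coeff_coneMap, ← LinearMap.mem_ker, hv]
    refine ⟨⟨MvPolynomial.coeff 0 F, ?_⟩, aeval_mem_span_of_mem_grading_one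
      (MvPolynomial.homogeneousComponent_isHomogeneous 1 F) v⟩
    rw [MvPolynomial.homogeneousComponent_zero, MvPolynomial.aeval_C]
  · rintro ⟨⟨c, hc⟩, h1p⟩
    suffices H : p ∈ Ψ.range from H
    have hlin : ∀ b, μ b = 0 → Polynomial.C b * Polynomial.X ∈ Ψ.range := by
      intro b hb
      rw [← LinearMap.mem_ker, hv, Submodule.mem_span_range_iff_exists_fun] at hb
      obtain ⟨a, rfl⟩ := hb
      refine ⟨Ideal.Quotient.mk _ (∑ i, a i • MvPolynomial.X i), ?_⟩
      change coneMap v _ = _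
      simp only [coneMap, map_sum, map_smul, MvPolynomial.aeval_X, Finset.sum_mul]
      refine Finset.sum_congr rfl fun i _ => ?_
      rw [← Polynomial.smul_C, smul_mul_assoc, mul_comm]
    have hquad : ∀ b, Polynomial.C b * Polynomial.X ^ 2 ∈ Ψ.range := by
      intro b
      have hb : b ∈ LinearMap.ker μ * LinearMap.ker μ := by
        rw [ker_mul_ker_eq_top hμ h1 hgen]
        trivial
      induction hb using Submodule.mul_induction_on' with
      | mem_mul_mem x hx y hy =>
        have := mul_mem (hlin x hx) (hlin y hy)
        rw [Polynomial.C_mul]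
        convert this using 1
        ring
      | add x _ y _ hx hy =>
        rw [Polynomial.C_add, add_mul]
        exact add_mem hx hy
    have hX : Polynomial.X ∈ Ψ.range := by simpa using hlin 1 h1
    rw [p.as_sum_support_C_mul_X_pow]
    refine sum_mem fun i _ => ?_
    match i with
    | 0 =>
      rw [hc, pow_zero, mul_one]
      exact Ψ.range.algebraMap_mem c
    | 1 =>
      rw [pow_one]
      exact hlin _ h1p
    | i + 2 =>
      rw [pow_add, mul_left_comm]
      exact mul_mem (pow_mem hX i) (hquad _)

theorem IsChart.isArithmeticallyGorenstein_iff [IsAlgClosed k] [Module.Finite k B]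
    (h : IsChart Z v) {μ : B →ₗ[k] k} (hμ : μ ≠ 0)
    (hv : LinearMap.ker μ = Submodule.span k (Set.range v)) :
    Z.IsArithmeticallyGorenstein ↔ ∀ a, (∀ b, μ (a * b) = 0) → a = 0 := by
  obtain ⟨Ψ, hΨ⟩ := h.exists_isCone hμ hv
  constructor
  · intro hS a ha
    obtain ⟨b₀, hb₀⟩ := DFunLike.ne_iff.mp hμ
    exact hΨ.eq_zero_of_isGorensteinRing hS hb₀ ha
  · exact fun hμ' => hΨ.isGorensteinRing hμ'

lemma exists_ker_eq_span [Module.Finite k B] (hdim : Module.finrank k B = n + 2)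
    (hv : LinearIndependent k v) :
    ∃ μ : B →ₗ[k] k, μ ≠ 0 ∧ LinearMap.ker μ = Submodule.span k (Set.range v) := by
  have hfr : Module.finrank k (Submodule.span k (Set.range v)) = n + 1 := by
    rw [finrank_span_eq_card hv, Fintype.card_fin]
  obtain ⟨x, hx⟩ : ∃ x, x ∉ Submodule.span k (Set.range v) := by
    by_contra! hall
    rw [Submodule.eq_top_iff'.mpr hall, finrank_top] at hfr
    omega
  obtain ⟨μ, hμx, hμ⟩ := Submodule.exists_le_ker_of_notMem hx
  have hμ0 : μ ≠ 0 := fun h => hμx (by rw [h]; rfl)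
  refine ⟨μ, hμ0, (Submodule.eq_of_le_of_finrank_eq hμ ?_).symm⟩
  have h1 := LinearMap.finrank_range_add_finrank_ker μ
  rw [LinearMap.range_eq_top.mpr (LinearMap.surjective hμ0), finrank_top, Module.finrank_self] at h1
  omega

/-- Two nondegenerate functionals differ by a unit. -/
lemma exists_isUnit_forall_eq [Module.Finite k B] {μ ν : B →ₗ[k] k}
    (hμ : ∀ a, (∀ b, μ (a * b) = 0) → a = 0) (hν : ∀ a, (∀ b, ν (a * b) = 0) → a = 0) :
    ∃ w, IsUnit w ∧ ∀ b, ν b = μ (w * b) := by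
  let f : B →ₗ[k] Module.Dual k B := (LinearMap.llcomp k B B k μ) ∘ₗ LinearMap.mul k B
  have hf : ∀ a b, f a b = μ (a * b) := fun a b => rfl
  have hinj : Function.Injective f := by
    rw [injective_iff_map_eq_zero]
    exact fun a ha => hμ a fun b => by rw [← hf, ha]; rfl
  have hsurj := (LinearMap.injective_iff_surjective_of_finrank_eq_finrank
    (Subspace.dual_finrank_eq (K := k) (V := B)).symm).mp hinj
  obtain ⟨w, hw⟩ := hsurj ν
  have hw' : ∀ b, ν b = μ (w * b) := fun b => by rw [← hw, hf]
  refine ⟨w, ?_, hw'⟩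
  have : IsArtinianRing B := IsArtinianRing.of_finite k B
  -- If aw = 0 then ν vanishes on aB, so a = 0: w is not a zero divisor, hence a unit in an Artinian
  -- ring.
  refine IsArtinianRing.isUnit_of_mem_nonZeroDivisors (mem_nonZeroDivisors_iff_right.mpr fun a ha => ?_)
  refine hν a fun b => ?_
  rw [hw', ← mul_assoc, mul_comm w, ha, zero_mul, map_zero]

/-- The transported functional ν ∘ g⁻¹ equals μ(c ·) for a unit c, so c·g maps ker ν into ker μ. The
matrix of c·g(w_i) in the coordinates v_j is the required projective transformation. -/
theorem IsChart.projectivelyEquivalent_of_algEquiv [Module.Finite k B] (h : IsChart Z v)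
    {μ : B →ₗ[k] k} (hμ : ∀ a, (∀ b, μ (a * b) = 0) → a = 0)
    (hv : LinearMap.ker μ = Submodule.span k (Set.range v))
    {C : Type u} [CommRing C] [Algebra k C]
    {W : ClosedSubscheme k n} {w : Fin (n + 1) → C} (hW : IsChart W w)
    {ν : C →ₗ[k] k} (hν : ∀ a, (∀ b, ν (a * b) = 0) → a = 0)
    (hw : LinearMap.ker ν = Submodule.span k (Set.range w)) (hwi : LinearIndependent k w)
    (g : C ≃ₐ[k] B) : Z.ProjectivelyEquivalent W := by
  obtain ⟨c, hc, hcν⟩ := exists_isUnit_forall_eq (ν := ν ∘ₗ g.symm.toLinearMap) hμ fun a ha => by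
    rw [← map_eq_zero_iff g.symm g.symm.injective]
    refine hν _ fun b => ?_
    simpa using ha (g b)
  have hmem : ∀ i, ∃ M : Fin (n + 1) → k, ∑ j, M j • v j = c * g (w i) := fun i => by
    rw [← Submodule.mem_span_range_iff_exists_fun, ← hv, LinearMap.mem_ker, ← hcν]
    have : w i ∈ LinearMap.ker ν := hw ▸ Submodule.subset_span ⟨i, rfl⟩
    simpa using this
  choose M hM using hmem
  have hunit : IsUnit (Matrix.of M) := by
    rw [← Matrix.linearIndependent_rows_iff_isUnit, Fintype.linearIndependent_iff]
    intro a ha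
    refine Fintype.linearIndependent_iff.mp hwi a ?_
    rw [← map_eq_zero_iff g g.injective, ← hc.mul_right_eq_zero, map_sum, Finset.mul_sum]
    have h1 : ∀ i, c * g (a i • w i) = ∑ j, (a i * M i j) • v j := fun i => by
      rw [map_smul, mul_smul_comm, ← hM, Finset.smul_sum]
      simp only [smul_smul]
    simp only [h1]
    rw [Finset.sum_comm]
    refine Finset.sum_eq_zero fun j _ => ?_
    rw [← Finset.sum_smul]
    have := congrFun ha j
    simp only [Finset.sum_apply, Pi.smul_apply, smul_eq_mul, Matrix.row_apply, Matrix.of_apply,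
      Pi.zero_apply] at this
    rw [this, zero_smul]
  obtain ⟨b, hb⟩ := hc.exists_left_inv
  refine h.projectivelyEquivalent hW g hunit.unit (b := b) (IsUnit.of_mul_eq_one c hb) fun i => ?_
  have h2 : substTuple (Matrix.of M) v i = c * g (w i) := by
    rw [← hM, substTuple]
    simp [linSubst, Algebra.smul_def]
  rw [IsUnit.unit_spec, h2, ← mul_assoc, hb, one_mul]

/-- Otherwise ker μ is covered by the finitely many maximal ideals, so it lies in one of them and,
being a hyperplane, equals it. Then ker μ is an ideal killed by μ, so it is zero and B has dimension
at most 1. -/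
lemma exists_isUnit_apply_eq_zero [Infinite k] [Module.Finite k B] (hdim : 2 ≤ Module.finrank k B)
    {μ : B →ₗ[k] k} (hμ : ∀ a, (∀ b, μ (a * b) = 0) → a = 0) : ∃ w, IsUnit w ∧ μ w = 0 := by
  by_contra! hall
  have : IsArtinianRing B := IsArtinianRing.of_finite k B
  have : Nontrivial B := Module.nontrivial_of_finrank_pos (R := k) (by omega)
  have hμ0 : μ ≠ 0 := by
    rintro rfl
    exact one_ne_zero (hμ (1 : B) fun b => rfl)
  let p : MaximalSpectrum B → Submodule k (LinearMap.ker μ) := fun m =>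
    (m.asIdeal.restrictScalars k).comap (LinearMap.ker μ).subtype
  have hcov : (⋃ m, (p m : Set (LinearMap.ker μ))) = Set.univ := by
    refine Set.eq_univ_of_forall fun x => ?_
    have hx : ¬ IsUnit (x : B) := fun h => hall x h x.2
    obtain ⟨m, hm, hxm⟩ := exists_max_ideal_of_mem_nonunits hx
    exact Set.mem_iUnion.mpr ⟨⟨m, hm⟩, hxm⟩
  obtain ⟨m, hm⟩ := Subspace.exists_eq_top_of_iUnion_eq_univ hcov
  have hle : LinearMap.ker μ ≤ m.asIdeal.restrictScalars k := fun x hx => by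
    have : (⟨x, hx⟩ : LinearMap.ker μ) ∈ p m := hm ▸ Submodule.mem_top
    exact this
  have heq : LinearMap.ker μ = m.asIdeal.restrictScalars k := by
    refine hle.eq_of_not_lt fun hlt => m.isMaximal.ne_top ?_
    have := (isCoatom_ker hμ0).2 _ hlt
    exact (Ideal.eq_top_iff_one _).mpr
      (show (1 : B) ∈ m.asIdeal.restrictScalars k by rw [this]; trivial)
  have hbot : LinearMap.ker μ = ⊥ := by
    rw [eq_bot_iff]
    intro a ha
    refine hμ a fun b => ?_
    rw [← LinearMap.mem_ker, heq] at *
    exact m.asIdeal.mul_mem_right b ha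
  have := LinearMap.finrank_le_finrank_of_injective (LinearMap.ker_eq_bot.mp hbot)
  rw [Module.finrank_self] at this
  omega

/-- Twisting by a unit w with μ₀(w) = 0 makes the functional kill 1. A basis of its kernel generates
B: otherwise the kernel would be a subalgebra, multiplication by its elements would preserve it, and
they would all be scalars, against dimension n + 1 ≥ 2. -/
theorem exists_isChart_of_isFrobenius [IsAlgClosed k] [Module.Finite k B]
    (hB : IsFrobenius k B) (hn : 1 ≤ n) (hdim : Module.finrank k B = n + 2) :
    ∃ (Z : ClosedSubscheme k n) (v : Fin (n + 1) → B), IsChart Z v ∧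
      IsAGPoint (n + 2) Z := by
  obtain ⟨μ₀, hμ₀⟩ := hB
  have : Infinite k := IsAlgClosed.instInfinite
  obtain ⟨w, hw, hw0⟩ := exists_isUnit_apply_eq_zero (by omega) hμ₀
  let μ : B →ₗ[k] k := μ₀ ∘ₗ LinearMap.mulLeft k w
  have hμ : ∀ a, (∀ b, μ (a * b) = 0) → a = 0 := fun a ha => by
    rw [← hw.mul_right_eq_zero]
    refine hμ₀ _ fun b => ?_
    rw [mul_assoc]
    exact ha b
  have h1 : μ 1 = 0 := by simpa [μ] using hw0
  have : Nontrivial B := Module.nontrivial_of_finrank_pos (R := k) (by omega)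
  have hμ0 : μ ≠ 0 := fun h => one_ne_zero (hμ (1 : B) fun b => by rw [h]; rfl)
  have hfr : Module.finrank k (LinearMap.ker μ) = n + 1 := by
    have h1 := LinearMap.finrank_range_add_finrank_ker μ
    rw [LinearMap.range_eq_top.mpr (LinearMap.surjective hμ0), finrank_top,
      Module.finrank_self] at h1
    omega
  let v' := Module.finBasisOfFinrankEq k (LinearMap.ker μ) hfr
  let v : Fin (n + 1) → B := fun i => v' i
  have hvi : LinearIndependent k v :=
    v'.linearIndependent.map' (LinearMap.ker μ).subtype (Submodule.ker_subtype _)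
  have hv : LinearMap.ker μ = Submodule.span k (Set.range v) := by
    have : Set.range v = (LinearMap.ker μ).subtype '' Set.range v' := by
      rw [← Set.range_comp]
      rfl
    rw [this, Submodule.span_image, v'.span_eq, Submodule.map_top, Submodule.range_subtype]
  have hgen : Algebra.adjoin k (Set.range v) = ⊤ := by
    have hle : LinearMap.ker μ ≤ Subalgebra.toSubmodule (Algebra.adjoin k (Set.range v)) := by
      rw [hv]
      exact Algebra.span_le_adjoin k _
    rw [← Algebra.toSubmodule_eq_top]
    refine (isCoatom_ker hμ0).2 _ (lt_of_le_of_ne hle fun heq => ?_)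
    have hk : LinearMap.ker μ ≤ LinearMap.range (Algebra.linearMap k B) := fun a ha => by
      obtain ⟨c, hc⟩ := IsCone.eq_algebraMap_of_forall hμ (a := a) fun b hb => by
        have hb' : b ∈ LinearMap.ker μ := hb
        rw [heq] at ha hb'
        rw [← LinearMap.mem_ker, heq]
        exact (Algebra.adjoin k (Set.range v)).mul_mem ha hb'
      exact ⟨c, hc.symm⟩
    have h2 := Submodule.finrank_mono hk
    have h3 := LinearMap.finrank_range_le (Algebra.linearMap k B)
    rw [Module.finrank_self] at h3
    omega
  obtain ⟨Z, hZ⟩ := exists_isChart_of_adjoin_eq_top v hgen (by rw [← hv]; exact h1)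
  have : IsArtinianRing B := IsArtinianRing.of_finite k B
  exact ⟨Z, v, hZ, hZ.topologicalKrullDim_eq_zero, hZ.degree_eq.trans hdim,
    (hZ.isArithmeticallyGorenstein_iff hμ0 hv).mpr hμ, hZ.isNonDegenerate_iff.mpr hvi⟩

/-- Coordinates on arithmetically Gorenstein points. -/
theorem IsAGPoint.exists_isChart [IsAlgClosed k] (h : IsAGPoint (n + 2) Z) :
    ∃ (B : Type u) (_ : CommRing B) (_ : Algebra k B) (v : Fin (n + 1) → B) (μ : B →ₗ[k] k),
      IsChart Z v ∧ Module.finrank k B = n + 2 ∧ LinearIndependent k v ∧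
      LinearMap.ker μ = Submodule.span k (Set.range v) ∧ ∀ a, (∀ b, μ (a * b) = 0) → a = 0 := by
  have : Infinite k := IsAlgClosed.instInfinite
  obtain ⟨B, _, _, v, hv⟩ := exists_chart Z h.dim_eq
  have hv : IsChart Z v := hv
  have hdim : Module.finrank k B = n + 2 := hv.degree_eq.symm.trans h.degree_eq
  have : Module.Finite k B := Module.finite_of_finrank_pos (by omega)
  have hvi := hv.isNonDegenerate_iff.mp h.nonDegenerate
  obtain ⟨μ, hμ0, hμ⟩ := exists_ker_eq_span hdim hvi
  exact ⟨B, _, _, v, μ, hv, hdim, hvi, hμ,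
    (hv.isArithmeticallyGorenstein_iff hμ0 hμ).mp h.arithmeticallyGorenstein⟩

theorem IsAGPoint.projectivelyEquivalent_iff [IsAlgClosed k] (hZ : IsAGPoint (n + 2) Z)
    {W : ClosedSubscheme k n} (hW : IsAGPoint (n + 2) W) :
    Z.ProjectivelyEquivalent W ↔ Nonempty (Z.toOver ≅ W.toOver) := by
  obtain ⟨B, _, _, v, μ, hv, hB, hvi, hμ, hμ'⟩ := hZ.exists_isChart
  refine ⟨hv.nonempty_iso_of_projectivelyEquivalent, fun ⟨i⟩ => ?_⟩
  obtain ⟨C, _, _, w, ν, hw, hC, hwi, hν, hν'⟩ := hW.exists_isChart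
  have : Module.Finite k B := Module.finite_of_finrank_pos (by omega)
  obtain ⟨iB⟩ := hv.nonempty_iso
  obtain ⟨iC⟩ := hw.nonempty_iso
  obtain ⟨g⟩ := nonempty_specOver_iso_iff.mp ⟨iC.symm ≪≫ i.symm ≪≫ iB⟩
  exact hv.projectivelyEquivalent_of_algEquiv hμ' hμ hw hν' hν hwi g

end

end AGor
end

noncomputable section
namespace AGor
open IsLocalRing

/-! ### Finite local algebras -/

section

variable {k : Type u} [Field k] {L : Type v} [CommRing L] [Algebra k L]

lemma exists_sub_algebraMap_mem [IsAlgClosed k] [IsLocalRing L] [Module.Finite k L] (a : L) :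
    ∃ c : k, a - algebraMap k L c ∈ maximalIdeal L := by
  obtain ⟨c, hc⟩ := (IsAlgClosed.algebraMap_bijective_of_isIntegral (k := k)
    (K := ResidueField L)).2 (residue L a)
  refine ⟨c, ?_⟩
  rw [← residue_eq_zero_iff, map_sub, ← hc, sub_eq_zero]
  rfl

lemma maximalIdeal_pow_eq_bot (k : Type u) [Field k] (L : Type v) [CommRing L] [Algebra k L]
    [IsLocalRing L] [Module.Finite k L] : ∃ N, maximalIdeal L ^ N = ⊥ := by
  have : IsArtinianRing L := IsArtinianRing.of_finite k L
  obtain ⟨N, hN⟩ := IsArtinianRing.isNilpotent_jacobson_bot (R := L)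
  rw [IsLocalRing.jacobson_eq_maximalIdeal _ bot_ne_top] at hN
  exact ⟨N, hN⟩

lemma isNilpotent_iff_mem_maximalIdeal (k : Type u) [Field k] {L : Type v} [CommRing L]
    [Algebra k L] [IsLocalRing L] [Module.Finite k L] {a : L} :
    IsNilpotent a ↔ a ∈ maximalIdeal L := by
  constructor
  · rintro ⟨N, hN⟩
    have : a ^ N ∈ maximalIdeal L := hN ▸ zero_mem _
    exact Ideal.IsPrime.mem_of_pow_mem inferInstance _ this
  · intro ha
    obtain ⟨N, hN⟩ := maximalIdeal_pow_eq_bot k L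
    exact ⟨N, by simpa [hN] using Ideal.pow_mem_pow ha N⟩

lemma apply_mul_of_mem_socle {μ : L →ₗ[k] k} [IsLocalRing L] {a : L}
    (ha : ∀ r ∈ maximalIdeal L, r * a = 0) {b : L} {c : k}
    (hb : b - algebraMap k L c ∈ maximalIdeal L) : μ (a * b) = c * μ a := by
  have h := ha _ hb
  rw [sub_mul, sub_eq_zero] at h
  rw [mul_comm, h, ← Algebra.smul_def, map_smul, smul_eq_mul]

variable [IsAlgClosed k] [IsLocalRing L] [Module.Finite k L]

lemma apply_ne_zero_of_mem_socle {μ : L →ₗ[k] k} (hμ : ∀ a, (∀ b, μ (a * b) = 0) → a = 0) {a : L}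
    (ha : ∀ r ∈ maximalIdeal L, r * a = 0) (ha0 : a ≠ 0) : μ a ≠ 0 := fun h => by
  refine ha0 (hμ a fun b => ?_)
  obtain ⟨c, hc⟩ := exists_sub_algebraMap_mem (k := k) b
  rw [apply_mul_of_mem_socle ha hc, h, mul_zero]

/-- On the socle L acts through the residue field k, so a nondegenerate μ is injective there and the
socle is a line. -/
lemma IsFrobenius.exists_smul_of_mem_socle (h : IsFrobenius k L) {a b : L}
    (ha : ∀ r ∈ maximalIdeal L, r * a = 0) (hb : ∀ r ∈ maximalIdeal L, r * b = 0) (hb0 : b ≠ 0) :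
    ∃ c : k, a = c • b := by
  obtain ⟨μ, hμ⟩ := h
  have h1 := apply_ne_zero_of_mem_socle hμ hb hb0
  refine ⟨μ a / μ b, ?_⟩
  by_contra h2
  refine apply_ne_zero_of_mem_socle hμ (a := a - (μ a / μ b) • b) (fun r hr => ?_)
    (sub_ne_zero.mpr h2) ?_
  · rw [mul_sub, mul_smul_comm, ha r hr, hb r hr, smul_zero, sub_zero]
  · rw [map_sub, map_smul, smul_eq_mul, div_mul_cancel₀ _ h1, sub_self]

/-- A homomorphism not vanishing on a socle element is injective. -/
lemma IsFrobenius.injective_of_socle (h : IsFrobenius k L) {e : L}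
    (he : ∀ r ∈ maximalIdeal L, r * e = 0) {C : Type*} [CommRing C] [Algebra k C] (f : L →ₐ[k] C)
    (hf : f e ≠ 0) : Function.Injective f := by
  rw [injective_iff_map_eq_zero]
  intro a ha
  by_contra ha0
  have : IsArtinianRing L := IsArtinianRing.of_finite k L
  obtain ⟨r, hr0, hr⟩ := exists_mul_mem_socle ha0
  obtain ⟨c, hc⟩ := h.exists_smul_of_mem_socle he hr hr0
  exact hf (by rw [hc, map_smul, map_mul, ha, mul_zero, smul_zero])

end

lemma apply_eq_zero_of_mem_span {k : Type*} [Field k] {R : Type*} [CommRing R] [Algebra k R]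
    {μ : R →ₗ[k] k} {S : Set R} (H : ∀ q, ∀ g ∈ S, μ (q * g) = 0) {F : R}
    (hF : F ∈ Ideal.span S) : μ F = 0 := by
  suffices H' : ∀ q, μ (q * F) = 0 by simpa using H' 1
  induction hF using Submodule.span_induction with
  | mem g hg => exact fun q => H q g hg
  | zero => simp
  | add a b _ _ ha hb => exact fun q => by rw [mul_add, map_add, ha, hb, add_zero]
  | smul c a _ ha => exact fun q => by rw [smul_eq_mul, ← mul_assoc, ha]

/-! ### Dual bases for a functional -/

section DualBases

variable {k : Type u} [Field k] {L : Type v} [CommRing L] [Algebra k L]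
  {ι : Type*} [Fintype ι] [DecidableEq ι] {μ : L →ₗ[k] k} {e f : ι → L}

lemma eq_sum_of_dual (h : ∀ i j, μ (e i * f j) = if i = j then 1 else 0)
    (he : Submodule.span k (Set.range e) = ⊤) (a : L) : a = ∑ i, μ (a * f i) • e i := by
  have ha : a ∈ Submodule.span k (Set.range e) := he ▸ Submodule.mem_top
  obtain ⟨c, rfl⟩ := (Submodule.mem_span_range_iff_exists_fun k).mp ha
  refine Finset.sum_congr rfl fun i _ => ?_
  simp [Finset.sum_mul, h]

lemma linearIndependent_of_dual (h : ∀ i j, μ (e i * f j) = if i = j then 1 else 0) :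
    LinearIndependent k e := by
  rw [Fintype.linearIndependent_iff]
  intro c hc j
  have := congrArg (fun a => μ (a * f j)) hc
  simpa [Finset.sum_mul, h] using this

lemma finrank_of_dual (h : ∀ i j, μ (e i * f j) = if i = j then 1 else 0)
    (he : Submodule.span k (Set.range e) = ⊤) : Module.finrank k L = Fintype.card ι := by
  rw [← finrank_top, ← he, finrank_span_eq_card (linearIndependent_of_dual h)]

lemma isFrobenius_of_dual (h : ∀ i j, μ (e i * f j) = if i = j then 1 else 0)
    (he : Submodule.span k (Set.range e) = ⊤) : IsFrobenius k L := by
  refine ⟨μ, fun a ha => ?_⟩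
  rw [eq_sum_of_dual h he a]
  simp [ha]

end DualBases

/-- The module structure underlying the algebra structure. -/
@[reducible]
def quotientModule {k : Type u} [Field k] {σ : Type} (I : Ideal (MvPolynomial σ k)) :
    Module k (MvPolynomial σ k ⧸ I) :=
  Algebra.toModule

attribute [local instance] quotientModule

/-! ### Quotients of polynomial rings -/

section Presentations

variable {k : Type u} [Field k] {σ : Type} {I : Ideal (MvPolynomial σ k)}

lemma span_eq_top_of_mul_mem {W : Submodule k (MvPolynomial σ k ⧸ I)} (h1 : 1 ∈ W)
    (hX : ∀ i, ∀ w ∈ W, Ideal.Quotient.mk I (MvPolynomial.X i) * w ∈ W) : W = ⊤ := by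
  rw [Submodule.eq_top_iff']
  intro a
  obtain ⟨F, rfl⟩ := Ideal.Quotient.mk_surjective a
  induction F using MvPolynomial.induction_on with
  | C c =>
    have := W.smul_mem c h1
    rwa [Algebra.smul_def, mul_one] at this
  | add p q hp hq =>
    rw [map_add]
    exact W.add_mem hp hq
  | mul_X p i hp =>
    rw [map_mul, mul_comm]
    exact hX i _ hp

lemma sub_C_coeff_mem_span_X (F : MvPolynomial σ k) :
    F - MvPolynomial.C (MvPolynomial.constantCoeff F) ∈
      Ideal.span (Set.range (MvPolynomial.X : σ → MvPolynomial σ k)) := by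
  induction F using MvPolynomial.induction_on with
  | C c => simp
  | add p q hp hq =>
    rw [map_add, map_add]
    convert add_mem hp hq using 1
    ring
  | mul_X p i hp =>
    simp only [map_mul, MvPolynomial.constantCoeff_X, mul_zero, map_zero, sub_zero]
    exact Ideal.mul_mem_left _ _ (Ideal.subset_span ⟨i, rfl⟩)

/-- A quotient of a polynomial ring by an ideal making the variables nilpotent is local. -/
lemma isLocalRing_quotient (hI : ∀ F ∈ I, MvPolynomial.constantCoeff F = 0)
    (hnil : ∀ i, IsNilpotent (Ideal.Quotient.mk I (MvPolynomial.X i))) :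
    ∃ _ : IsLocalRing (MvPolynomial σ k ⧸ I), maximalIdeal (MvPolynomial σ k ⧸ I) =
      Ideal.span (Set.range fun i => Ideal.Quotient.mk I (MvPolynomial.X i)) := by
  -- Every element differs from its constant term by a nilpotent, so the units are exactly the
  -- elements with nonzero constant term.
  let ε : MvPolynomial σ k ⧸ I →+* k := Ideal.Quotient.lift I MvPolynomial.constantCoeff hI
  let J : Ideal (MvPolynomial σ k ⧸ I) :=
    Ideal.span (Set.range fun i => Ideal.Quotient.mk I (MvPolynomial.X i))
  have hJε : ∀ a, a - algebraMap k _ (ε a) ∈ J := fun a => by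
    obtain ⟨F, rfl⟩ := Ideal.Quotient.mk_surjective a
    have := Ideal.mem_map_of_mem (Ideal.Quotient.mk I) (sub_C_coeff_mem_span_X F)
    rw [Ideal.map_span, ← Set.range_comp, map_sub] at this
    exact this
  have hJnil : J ≤ nilradical _ := by
    rw [Ideal.span_le]
    rintro _ ⟨i, rfl⟩
    exact hnil i
  have hunit : ∀ a, ε a ≠ 0 → IsUnit a := fun a ha => by
    have h1 := (IsUnit.mk0 _ ha).map (algebraMap k (MvPolynomial σ k ⧸ I))
    have h2 : IsNilpotent (a - algebraMap k _ (ε a)) := hJnil (hJε a)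
    have := h2.isUnit_add_left_of_commute h1 (Commute.all _ _)
    rwa [add_sub_cancel] at this
  have hunit' : ∀ a, IsUnit a → ε a ≠ 0 := fun a ha => (ha.map ε).ne_zero
  have : Nontrivial (MvPolynomial σ k ⧸ I) := ε.domain_nontrivial
  have hloc : IsLocalRing (MvPolynomial σ k ⧸ I) := by
    refine IsLocalRing.of_nonunits_add fun a b ha hb hab => hunit' _ hab ?_
    rw [map_add, not_imp_comm.mp (hunit a) ha, not_imp_comm.mp (hunit b) hb, add_zero]
  refine ⟨hloc, le_antisymm (fun a ha => ?_) ?_⟩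
  · have h0 : ε a = 0 := not_imp_comm.mp (hunit a) ha
    have := hJε a
    rwa [h0, map_zero, sub_zero] at this
  · rw [Ideal.span_le]
    rintro _ ⟨i, rfl⟩
    refine fun h => hunit' _ h ?_
    exact MvPolynomial.constantCoeff_X k i

end Presentations

/-! ### The algebras A_{n,d}, with d = n + s -/

section AModels

variable (k : Type u) [Field k] (n s : ℕ) [NeZero n]

/-- The class of the `i`-th variable. -/
def gen (i : Fin n) : A k n (n + s) := Ideal.Quotient.mk _ (MvPolynomial.X i)

lemma idealA_eq : idealA k n (n + s) = Ideal.span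
    ({F | ∃ i j : Fin n, i ≤ j ∧ (i, j) ≠ (0, 0) ∧
        F = MvPolynomial.X i * MvPolynomial.X j
          - (if i = j then MvPolynomial.X 0 ^ s else 0)} ∪
      {MvPolynomial.X 0 ^ (s + 1)}) := by
  rw [idealA, Nat.add_sub_cancel_left]

variable {k n s}

lemma gen_mul_gen_of_ne {i j : Fin n} (hij : i ≠ j) : gen k n s i * gen k n s j = 0 := by
  wlog h : i < j generalizing i j
  · rw [mul_comm]
    exact this hij.symm (lt_of_le_of_ne (not_lt.mp h) hij.symm)
  refine Ideal.Quotient.eq_zero_iff_mem.mpr ?_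
  rw [idealA_eq]
  refine Ideal.subset_span (Or.inl ⟨i, j, h.le, fun h' => hij ?_, by simp [hij]⟩)
  rw [Prod.mk.injEq] at h'
  rw [h'.1, h'.2]

lemma gen_sq {j : Fin n} (hj : j ≠ 0) : gen k n s j * gen k n s j = gen k n s 0 ^ s := by
  rw [← sub_eq_zero]
  refine Ideal.Quotient.eq_zero_iff_mem.mpr ?_
  rw [idealA_eq]
  exact Ideal.subset_span (Or.inl ⟨j, j, le_rfl, fun h' => hj (Prod.mk.inj h').1, by simp⟩)

lemma gen_zero_pow : gen k n s 0 ^ (s + 1) = 0 := by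
  refine Ideal.Quotient.eq_zero_iff_mem.mpr ?_
  rw [idealA_eq]
  exact Ideal.subset_span (Or.inr rfl)

/-- Restriction to the `i`-th axis. -/
def axis {n : ℕ} (i : Fin n) : MvPolynomial (Fin n) k →ₐ[k] Polynomial k :=
  MvPolynomial.aeval fun j => if j = i then Polynomial.X else 0

lemma coeff_zero_axis {n : ℕ} (i : Fin n) (F : MvPolynomial (Fin n) k) :
    (axis i F).coeff 0 = MvPolynomial.constantCoeff F := by
  have : (Polynomial.constantCoeff (R := k)).comp (axis i).toRingHom =
      (MvPolynomial.constantCoeff : MvPolynomial (Fin n) k →+* k) := by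
    refine MvPolynomial.ringHom_ext (fun c => ?_) fun j => ?_
    · simp [axis]
    · by_cases h : j = i <;> simp [axis, h]
  exact RingHom.congr_fun this F

/-- The coefficient of `x_0 ^ s` plus the sum of those of the other squares. -/
def axisFunctional (s : ℕ) : MvPolynomial (Fin n) k →ₗ[k] k :=
  (Polynomial.lcoeff k s) ∘ₗ (axis 0).toLinearMap +
    ∑ j ∈ Finset.univ.erase (0 : Fin n), (Polynomial.lcoeff k 2) ∘ₗ (axis j).toLinearMap

lemma axisFunctional_apply (s : ℕ) (F : MvPolynomial (Fin n) k) : axisFunctional s F =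
    (axis 0 F).coeff s + ∑ j ∈ Finset.univ.erase (0 : Fin n), (axis j F).coeff 2 := by
  simp [axisFunctional]

/-- A multiple q of x_i² − x_0^s contributes −q(0) on the 0-axis and q(0) on the i-axis. Mixed
products vanish on every axis, and x_0^{s+1} has too high an order. For s > 0 the power x_0^s
vanishes on the other axes. -/
lemma axisFunctional_eq_zero (hs : 0 < s) (F : MvPolynomial (Fin n) k)
    (hF : F ∈ idealA k n (n + s)) : axisFunctional s F = 0 := by
  rw [idealA_eq] at hF
  suffices H : ∀ q, ∀ g ∈ ({F | ∃ i j : Fin n, i ≤ j ∧ (i, j) ≠ (0, 0) ∧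
        F = MvPolynomial.X i * MvPolynomial.X j
          - (if i = j then MvPolynomial.X 0 ^ s else 0)} ∪
      {MvPolynomial.X 0 ^ (s + 1)} : Set (MvPolynomial (Fin n) k)), axisFunctional s (q * g) = 0 by
    exact apply_eq_zero_of_mem_span H hF
  rintro q g (⟨i, j, hij, hij', rfl⟩ | rfl)
  · by_cases h : i = j
    · subst h
      have hi : i ≠ 0 := fun h => hij' (by rw [h])
      have h1 : (axis 0 (q * (MvPolynomial.X i * MvPolynomial.X i -
          MvPolynomial.X 0 ^ s))).coeff s = - MvPolynomial.constantCoeff q := by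
        rw [← coeff_zero_axis 0 q, map_mul]
        have : axis (k := k) 0 (MvPolynomial.X i * MvPolynomial.X i - MvPolynomial.X (0 : Fin n) ^ s) =
          - Polynomial.X ^ s := by simp [axis, hi]
        rw [this, mul_neg, Polynomial.coeff_neg, Polynomial.coeff_mul_X_pow', if_pos le_rfl,
          Nat.sub_self]
      have h2 : ∀ j ∈ Finset.univ.erase (0 : Fin n), (axis j (q * (MvPolynomial.X i *
          MvPolynomial.X i - MvPolynomial.X 0 ^ s))).coeff 2 =
          if j = i then MvPolynomial.constantCoeff q else 0 := by
        intro j hj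
        have hj0 : ¬ (0 = j) := fun h => (Finset.mem_erase.mp hj).1 h.symm
        rw [map_mul]
        have : axis (k := k) j (MvPolynomial.X i * MvPolynomial.X i - MvPolynomial.X (0 : Fin n) ^ s) =
          if j = i then Polynomial.X ^ 2 else 0 := by
          by_cases hji : j = i
          · subst hji
            simp [axis, hj0, hs.ne', sq]
          · have : ¬ (i = j) := fun h => hji h.symm
            simp [axis, hj0, this, hji, hs.ne']
        rw [this]
        split_ifs
        · rw [Polynomial.coeff_mul_X_pow', if_pos le_rfl, Nat.sub_self, coeff_zero_axis]
        · simp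
      rw [if_pos rfl, axisFunctional_apply, h1, Finset.sum_congr rfl h2, Finset.sum_ite_eq',
        if_pos (by simp [hi])]
      ring
    · have h1 : ∀ l : Fin n, axis (k := k) l (q * (MvPolynomial.X i * MvPolynomial.X j - 0)) = 0 := by
        intro l
        by_cases hl : i = l
        · have : ¬ (j = l) := fun h' => h (hl.trans h'.symm)
          simp [axis, this]
        · simp [axis, hl]
      rw [if_neg h, axisFunctional_apply]
      simp only [h1, Polynomial.coeff_zero, Finset.sum_const_zero, add_zero]
  · have h1 : (axis (k := k) 0 (q * MvPolynomial.X (0 : Fin n) ^ (s + 1))).coeff s = 0 := by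
      simp [axis, Polynomial.coeff_mul_X_pow']
    have h2 : ∀ j ∈ Finset.univ.erase (0 : Fin n), (axis j (q * MvPolynomial.X 0 ^ (s + 1))).coeff 2 = 0 := by
      intro j hj
      have hj0 : ¬ (0 = j) := fun h => (Finset.mem_erase.mp hj).1 h.symm
      simp [axis, hj0]
    rw [axisFunctional_apply, h1, Finset.sum_eq_zero h2, add_zero]

/-- The basis of monomials. -/
def basisA (k : Type u) [Field k] (n s : ℕ) [NeZero n] :
    Fin (s + 1) ⊕ {j : Fin n // j ≠ 0} → A k n (n + s) :=
  Sum.elim (fun i => gen k n s 0 ^ (i : ℕ)) fun j => gen k n s j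

/-- The dual basis. -/
def dualA (k : Type u) [Field k] (n s : ℕ) [NeZero n] :
    Fin (s + 1) ⊕ {j : Fin n // j ≠ 0} → A k n (n + s) :=
  Sum.elim (fun i => gen k n s 0 ^ (s - i : ℕ)) fun j => gen k n s j

lemma span_basisA : Submodule.span k (Set.range (basisA k n s)) = ⊤ := by
  have hpow : ∀ i, gen k n s 0 ^ i ∈ Submodule.span k (Set.range (basisA k n s)) := fun i => by
    by_cases hi : i < s + 1
    · exact Submodule.subset_span ⟨Sum.inl ⟨i, hi⟩, rfl⟩
    · rw [pow_eq_zero_of_le (not_lt.mp hi) gen_zero_pow]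
      exact zero_mem _
  have hgen : ∀ j : Fin n, gen k n s j ∈ Submodule.span k (Set.range (basisA k n s)) := fun j => by
    by_cases hj : j = 0
    · subst hj
      simpa using hpow 1
    · exact Submodule.subset_span ⟨Sum.inr ⟨j, hj⟩, rfl⟩
  refine span_eq_top_of_mul_mem (by simpa using hpow 0) fun j w hw => ?_
  change gen k n s j * w ∈ _
  induction hw using Submodule.span_induction with
  | zero => rw [mul_zero]; exact zero_mem _
  | add a b _ _ ha hb => rw [mul_add]; exact add_mem ha hb
  | smul c a _ ha => rw [mul_smul_comm]; exact Submodule.smul_mem _ _ ha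
  | mem w hw =>
    obtain ⟨i | ⟨i, hi⟩, rfl⟩ := hw
    · change gen k n s j * gen k n s 0 ^ (i : ℕ) ∈ _
      by_cases hj : j = 0
      · subst hj
        rw [← pow_succ']
        exact hpow _
      · by_cases hi : (i : ℕ) = 0
        · rw [hi, pow_zero, mul_one]
          exact hgen j
        · obtain ⟨m, hm⟩ := Nat.exists_eq_succ_of_ne_zero hi
          rw [hm, pow_succ', ← mul_assoc, gen_mul_gen_of_ne hj, zero_mul]
          exact zero_mem _
    · change gen k n s j * gen k n s i ∈ _
      by_cases hij : j = i
      · subst hij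
        rw [gen_sq hi]
        exact hpow s
      · rw [gen_mul_gen_of_ne hij]
        exact zero_mem _

/-- The dualizing functional. -/
def functionalA (hs : 0 < s) : A k n (n + s) →ₗ[k] k :=
  Submodule.liftQ ((idealA k n (n + s)).restrictScalars k) (axisFunctional s)
    (axisFunctional_eq_zero hs)

lemma functionalA_pow (hs : 0 < s) (i : ℕ) :
    functionalA hs (gen k n s 0 ^ i) = if i = s then 1 else 0 := by
  change axisFunctional s (MvPolynomial.X 0 ^ i) = _
  have h1 : axis (k := k) 0 (MvPolynomial.X (0 : Fin n) ^ i) = Polynomial.X ^ i := by simp [axis]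
  have h2 : ∀ j ∈ Finset.univ.erase (0 : Fin n),
      (axis (k := k) j (MvPolynomial.X (0 : Fin n) ^ i)).coeff 2 = 0 := by
    intro j hj
    have hj0 : ¬ (0 = j) := fun h => (Finset.mem_erase.mp hj).1 h.symm
    by_cases hi : i = 0
    · simp [hi, Polynomial.coeff_one]
    · simp [axis, hj0, hi]
  rw [axisFunctional_apply, h1, Finset.sum_eq_zero h2, Polynomial.coeff_X_pow, add_zero]
  simp only [eq_comm]

lemma functionalA_gen (hs : 0 < s) {j : Fin n} (hj : j ≠ 0) :
    functionalA hs (gen k n s j) = 0 := by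
  change axisFunctional s (MvPolynomial.X j) = _
  rw [axisFunctional_apply]
  have h2 : ∀ i ∈ Finset.univ.erase (0 : Fin n),
      (axis (k := k) i (MvPolynomial.X j)).coeff 2 = 0 := by
    intro i _
    by_cases hi : j = i <;> simp [axis, hi, Polynomial.coeff_X]
  rw [Finset.sum_eq_zero h2]
  simp [axis, hj]

lemma functionalA_dual (hs : 0 < s) (i j : Fin (s + 1) ⊕ {j : Fin n // j ≠ 0}) :
    functionalA hs (basisA k n s i * dualA k n s j) = if i = j then 1 else 0 := by
  have hmix : ∀ (m : ℕ) (j : Fin n), j ≠ 0 → functionalA hs (gen k n s 0 ^ m * gen k n s j) = 0 := by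
    intro m j hj
    match m with
    | 0 => rw [pow_zero, one_mul, functionalA_gen hs hj]
    | m + 1 => rw [pow_succ, mul_assoc, gen_mul_gen_of_ne hj.symm, mul_zero, map_zero]
  rcases i with i | ⟨i, hi⟩ <;> rcases j with j | ⟨j, hj⟩
  · simp only [basisA, dualA, Sum.elim_inl, ← pow_add, functionalA_pow, Sum.inl.injEq, Fin.ext_iff]
    have := i.2
    have := j.2
    congr 1
    exact propext (by omega)
  · simp only [basisA, dualA, Sum.elim_inl, Sum.elim_inr, reduceCtorEq, if_false]
    exact hmix _ _ hj
  · simp only [basisA, dualA, Sum.elim_inl, Sum.elim_inr, reduceCtorEq, if_false]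
    rw [mul_comm]
    exact hmix _ _ hi
  · simp only [basisA, dualA, Sum.elim_inr, Sum.inr.injEq, Subtype.mk.injEq]
    split_ifs with h
    · rw [h, gen_sq hj, functionalA_pow, if_pos rfl]
    · rw [gen_mul_gen_of_ne h, map_zero]

lemma finrank_A (hs : 0 < s) : Module.finrank k (A k n (n + s)) = n + s := by
  rw [finrank_of_dual (functionalA_dual hs) span_basisA, Fintype.card_sum, Fintype.card_fin,
    Fintype.card_subtype_compl, Fintype.card_fin, Fintype.card_subtype_eq]
  have := NeZero.pos n
  omega

lemma isFrobenius_A (hs : 0 < s) : IsFrobenius k (A k n (n + s)) :=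
  isFrobenius_of_dual (functionalA_dual hs) span_basisA

lemma finite_A (hs : 0 < s) : Module.Finite k (A k n (n + s)) :=
  Module.finite_of_finrank_pos (by rw [finrank_A hs]; omega)

lemma gen_zero_pow_ne_zero (hs : 0 < s) : gen k n s 0 ^ s ≠ 0 := fun h => by
  have := functionalA_pow (k := k) (n := n) hs s
  rw [h, map_zero, if_pos rfl] at this
  exact zero_ne_one this

lemma isLocalRing_A (hs : 0 < s) : ∃ _ : IsLocalRing (A k n (n + s)),
    maximalIdeal (A k n (n + s)) = Ideal.span (Set.range (gen k n s)) := by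
  refine isLocalRing_quotient (fun F hF => ?_) fun i => ?_
  · change F ∈ RingHom.ker (MvPolynomial.constantCoeff : MvPolynomial (Fin n) k →+* k)
    rw [idealA_eq] at hF
    refine (Ideal.span_le.mpr ?_) hF
    rintro _ (⟨i, j, _, _, rfl⟩ | rfl)
    · rw [SetLike.mem_coe, RingHom.mem_ker]
      split_ifs <;> simp [hs.ne']
    · rw [SetLike.mem_coe, RingHom.mem_ker]
      simp
  · change IsNilpotent (gen k n s i)
    by_cases hi : i = 0
    · exact ⟨s + 1, hi ▸ gen_zero_pow⟩
    · refine ⟨2 * (s + 1), ?_⟩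
      rw [pow_mul, sq, gen_sq hi, ← pow_mul, mul_comm, pow_mul, gen_zero_pow, zero_pow hs.ne']

lemma mul_gen_zero_pow [IsLocalRing (A k n (n + s))] (hs : 0 < s) :
    ∀ r ∈ maximalIdeal (A k n (n + s)), r * gen k n s 0 ^ s = 0 := by
  obtain ⟨_, h⟩ := isLocalRing_A (k := k) (n := n) hs
  rw [h]
  intro r hr
  induction hr using Submodule.span_induction with
  | zero => rw [zero_mul]
  | add a b _ _ ha hb => rw [add_mul, ha, hb, add_zero]
  | smul c a _ ha => rw [smul_eq_mul, mul_assoc, ha, mul_zero]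
  | mem w hw =>
    obtain ⟨i, rfl⟩ := hw
    by_cases hi : i = 0
    · rw [hi, ← pow_succ', gen_zero_pow]
    · obtain ⟨m, rfl⟩ := Nat.exists_eq_succ_of_ne_zero hs.ne'
      rw [pow_succ', ← mul_assoc, gen_mul_gen_of_ne hi, zero_mul]

/-- The homomorphism from `A_{n,n+s}` given by elements satisfying the relations. -/
lemma exists_algHom_A {C : Type*} [CommRing C] [Algebra k C] (x : Fin n → C)
    (h1 : ∀ i j, i ≠ j → x i * x j = 0) (h2 : ∀ j, j ≠ 0 → x j * x j = x 0 ^ s)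
    (h3 : x 0 ^ (s + 1) = 0) : ∃ f : A k n (n + s) →ₐ[k] C, ∀ i, f (gen k n s i) = x i := by
  have hle : ∀ F ∈ idealA k n (n + s), MvPolynomial.aeval (R := k) x F = 0 := by
    intro F hF
    change F ∈ RingHom.ker (MvPolynomial.aeval (R := k) x)
    rw [idealA_eq] at hF
    refine (Ideal.span_le.mpr ?_) hF
    rintro _ (⟨i, j, _, hij, rfl⟩ | rfl)
    · rw [SetLike.mem_coe, RingHom.mem_ker]
      split_ifs with h
      · subst h
        have hi : i ≠ 0 := fun h => hij (by rw [h])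
        simp [h2 i hi]
      · simp [h1 i j h]
    · rw [SetLike.mem_coe, RingHom.mem_ker]
      simp [h3]
  exact ⟨Ideal.Quotient.liftₐ _ (MvPolynomial.aeval x) hle, fun i =>
    MvPolynomial.aeval_X x i⟩

end AModels

end AGor
end

noncomputable section
namespace AGor
open IsLocalRing
attribute [local instance] quotientModule

/-! ### The special algebras -/

section Special

variable {k : Type u} [Field k] {I : Ideal (MvPolynomial (Fin 2) k)}

lemma quotient_smul_def (c : k) (a : MvPolynomial (Fin 2) k ⧸ I) :
    c • a = algebraMap k (MvPolynomial (Fin 2) k ⧸ I) c * a :=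
  Algebra.smul_def c a

/-- The monomial `x_1 ^ a x_2 ^ b`. -/
def mon (I : Ideal (MvPolynomial (Fin 2) k)) (a b : ℕ) : MvPolynomial (Fin 2) k ⧸ I :=
  Ideal.Quotient.mk I (MvPolynomial.X 0 ^ a * MvPolynomial.X 1 ^ b)

lemma mon_eq (a b : ℕ) : mon I a b = mon I 1 0 ^ a * mon I 0 1 ^ b := by
  simp [mon]

lemma mon_mul_mon (a b a' b' : ℕ) : mon I a b * mon I a' b' = mon I (a + a') (b + b') := by
  rw [mon_eq a, mon_eq a', mon_eq (a + a')]
  ring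

lemma mon_zero : mon I 0 0 = 1 := by simp [mon]

lemma mon_eq_zero (h3 : mon I 3 0 = 0) {a : ℕ} (ha : 3 ≤ a) (b : ℕ) : mon I a b = 0 := by
  obtain ⟨c, rfl⟩ := Nat.exists_eq_add_of_le ha
  rw [← zero_add b, ← mon_mul_mon, h3, zero_mul]

/-- Both special algebras satisfy x_2² = ε x_1², with ε = 0 for `A₁sp` and ε = 1 for `A₂sp`; they
are treated together. -/
lemma mon_add_two {ε : k} (h2 : mon I 0 2 = ε • mon I 2 0) (a b : ℕ) :
    mon I a (b + 2) = ε • mon I (a + 2) b := by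
  rw [← add_zero a, ← mon_mul_mon, h2, mul_smul_comm, mon_mul_mon, add_zero, add_zero]

lemma span_mon {ε : k} (h3 : mon I 3 0 = 0) (h2 : mon I 0 2 = ε • mon I 2 0) :
    Submodule.span k (Set.range fun i : Fin 3 × Fin 2 => mon I i.1 i.2) = ⊤ := by
  have h0 : ∀ a b, b < 2 →
      mon I a b ∈ Submodule.span k (Set.range fun i : Fin 3 × Fin 2 => mon I i.1 i.2) := by
    intro a b hb
    by_cases ha : a < 3
    · exact Submodule.subset_span ⟨(⟨a, ha⟩, ⟨b, hb⟩), rfl⟩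
    · rw [mon_eq_zero h3 (not_lt.mp ha)]
      exact zero_mem _
  refine span_eq_top_of_mul_mem (by simpa [mon_zero] using h0 0 0) fun j w hw => ?_
  induction hw using Submodule.span_induction with
  | zero => rw [mul_zero]; exact zero_mem _
  | add a b _ _ ha hb => rw [mul_add]; exact add_mem ha hb
  | smul c a _ ha => rw [mul_smul_comm]; exact Submodule.smul_mem _ _ ha
  | mem w hw =>
    obtain ⟨⟨a, b⟩, rfl⟩ := hw
    fin_cases j
    · have : Ideal.Quotient.mk I (MvPolynomial.X 0) = mon I 1 0 := by simp [mon]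
      change Ideal.Quotient.mk I (MvPolynomial.X 0) * mon I a b ∈ _
      rw [this, mon_mul_mon, zero_add]
      exact h0 _ _ b.2
    · have : Ideal.Quotient.mk I (MvPolynomial.X 1) = mon I 0 1 := by simp [mon]
      change Ideal.Quotient.mk I (MvPolynomial.X 1) * mon I a b ∈ _
      rw [this, mon_mul_mon, zero_add]
      by_cases hb : (b : ℕ) = 0
      · rw [hb]
        exact h0 _ _ (by norm_num)
      · have : 1 + (b : ℕ) = 0 + 2 := by omega
        rw [this, mon_add_two h2]
        exact Submodule.smul_mem _ _ (h0 _ _ (by norm_num))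

/-- A functional dual to the monomial `x_1 ^ 2 x_2`. -/
def IsTopCoeff (μ : (MvPolynomial (Fin 2) k ⧸ I) →ₗ[k] k) : Prop :=
  -- The bound on b leaves out x_2³ = ε x_1² x_2, where the formula fails for ε = 1. The products
  -- needed for duality have b ≤ 2.
  ∀ a b, b < 3 → μ (mon I a b) = if a = 2 ∧ b = 1 then 1 else 0

lemma IsTopCoeff.dual {μ : (MvPolynomial (Fin 2) k ⧸ I) →ₗ[k] k} (hμ : IsTopCoeff μ)
    (i j : Fin 3 × Fin 2) :
    μ (mon I i.1 i.2 * mon I (2 - j.1 : ℕ) (1 - j.2 : ℕ)) = if i = j then 1 else 0 := by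
  rw [mon_mul_mon, hμ _ _ (by omega)]
  congr 1
  rw [Prod.ext_iff, Fin.ext_iff, Fin.ext_iff]
  exact propext (by omega)

/-- The relations of the special algebras. -/
structure IsSpecial (I : Ideal (MvPolynomial (Fin 2) k)) (ε : k) : Prop where
  cube : mon I 3 0 = 0
  sq : mon I 0 2 = ε • mon I 2 0
  exists_isTopCoeff : ∃ μ : (MvPolynomial (Fin 2) k ⧸ I) →ₗ[k] k, IsTopCoeff μ
  constantCoeff_eq_zero : ∀ F ∈ I, MvPolynomial.constantCoeff F = 0

namespace IsSpecial

variable {ε : k}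

lemma finrank_eq (h : IsSpecial I ε) : Module.finrank k (MvPolynomial (Fin 2) k ⧸ I) = 6 := by
  obtain ⟨μ, hμ⟩ := h.exists_isTopCoeff
  rw [finrank_of_dual hμ.dual (span_mon h.cube h.sq)]
  rfl

lemma finite (h : IsSpecial I ε) : Module.Finite k (MvPolynomial (Fin 2) k ⧸ I) :=
  Module.finite_of_finrank_pos (by rw [h.finrank_eq]; norm_num)

lemma isFrobenius (h : IsSpecial I ε) : IsFrobenius k (MvPolynomial (Fin 2) k ⧸ I) := by
  obtain ⟨μ, hμ⟩ := h.exists_isTopCoeff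
  exact isFrobenius_of_dual hμ.dual (span_mon h.cube h.sq)

lemma top_ne_zero (h : IsSpecial I ε) : mon I 2 1 ≠ 0 := fun h0 => by
  obtain ⟨μ, hμ⟩ := h.exists_isTopCoeff
  have := hμ 2 1 (by norm_num)
  rw [h0, map_zero, if_pos ⟨rfl, rfl⟩] at this
  exact zero_ne_one this

lemma isLocalRing (h : IsSpecial I ε) : ∃ _ : IsLocalRing (MvPolynomial (Fin 2) k ⧸ I),
    maximalIdeal (MvPolynomial (Fin 2) k ⧸ I) = Ideal.span {mon I 1 0, mon I 0 1} := by
  have h0 : Ideal.Quotient.mk I (MvPolynomial.X 0) = mon I 1 0 := by simp [mon]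
  have h1 : Ideal.Quotient.mk I (MvPolynomial.X 1) = mon I 0 1 := by simp [mon]
  obtain ⟨hl, hm⟩ := isLocalRing_quotient h.constantCoeff_eq_zero fun i => by
    fin_cases i
    · refine ⟨3, ?_⟩
      change Ideal.Quotient.mk I (MvPolynomial.X 0) ^ 3 = 0
      rw [h0, ← h.cube, mon_eq 3 0, pow_zero, mul_one]
    · refine ⟨4, ?_⟩
      change Ideal.Quotient.mk I (MvPolynomial.X 1) ^ 4 = 0
      have : mon I 0 1 ^ 4 = mon I 0 (2 + 2) := by rw [mon_eq 0 (2 + 2), pow_zero, one_mul]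
      rw [h1, this, mon_add_two h.sq, mon_add_two h.sq 2 0, mon_eq_zero h.cube (by norm_num), smul_zero, smul_zero]
  refine ⟨hl, hm.trans ?_⟩
  congr 1
  ext a
  simp only [Set.mem_range, Fin.exists_fin_two, h0, h1, Set.mem_insert_iff, Set.mem_singleton_iff,
    eq_comm]

lemma mul_top (h : IsSpecial I ε) [IsLocalRing (MvPolynomial (Fin 2) k ⧸ I)] :
    ∀ r ∈ maximalIdeal (MvPolynomial (Fin 2) k ⧸ I), r * mon I 2 1 = 0 := by
  obtain ⟨_, hm⟩ := h.isLocalRing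
  rw [hm]
  intro r hr
  obtain ⟨p, q, rfl⟩ := Ideal.mem_span_pair.mp hr
  rw [add_mul, mul_assoc, mul_assoc, mon_mul_mon, mon_mul_mon, mon_eq_zero h.cube (by norm_num),
    mon_add_two h.sq (0 + 2) 0, mon_eq_zero h.cube (by norm_num), smul_zero, mul_zero, mul_zero,
    add_zero]

/-- An element is determined by its products with the dual monomials. -/
lemma exists_eq (h : IsSpecial I ε) (y : MvPolynomial (Fin 2) k ⧸ I) : ∃ c : ℕ → ℕ → k,
    (∀ i < 3, ∀ j < 2, y * mon I (2 - i) (1 - j) = 0 → c i j = 0) ∧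
    y = c 0 0 • 1 + c 1 0 • mon I 1 0 + c 0 1 • mon I 0 1 + c 2 0 • mon I 2 0 +
      c 1 1 • mon I 1 1 + c 2 1 • mon I 2 1 := by
  obtain ⟨μ, hμ⟩ := h.exists_isTopCoeff
  refine ⟨fun i j => μ (y * mon I (2 - i) (1 - j)), fun i _ j _ h0 => (congrArg μ h0).trans (map_zero μ), ?_⟩
  conv_lhs => rw [eq_sum_of_dual hμ.dual (span_mon h.cube h.sq) y]
  rw [Fintype.sum_prod_type]
  simp only [Fin.sum_univ_three, Fin.sum_univ_two, ← mon_zero (I := I)]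
  simp only [Fin.val_zero, Fin.val_one, Fin.val_two]
  abel

lemma sq_eq_zero_of_forall (h : IsSpecial I ε) (y : MvPolynomial (Fin 2) k ⧸ I)
    (hy : ∀ a b, IsNilpotent a → IsNilpotent b → y * a * b = 0) : y * y = 0 := by
  obtain ⟨_, hm⟩ := h.isLocalRing
  have := h.finite
  have hx : IsNilpotent (mon I 1 0) := by
    rw [isNilpotent_iff_mem_maximalIdeal k, hm]
    exact Ideal.subset_span (by simp)
  have hx' : IsNilpotent (mon I 0 1) := by
    rw [isNilpotent_iff_mem_maximalIdeal k, hm]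
    exact Ideal.subset_span (by simp)
  obtain ⟨c, hc, rfl⟩ := h.exists_eq y
  set y := c 0 0 • 1 + c 1 0 • mon I 1 0 + c 0 1 • mon I 0 1 + c 2 0 • mon I 2 0 +
      c 1 1 • mon I 1 1 + c 2 1 • mon I 2 1 with hy'
  have h20 : y * mon I 2 0 = 0 := by
    rw [show mon I 2 0 = mon I 1 0 * mon I 1 0 by rw [mon_mul_mon], ← mul_assoc, hy _ _ hx hx]
  have h11 : y * mon I 1 1 = 0 := by
    rw [show mon I 1 1 = mon I 1 0 * mon I 0 1 by rw [mon_mul_mon], ← mul_assoc, hy _ _ hx hx']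
  have h21 : y * mon I 2 1 = 0 := by
    rw [show mon I 2 1 = mon I 2 0 * mon I 0 1 by rw [mon_mul_mon], ← mul_assoc, h20, zero_mul]
  have h3 : y = c 2 0 • mon I 2 0 + c 1 1 • mon I 1 1 + c 2 1 • mon I 2 1 := by
    rw [hy', hc 0 (by norm_num) 0 (by norm_num) h21, hc 1 (by norm_num) 0 (by norm_num) h11,
      hc 0 (by norm_num) 1 (by norm_num) h20]
    simp
  conv_lhs => rw [h3, ← h3]
  conv_lhs => enter [2]; rw [h3]
  simp only [mul_add, mul_smul_comm, h20, h11, h21, smul_zero, add_zero]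

end IsSpecial

end Special

section

variable (k : Type u) [Field k]

/-- The ideals of the special algebras. -/
abbrev ideal₁sp : Ideal (MvPolynomial (Fin 2) k) :=
  Ideal.span {MvPolynomial.X 1 ^ 2, MvPolynomial.X 0 ^ 3}

/-- The ideals of the special algebras. -/
abbrev ideal₂sp : Ideal (MvPolynomial (Fin 2) k) :=
  Ideal.span {MvPolynomial.X 1 ^ 2 - MvPolynomial.X 0 ^ 2, MvPolynomial.X 0 ^ 3}

variable {k}

/-- The exponent of `x_1 ^ a x_2 ^ b`. -/
def expo (a b : ℕ) : Fin 2 →₀ ℕ := Finsupp.single 0 a + Finsupp.single 1 b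

lemma expo_zero (a b : ℕ) : expo a b 0 = a := by simp [expo]

lemma expo_one (a b : ℕ) : expo a b 1 = b := by simp [expo]

lemma X_pow_mul_X_pow (a b : ℕ) : (MvPolynomial.X 0 ^ a * MvPolynomial.X 1 ^ b :
    MvPolynomial (Fin 2) k) = MvPolynomial.monomial (expo a b) 1 := by
  rw [MvPolynomial.X_pow_eq_monomial, MvPolynomial.X_pow_eq_monomial, MvPolynomial.monomial_mul,
    one_mul, expo]

lemma expo_le_iff {a b a' b' : ℕ} : expo a b ≤ expo a' b' ↔ a ≤ a' ∧ b ≤ b' := by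
  rw [Finsupp.le_def, Fin.forall_fin_two, expo_zero, expo_zero, expo_one, expo_one]

lemma expo_inj {a b a' b' : ℕ} : expo a b = expo a' b' ↔ a = a' ∧ b = b' := by
  rw [le_antisymm_iff, expo_le_iff, expo_le_iff]
  omega

lemma expo_sub (a b a' b' : ℕ) : expo a b - expo a' b' = expo (a - a') (b - b') := by
  ext i
  fin_cases i
  · exact (Finsupp.tsub_apply _ _ _).trans (by rw [Fin.zero_eta, expo_zero, expo_zero, expo_zero])
  · exact (Finsupp.tsub_apply _ _ _).trans (by
      rw [Fin.mk_one, expo_one, expo_one, expo_one])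

lemma coeff_mul_X_pow (q : MvPolynomial (Fin 2) k) (a b a' b' : ℕ) :
    MvPolynomial.coeff (expo a b) (q * (MvPolynomial.X 0 ^ a' * MvPolynomial.X 1 ^ b')) =
      if a' ≤ a ∧ b' ≤ b then MvPolynomial.coeff (expo (a - a') (b - b')) q else 0 := by
  rw [X_pow_mul_X_pow, MvPolynomial.coeff_mul_monomial', mul_one, expo_sub]
  simp only [expo_le_iff]

lemma coeff_X_pow (a b a' b' : ℕ) : MvPolynomial.coeff (expo a b)
    (MvPolynomial.X 0 ^ a' * MvPolynomial.X 1 ^ b' : MvPolynomial (Fin 2) k) =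
      if a' = a ∧ b' = b then 1 else 0 := by
  rw [X_pow_mul_X_pow, MvPolynomial.coeff_monomial]
  simp only [expo_inj]

lemma isSpecial_ideal₁sp : IsSpecial (ideal₁sp k) 0 where
  cube := by
    rw [mon, pow_zero, mul_one]
    exact Ideal.Quotient.eq_zero_iff_mem.mpr (Ideal.subset_span (by simp))
  sq := by
    rw [mon, pow_zero, one_mul, zero_smul]
    exact Ideal.Quotient.eq_zero_iff_mem.mpr (Ideal.subset_span (by simp))
  exists_isTopCoeff := by
    let μ := MvPolynomial.lcoeff k (expo 2 1)
    have hμ : ∀ F ∈ ideal₁sp k, μ F = 0 := fun F hF => by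
      refine apply_eq_zero_of_mem_span ?_ hF
      rintro q g (rfl | rfl)
      · have := coeff_mul_X_pow q 2 1 0 2
        rw [pow_zero, one_mul] at this
        exact this
      · have := coeff_mul_X_pow q 2 1 3 0
        rw [pow_zero, mul_one] at this
        exact this
    exact ⟨Submodule.liftQ ((ideal₁sp k).restrictScalars k) μ hμ,
      fun a b _ => coeff_X_pow 2 1 a b⟩
  constantCoeff_eq_zero F hF := by
    change F ∈ RingHom.ker (MvPolynomial.constantCoeff : MvPolynomial (Fin 2) k →+* k)
    refine (Ideal.span_le.mpr ?_) hF
    rintro _ (rfl | rfl) <;> simp [RingHom.mem_ker]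

lemma isSpecial_ideal₂sp : IsSpecial (ideal₂sp k) 1 where
  cube := by
    rw [mon, pow_zero, mul_one]
    exact Ideal.Quotient.eq_zero_iff_mem.mpr (Ideal.subset_span (by simp))
  sq := by
    rw [mon, pow_zero, one_mul, one_smul, mon, pow_zero, mul_one]
    exact Ideal.Quotient.eq.mpr (Ideal.subset_span (by simp))
  exists_isTopCoeff := by
    -- Here x_2³ ≡ x_1² x_2, so both monomials count.
    let μ := MvPolynomial.lcoeff k (expo 2 1) + MvPolynomial.lcoeff k (expo 0 3)
    have hμ' : ∀ F, μ F = MvPolynomial.coeff (expo 2 1) F + MvPolynomial.coeff (expo 0 3) F :=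
      fun F => rfl
    have hμ : ∀ F ∈ ideal₂sp k, μ F = 0 := fun F hF => by
      refine apply_eq_zero_of_mem_span ?_ hF
      rintro q g (rfl | rfl)
      · have h1 := coeff_mul_X_pow q 2 1 0 2
        have h2 := coeff_mul_X_pow q 0 3 0 2
        have h3 := coeff_mul_X_pow q 2 1 2 0
        have h4 := coeff_mul_X_pow q 0 3 2 0
        rw [pow_zero, one_mul] at h1 h2
        rw [pow_zero, mul_one] at h3 h4
        rw [hμ', mul_sub, MvPolynomial.coeff_sub, MvPolynomial.coeff_sub, h1, h2, h3, h4]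
        simp
      · have h1 := coeff_mul_X_pow q 2 1 3 0
        have h2 := coeff_mul_X_pow q 0 3 3 0
        rw [pow_zero, mul_one] at h1 h2
        rw [hμ', h1, h2]
        simp
    refine ⟨Submodule.liftQ ((ideal₂sp k).restrictScalars k) μ hμ, fun a b hb => ?_⟩
    refine (hμ' _).trans ?_
    rw [coeff_X_pow, coeff_X_pow, if_neg (show ¬ (a = 0 ∧ b = 3) by omega), add_zero]
  constantCoeff_eq_zero F hF := by
    change F ∈ RingHom.ker (MvPolynomial.constantCoeff : MvPolynomial (Fin 2) k →+* k)
    refine (Ideal.span_le.mpr ?_) hF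
    rintro _ (rfl | rfl) <;> simp [RingHom.mem_ker]

lemma exists_algHom_A₁sp {C : Type*} [CommRing C] [Algebra k C] {x y : C} (hy : y ^ 2 = 0)
    (hx : x ^ 3 = 0) : ∃ f : A₁sp k →ₐ[k] C, f (mon (ideal₁sp k) 2 1) = x ^ 2 * y := by
  have hle : ∀ F ∈ ideal₁sp k, MvPolynomial.aeval (R := k) ![x, y] F = 0 := by
    intro F hF
    change F ∈ RingHom.ker (MvPolynomial.aeval (R := k) ![x, y])
    refine (Ideal.span_le.mpr ?_) hF
    rintro _ (rfl | rfl) <;> simp [RingHom.mem_ker, hx, hy]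
  refine ⟨Ideal.Quotient.liftₐ _ (MvPolynomial.aeval ![x, y]) hle, ?_⟩
  change MvPolynomial.aeval (R := k) ![x, y] _ = _
  simp

lemma exists_algHom_A₂sp {C : Type*} [CommRing C] [Algebra k C] {x y : C} (hy : y ^ 2 = x ^ 2)
    (hx : x ^ 3 = 0) : ∃ f : A₂sp k →ₐ[k] C, f (mon (ideal₂sp k) 2 1) = x ^ 2 * y := by
  have hle : ∀ F ∈ ideal₂sp k, MvPolynomial.aeval (R := k) ![x, y] F = 0 := by
    intro F hF
    change F ∈ RingHom.ker (MvPolynomial.aeval (R := k) ![x, y])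
    refine (Ideal.span_le.mpr ?_) hF
    rintro _ (rfl | rfl) <;> simp [RingHom.mem_ker, hx, hy]
  refine ⟨Ideal.Quotient.liftₐ _ (MvPolynomial.aeval ![x, y]) hle, ?_⟩
  change MvPolynomial.aeval (R := k) ![x, y] _ = _
  simp

end

end AGor
end

noncomputable section
namespace AGor
open IsLocalRing
attribute [local instance] quotientModule

/-! ### The local models -/

section

variable (k : Type u) [Field k]

/-- The local algebras occurring as factors. -/
def localModel : Fin 14 → CommAlgCat.{u} k :=
  ![.of k k, .of k (A k 1 2), .of k (A k 1 3), .of k (A k 1 4), .of k (A k 2 4), .of k (A k 1 5),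
    .of k (A k 2 5), .of k (A k 3 5), .of k (A k 1 6), .of k (A k 2 6), .of k (A k 3 6),
    .of k (A k 4 6), .of k (A₁sp k), .of k (A₂sp k)]

/-- The dimensions of the local models. -/
def localDim : Fin 14 → ℕ := ![1, 2, 3, 4, 4, 5, 5, 5, 6, 6, 6, 6, 6, 6]

/-- The largest exponents of nonzero powers of nilpotent elements. -/
def localExp : Fin 14 → ℕ := ![0, 1, 2, 3, 2, 4, 3, 2, 5, 4, 3, 2, 3, 3]

/-- A local Frobenius algebra with given dimension and largest exponent of a nonzero power of a
nilpotent element. -/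
structure IsLocalModel (L : Type u) [CommRing L] [Algebra k L] (d s : ℕ) : Prop where
  isLocalRing : IsLocalRing L
  finrank_eq : Module.finrank k L = d
  isFrobenius : IsFrobenius k L
  exists_pow_ne_zero : ∃ a : L, IsNilpotent a ∧ a ^ s ≠ 0
  pow_eq_zero : ∀ a : L, IsNilpotent a → a ^ (s + 1) = 0

lemma isLocalModel_self : IsLocalModel k k 1 0 where
  isLocalRing := inferInstance
  finrank_eq := Module.finrank_self k
  isFrobenius := ⟨LinearMap.id, fun a ha => by simpa using ha 1⟩
  exists_pow_ne_zero := ⟨0, IsNilpotent.zero, by simp⟩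
  pow_eq_zero a ha := by simpa using ha.eq_zero

variable {k}

/-- Any product of two generators is 0, x_0² or x_0^s, and the last one needs s ≥ 2 or does not
occur when n = 1. -/
lemma sq_mem_of_mem_span_gen {n s : ℕ} [NeZero n] (h : 2 ≤ s ∨ n = 1)
    {a b : A k n (n + s)} (ha : a ∈ Ideal.span (Set.range (gen k n s)))
    (hb : b ∈ Ideal.span (Set.range (gen k n s))) : ∃ u, a * b = gen k n s 0 ^ 2 * u := by
  have hle : Ideal.span (Set.range (gen k n s)) * Ideal.span (Set.range (gen k n s)) ≤
      Ideal.span {gen k n s 0 ^ 2} := by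
    rw [Ideal.span_mul_span', Ideal.span_le]
    rintro _ ⟨_, ⟨i, rfl⟩, _, ⟨j, rfl⟩, rfl⟩
    change gen k n s i * gen k n s j ∈ _
    rw [SetLike.mem_coe, Ideal.mem_span_singleton]
    by_cases hij : i = j
    · subst hij
      by_cases hi : i = 0
      · rw [hi, sq]
      · have : 2 ≤ s := h.resolve_right fun h1 => hi (by subst h1; exact Subsingleton.elim _ _)
        rw [gen_sq hi]
        exact pow_dvd_pow _ this
    · rw [gen_mul_gen_of_ne hij]
      exact dvd_zero _
  obtain ⟨u, hu⟩ := Ideal.mem_span_singleton.mp (hle (Ideal.mul_mem_mul ha hb))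
  exact ⟨u, hu⟩

lemma isLocalModel_A {n s : ℕ} [NeZero n] (hs : 0 < s) (h : 2 ≤ s ∨ n = 1) :
    IsLocalModel k (A k n (n + s)) (n + s) s where
  isLocalRing := (isLocalRing_A hs).1
  finrank_eq := finrank_A hs
  isFrobenius := isFrobenius_A hs
  exists_pow_ne_zero := ⟨gen k n s 0, ⟨s + 1, gen_zero_pow⟩, gen_zero_pow_ne_zero hs⟩
  pow_eq_zero a ha := by
    obtain ⟨_, hm⟩ := isLocalRing_A (k := k) (n := n) hs
    have := finite_A (k := k) (n := n) hs
    rw [isNilpotent_iff_mem_maximalIdeal k, hm] at ha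
    have h0 : gen k n s 0 ∈ Ideal.span (Set.range (gen k n s)) := Ideal.subset_span ⟨0, rfl⟩
    -- Exchanging factors one at a time, a^j is a multiple of x_0^j for j ≥ 2; at j = s + 1 this
    -- vanishes.
    have key : ∀ i, ∃ u, a ^ (i + 2) = gen k n s 0 ^ (i + 2) * u := by
      intro i
      induction i with
      | zero =>
        obtain ⟨u, hu⟩ := sq_mem_of_mem_span_gen h ha ha
        exact ⟨u, by rw [zero_add, sq, hu]⟩
      | succ i ih =>
        obtain ⟨u, hu⟩ := ih
        obtain ⟨w, hw⟩ := sq_mem_of_mem_span_gen h ha h0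
        refine ⟨w * u, ?_⟩
        calc a ^ (i + 1 + 2) = (a * gen k n s 0) * gen k n s 0 ^ (i + 1) * u := by
              rw [show i + 1 + 2 = (i + 2) + 1 by ring, pow_succ, hu]
              ring
          _ = _ := by
              rw [hw]
              ring
    obtain ⟨i, rfl⟩ := Nat.exists_eq_add_of_le' (Nat.succ_le_iff.mpr hs)
    obtain ⟨u, hu⟩ := key i
    rw [show i + 1 + 1 = i + 2 by ring, hu]
    have := gen_zero_pow (k := k) (n := n) (s := i + 1)
    rw [show i + 1 + 1 = i + 2 by ring] at this
    rw [this, zero_mul]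

/-- With x = x_1 and y = x_2, the relations x³ = 0, xy² = 0 and y³ = εx²y give (x + y)³ = (3 +
ε)x²y. For ε = 0, 1 the factor is 3 or 4, so both excluded characteristics matter. -/
lemma IsSpecial.isLocalModel {I : Ideal (MvPolynomial (Fin 2) k)} {ε : k} (h : IsSpecial I ε)
    (hε : 3 + ε ≠ 0) : IsLocalModel k (MvPolynomial (Fin 2) k ⧸ I) 6 3 where
  isLocalRing := h.isLocalRing.1
  finrank_eq := h.finrank_eq
  isFrobenius := h.isFrobenius
  exists_pow_ne_zero := by
    obtain ⟨_, hm⟩ := h.isLocalRing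
    have := h.finite
    refine ⟨mon I 1 0 + mon I 0 1, ?_, ?_⟩
    · rw [isNilpotent_iff_mem_maximalIdeal k, hm]
      exact add_mem (Ideal.subset_span (by simp)) (Ideal.subset_span (by simp))
    · have h2 : mon I 1 0 * mon I 0 1 ^ 2 = 0 := by
        have h12 := mon_add_two h.sq 1 0
        rw [mon_eq_zero h.cube (a := 1 + 2) (by norm_num), smul_zero] at h12
        rw [← h12, mon_eq 1 (0 + 2), pow_one]
      have h3 : mon I 0 1 ^ 3 = ε • mon I 2 1 := by
        have h03 := mon_add_two h.sq 0 1
        refine Eq.trans ?_ h03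
        rw [mon_eq 0 (1 + 2), pow_zero, one_mul]
      have hx : mon I 1 0 ^ 3 = 0 := by
        rw [← h.cube, mon_eq 3 0, pow_zero, mul_one]
      have : (mon I 1 0 + mon I 0 1) ^ 3 = (3 + ε) • mon I 2 1 := by
        rw [add_smul, ← h3, mon_eq 2 1, pow_one, quotient_smul_def, map_ofNat]
        linear_combination hx + 3 * h2
      rw [this]
      exact smul_ne_zero hε h.top_ne_zero
  pow_eq_zero a ha := by
    obtain ⟨_, hm⟩ := h.isLocalRing
    have := h.finite
    rw [isNilpotent_iff_mem_maximalIdeal k, hm] at ha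
    obtain ⟨p, q, rfl⟩ := Ideal.mem_span_pair.mp ha
    have hx : mon I 1 0 ^ 3 = 0 := by
      rw [← h.cube, mon_eq 3 0, pow_zero, mul_one]
    have hy : mon I 0 1 ^ 2 = algebraMap k _ ε * mon I 1 0 ^ 2 := by
      have := h.sq
      rw [mon_eq 0 2, mon_eq 2 0, pow_zero, one_mul, pow_zero, mul_one, quotient_smul_def] at this
      exact this
    generalize mon I 1 0 = x at *
    generalize mon I 0 1 = y at *
    generalize algebraMap k (MvPolynomial (Fin 2) k ⧸ I) ε = e at *
    linear_combination (p ^ 4 * x + 4 * p ^ 3 * q * y + 6 * p ^ 2 * q ^ 2 * e * x +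
        4 * p * q ^ 3 * e * y + q ^ 4 * e ^ 2 * x) * hx +
      (6 * p ^ 2 * q ^ 2 * x ^ 2 + 4 * p * q ^ 3 * x * y + q ^ 4 * y ^ 2 + q ^ 4 * e * x ^ 2) * hy

theorem isLocalModel_localModel (h3 : (3 : k) ≠ 0) (h2 : (2 : k) ≠ 0) (t : Fin 14) :
    IsLocalModel k (localModel k t) (localDim t) (localExp t) := by
  have h4 : (3 : k) + 1 ≠ 0 := by
    rw [show (3 : k) + 1 = 2 * 2 by norm_num]
    exact mul_ne_zero h2 h2
  fin_cases t
  · exact isLocalModel_self k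
  · exact isLocalModel_A (n := 1) (s := 1) (by norm_num) (by norm_num)
  · exact isLocalModel_A (n := 1) (s := 2) (by norm_num) (by norm_num)
  · exact isLocalModel_A (n := 1) (s := 3) (by norm_num) (by norm_num)
  · exact isLocalModel_A (n := 2) (s := 2) (by norm_num) (by norm_num)
  · exact isLocalModel_A (n := 1) (s := 4) (by norm_num) (by norm_num)
  · exact isLocalModel_A (n := 2) (s := 3) (by norm_num) (by norm_num)
  · exact isLocalModel_A (n := 3) (s := 2) (by norm_num) (by norm_num)
  · exact isLocalModel_A (n := 1) (s := 5) (by norm_num) (by norm_num)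
  · exact isLocalModel_A (n := 2) (s := 4) (by norm_num) (by norm_num)
  · exact isLocalModel_A (n := 3) (s := 3) (by norm_num) (by norm_num)
  · exact isLocalModel_A (n := 4) (s := 2) (by norm_num) (by norm_num)
  · exact isSpecial_ideal₁sp.isLocalModel (by rwa [add_zero])
  · exact isSpecial_ideal₂sp.isLocalModel h4

/-- Some element whose square is not zero is killed by all products of two nilpotent elements. -/
def HasSquare (L : Type*) [CommRing L] : Prop :=
  ∃ y : L, (∀ a b, IsNilpotent a → IsNilpotent b → y * a * b = 0) ∧ y * y ≠ 0

lemma HasSquare.map {L M : Type*} [CommRing L] [CommRing M] (f : L ≃+* M) (h : HasSquare L) :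
    HasSquare M := by
  obtain ⟨y, hy, hyy⟩ := h
  refine ⟨f y, fun a b ha hb => ?_, fun h => hyy ?_⟩
  · apply f.symm.injective
    rw [map_mul, map_mul, f.symm_apply_apply, map_zero]
    exact hy _ _ (ha.map f.symm) (hb.map f.symm)
  · apply f.injective
    rw [map_mul, h, map_zero]

/-- Some element of square zero is not killed by some product of two nilpotent elements. -/
def HasNull (L : Type*) [CommRing L] : Prop :=
  ∃ y : L, y * y = 0 ∧ ∃ a b, IsNilpotent a ∧ IsNilpotent b ∧ y * a * b ≠ 0

lemma HasNull.map {L M : Type*} [CommRing L] [CommRing M] (f : L ≃+* M) (h : HasNull L) :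
    HasNull M := by
  obtain ⟨y, hy, a, b, ha, hb, hab⟩ := h
  refine ⟨f y, by rw [← map_mul, hy, map_zero], f a, f b, ha.map f, hb.map f, fun h => hab ?_⟩
  apply f.injective
  rw [map_mul, map_mul, h, map_zero]

/-- The second generator is orthogonal to the first, whose square divides every product of two
nilpotents; its own square is the nonzero socle element. -/
lemma hasSquare_A : HasSquare (A k 3 6) := by
  obtain ⟨_, hm⟩ := isLocalRing_A (k := k) (n := 3) (s := 3) (by norm_num)
  have := finite_A (k := k) (n := 3) (s := 3) (by norm_num)
  refine ⟨gen k 3 3 1, fun a b ha hb => ?_, ?_⟩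
  · have ha' := (isNilpotent_iff_mem_maximalIdeal (L := A k 3 (3 + 3)) k).mp ha
    have hb' := (isNilpotent_iff_mem_maximalIdeal (L := A k 3 (3 + 3)) k).mp hb
    rw [hm] at ha' hb'
    obtain ⟨u, hu⟩ := sq_mem_of_mem_span_gen (n := 3) (s := 3) (by norm_num) ha' hb'
    have h0 : gen k 3 3 1 * gen k 3 3 0 = 0 := gen_mul_gen_of_ne (by decide)
    exact (mul_assoc (gen k 3 3 1) a b).trans (by rw [hu]; linear_combination gen k 3 3 0 * u * h0)
  · exact fun h => gen_zero_pow_ne_zero (k := k) (n := 3) (s := 3) (by norm_num)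
      ((gen_sq (by decide)).symm.trans h)

lemma IsSpecial.not_hasSquare {I : Ideal (MvPolynomial (Fin 2) k)} {ε : k} (h : IsSpecial I ε) :
    ¬ HasSquare (MvPolynomial (Fin 2) k ⧸ I) := by
  rintro ⟨y, hy, hyy⟩
  exact hyy (h.sq_eq_zero_of_forall y hy)

lemma hasNull_A₁sp : HasNull (A₁sp k) := by
  have h := isSpecial_ideal₁sp (k := k)
  have hx : IsNilpotent (mon (ideal₁sp k) 1 0) := by
    refine ⟨3, ?_⟩
    rw [← h.cube, mon_eq 3 0, pow_zero, mul_one]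
  refine ⟨mon (ideal₁sp k) 0 1, ?_, mon (ideal₁sp k) 1 0, mon (ideal₁sp k) 1 0, hx, hx, ?_⟩
  · rw [mon_mul_mon]
    exact h.sq.trans (zero_smul _ _)
  · rw [mon_mul_mon, mon_mul_mon]
    exact h.top_ne_zero

/-- Let y² = 0. Then y has no constant term; let αX + βY be its linear part. Multiplying y² by X and
by Y gives 2αβ = 0 and α² + β² = 0, so α = β = 0. Thus y lies in the square of the maximal ideal and
is killed by all products of two nilpotents. -/
lemma not_hasNull_A₂sp (h2 : (2 : k) ≠ 0) : ¬ HasNull (A₂sp k) := by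
  rintro ⟨y, hyy, a, b, ha, hb, hab⟩
  have h := isSpecial_ideal₂sp (k := k)
  obtain ⟨_, hm⟩ := h.isLocalRing
  have := h.finite
  have ha' := (isNilpotent_iff_mem_maximalIdeal (L := A₂sp k) k).mp ha
  have hb' := (isNilpotent_iff_mem_maximalIdeal (L := A₂sp k) k).mp hb
  rw [hm] at ha' hb'
  obtain ⟨a₁, a₂, rfl⟩ := Ideal.mem_span_pair.mp ha'
  obtain ⟨b₁, b₂, rfl⟩ := Ideal.mem_span_pair.mp hb'
  obtain ⟨c, -, hc⟩ := h.exists_eq y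
  have htop := h.top_ne_zero
  rw [mon_eq 2 0, mon_eq 1 1, mon_eq 2 1] at hc
  rw [mon_eq 2 1] at htop
  simp only [pow_zero, pow_one, mul_one, quotient_smul_def] at hc htop
  have hx : mon (ideal₂sp k) 1 0 ^ 3 = 0 := by
    rw [← h.cube, mon_eq 3 0, pow_zero, mul_one]
  have hsq : mon (ideal₂sp k) 0 1 ^ 2 = mon (ideal₂sp k) 1 0 ^ 2 := by
    have := h.sq
    rwa [mon_eq 0 2, mon_eq 2 0, pow_zero, one_mul, pow_zero, mul_one, one_smul] at this
  generalize mon (ideal₂sp k) 1 0 = X at *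
  generalize mon (ideal₂sp k) 0 1 = Y at *
  have key : ∀ r : k, algebraMap k (A₂sp k) r * (X ^ 2 * Y) = 0 → r = 0 := fun r hr => by
    rw [← Algebra.smul_def] at hr
    exact (smul_eq_zero.mp hr).resolve_right htop
  have hXY : X * Y ^ 2 = 0 := by linear_combination X * hsq + hx
  set φ := algebraMap k (A₂sp k)
  set p := φ (c 1 0) + φ (c 2 0) * X + φ (c 1 1) * Y + φ (c 2 1) * X * Y with hp
  have hy : y = φ (c 0 0) + X * p + Y * φ (c 0 1) := by
    rw [hc]
    ring
  have h1 : X ^ 2 * Y * y = φ (c 0 0) * (X ^ 2 * Y) := by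
    rw [hy]
    linear_combination Y * p * hx + X * φ (c 0 1) * hXY
  have h00 : c 0 0 = 0 := by
    have : φ (c 0 0 * c 0 0) * (X ^ 2 * Y) = 0 := by
      rw [map_mul]
      linear_combination X ^ 2 * Y * hyy - (y + φ (c 0 0)) * h1
    simpa using key _ this
  rw [h00, map_zero, zero_add] at hy
  have h2p : X ^ 2 * Y * p = φ (c 1 0) * (X ^ 2 * Y) := by
    rw [hp]
    linear_combination (φ (c 2 0) * Y + φ (c 2 1) * Y ^ 2) * hx + φ (c 1 1) * X * hXY
  have h3 : c 1 0 * c 0 1 = 0 := by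
    have : φ (2 * (c 1 0 * c 0 1)) * (X ^ 2 * Y) = 0 := by
      rw [hy] at hyy
      rw [map_mul, map_mul, map_ofNat]
      linear_combination X * hyy - p ^ 2 * hx - φ (c 0 1) ^ 2 * hXY - 2 * φ (c 0 1) * h2p
    exact (mul_eq_zero.mp (key _ this)).resolve_left h2
  have h4 : c 1 0 * c 1 0 + c 0 1 * c 0 1 = 0 := by
    refine key _ ?_
    rw [hy] at hyy
    rw [map_add, map_mul, map_mul]
    linear_combination Y * hyy - (p + φ (c 1 0)) * h2p - 2 * p * φ (c 0 1) * hXY -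
      φ (c 0 1) ^ 2 * Y * hsq
  have h5 : c 1 0 = 0 ∧ c 0 1 = 0 := by
    rcases mul_eq_zero.mp h3 with h | h
    · exact ⟨h, by simpa [h] using h4⟩
    · exact ⟨by simpa [h] using h4, h⟩
  refine hab ?_
  rw [hy, hp, h5.1, h5.2, map_zero]
  linear_combination
    (φ (c 2 0) * a₁ * b₁ * X + Y * (φ (c 2 0) * a₁ * b₂ + φ (c 2 0) * a₂ * b₁ +
      (φ (c 1 1) + φ (c 2 1) * X) * a₁ * b₁)) * hx +
    (X * (φ (c 2 0) * a₂ * b₂ + (φ (c 1 1) + φ (c 2 1) * X) * a₁ * b₂ +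
      (φ (c 1 1) + φ (c 2 1) * X) * a₂ * b₁) + Y * (φ (c 1 1) + φ (c 2 1) * X) * a₂ * b₂) * hXY

/-- The local models are pairwise not isomorphic. -/
theorem eq_of_localModel_algEquiv (h3 : (3 : k) ≠ 0) (h2 : (2 : k) ≠ 0) {t t' : Fin 14}
    (f : localModel k t ≃ₐ[k] localModel k t') : t = t' := by
  have hd : localDim t = localDim t' := by
    rw [← (isLocalModel_localModel h3 h2 t).finrank_eq,
      ← (isLocalModel_localModel h3 h2 t').finrank_eq]
    exact f.toLinearEquiv.finrank_eq
  have hle : ∀ {t t' : Fin 14} (f : localModel k t ≃ₐ[k] localModel k t'),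
      localExp t ≤ localExp t' := by
    intro t t' f
    by_contra! hlt
    obtain ⟨a, ha, ha0⟩ := (isLocalModel_localModel h3 h2 t).exists_pow_ne_zero
    have h0 := (isLocalModel_localModel h3 h2 t').pow_eq_zero (f a) (ha.map f)
    rw [← map_pow, map_eq_zero_iff f f.injective] at h0
    exact ha0 (pow_eq_zero_of_le hlt h0)
  have hs : localExp t = localExp t' := le_antisymm (hle f) (hle f.symm)
  -- Dimension and exponent leave only A_{3,6} (index 10) and the two special algebras (indices 12
  -- and 13) to be separated.
  have hcases : ∀ t t' : Fin 14, localDim t = localDim t' → localExp t = localExp t' → t ≠ t' →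
      (t = 10 ∧ (t' = 12 ∨ t' = 13)) ∨ (t' = 10 ∧ (t = 12 ∨ t = 13)) ∨
        (t = 12 ∧ t' = 13) ∨ (t = 13 ∧ t' = 12) := by decide
  by_contra hne
  have h1 := (isSpecial_ideal₁sp (k := k)).not_hasSquare
  have h2' := (isSpecial_ideal₂sp (k := k)).not_hasSquare
  have h0 := hasSquare_A (k := k)
  rcases hcases t t' hd hs hne with ⟨rfl, rfl | rfl⟩ | ⟨rfl, rfl | rfl⟩ | ⟨rfl, rfl⟩ | ⟨rfl, rfl⟩
  · exact h1 (h0.map f.toRingEquiv)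
  · exact h2' (h0.map f.toRingEquiv)
  · exact h1 (h0.map f.symm.toRingEquiv)
  · exact h2' (h0.map f.symm.toRingEquiv)
  · exact not_hasNull_A₂sp h2 (hasNull_A₁sp.map f.toRingEquiv)
  · exact not_hasNull_A₂sp h2 (hasNull_A₁sp.map f.symm.toRingEquiv)

end

end AGor
end

noncomputable section
namespace AGor
open IsLocalRing
attribute [local instance] quotientModule

/-! ### Classification of the local algebras -/

section

variable {k : Type u} [Field k]

lemma le_span_sup {V : Type*} [AddCommGroup V] [Module k V] [Module.Finite k V]
    {N M : Submodule k V} (hNM : N ≤ M) {a : V} (ha : a ∈ M) (haN : a ∉ N)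
    (h : Module.finrank k M ≤ Module.finrank k N + 1) : M ≤ Submodule.span k {a} ⊔ N := by
  have hle : Submodule.span k {a} ⊔ N ≤ M :=
    sup_le ((Submodule.span_singleton_le_iff_mem _ _).mpr ha) hNM
  have hlt : N < Submodule.span k {a} ⊔ N := lt_of_le_of_ne le_sup_right fun heq =>
    haN (heq ▸ Submodule.mem_sup_left (Submodule.mem_span_singleton_self a))
  have := Submodule.finrank_lt_finrank_of_lt hlt
  exact (Submodule.eq_of_le_of_finrank_le hle (by omega)).ge

lemma mem_span_singleton_sup_iff {V : Type*} [AddCommGroup V] [Module k V]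
    {N : Submodule k V} {a b : V} :
    b ∈ Submodule.span k {a} ⊔ N ↔ ∃ c : k, ∃ n ∈ N, b = c • a + n := by
  rw [Submodule.mem_sup]
  constructor
  · rintro ⟨y, hy, n, hn, rfl⟩
    obtain ⟨c, rfl⟩ := Submodule.mem_span_singleton.mp hy
    exact ⟨c, n, hn, rfl⟩
  · rintro ⟨c, n, hn, rfl⟩
    exact ⟨_, Submodule.smul_mem _ _ (Submodule.mem_span_singleton_self a), n, hn, rfl⟩

variable [IsAlgClosed k]

/-- Recognition of the algebras `A_{n,d}`. -/
lemma nonempty_algEquiv_A {L : Type*} [CommRing L] [Algebra k L] {x : L} {r s : ℕ} (y : Fin r → L)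
    (hs : 0 < s) (hxy : ∀ j, x * y j = 0) (hyy : ∀ i j, i ≠ j → y i * y j = 0)
    (hy : ∀ j, y j * y j = x ^ s) (hx : x ^ (s + 1) = 0) (hx0 : x ^ s ≠ 0)
    (hspan : ∀ l, ∃ c : k, ∃ p ∈ Submodule.span k (Set.range y), ∃ l',
      l = algebraMap k L c + p + x * l') : Nonempty (L ≃ₐ[k] A k (r + 1) (r + 1 + s)) := by
  obtain ⟨f, hf⟩ := exists_algHom_A (k := k) (n := r + 1) (s := s) (Fin.cons x y)
    (fun i j => by
      refine Fin.cases ?_ (fun i => ?_) i <;> refine Fin.cases ?_ (fun j => ?_) j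
      · exact fun h => (h rfl).elim
      · exact fun _ => hxy j
      · exact fun _ => (mul_comm _ _).trans (hxy i)
      · exact fun h => hyy i j fun h' => h (congrArg _ h'))
    (fun j => Fin.cases (fun h => (h rfl).elim) (fun j _ => hy j) j) (by simpa using hx)
  have hfx : f (gen k (r + 1) s 0) = x := hf 0
  have hfy : ∀ j : Fin r, f (gen k (r + 1) s j.succ) = y j := fun j => hf j.succ
  obtain ⟨_, _⟩ := isLocalRing_A (k := k) (n := r + 1) hs
  have := finite_A (k := k) (n := r + 1) hs
  have hinj : Function.Injective f := (isFrobenius_A hs).injective_of_socle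
    (mul_gen_zero_pow hs) f (by rwa [map_pow, hfx])
  have hy' : ∀ p ∈ Submodule.span k (Set.range y), p ∈ f.range := by
    intro p hp
    have hle : Submodule.span k (Set.range y) ≤ Subalgebra.toSubmodule f.range := by
      rw [Submodule.span_le]
      rintro _ ⟨j, rfl⟩
      exact ⟨_, hfy j⟩
    exact hle hp
  -- Iterating `hspan` N times pushes the part outside the image into x^N L, which is zero for N = s
  -- + 1.
  have key : ∀ N l, ∃ t ∈ f.range, ∃ l', l = t + x ^ N * l' := by
    intro N
    induction N with
    | zero => exact fun l => ⟨0, zero_mem _, l, by simp⟩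
    | succ N ih =>
      intro l
      obtain ⟨t, ht, l', hl⟩ := ih l
      obtain ⟨c, p, hp, l'', hl'⟩ := hspan l'
      have hxr : x ∈ f.range := ⟨_, hfx⟩
      refine ⟨t + x ^ N * (algebraMap k L c + p), add_mem ht (mul_mem (pow_mem hxr N)
        (add_mem (f.range.algebraMap_mem c) (hy' p hp))), l'', ?_⟩
      rw [hl, hl']
      ring
  have hsurj : Function.Surjective f := fun l => by
    obtain ⟨t, ht, l', hl⟩ := key (s + 1) l
    rw [hx, zero_mul, add_zero] at hl
    rw [hl]
    exact ht
  exact ⟨(AlgEquiv.ofBijective f ⟨hinj, hsurj⟩).symm⟩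

variable {L : Type v} [CommRing L] [Algebra k L] [IsLocalRing L] [Module.Finite k L]

/-- Let K be the annihilator of x. As xa ∈ x²L for a in the maximal ideal, that ideal is K + xL.
Products of two elements of K lie in the socle, the line spanned by the last nonzero power x^s, so
multiplication on K is a symmetric bilinear form. An orthogonal basis exists as 2 ≠ 0; its
non-isotropic vectors, rescaled to have square x^s, are the remaining generators. -/
lemma exists_algEquiv_A_of_sq_le (h2 : (2 : k) ≠ 0) (hF : IsFrobenius k L) {x : L}
    (hx2 : x ^ 2 ≠ 0) (hxm : x ∈ maximalIdeal L)
    (hm : ∀ a ∈ maximalIdeal L, ∀ b ∈ maximalIdeal L, ∃ c, a * b = x ^ 2 * c) :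
    ∃ r s, 2 ≤ s ∧ Nonempty (L ≃ₐ[k] A k (r + 1) (r + 1 + s)) := by
  classical
  obtain ⟨s, hs, hs0⟩ : ∃ s, x ^ (s + 1) = 0 ∧ x ^ s ≠ 0 := by
    have hnil : ∃ N, x ^ N = 0 := (isNilpotent_iff_mem_maximalIdeal k).mpr hxm
    obtain ⟨s, hs⟩ := Nat.exists_eq_succ_of_ne_zero (n := Nat.find hnil) fun h => by
      have := Nat.find_spec hnil
      rw [h, pow_zero] at this
      exact one_ne_zero this
    exact ⟨s, by rw [← Nat.succ_eq_add_one, ← hs]; exact Nat.find_spec hnil,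
      Nat.find_min hnil (by omega)⟩
  have hs2 : 2 ≤ s := by
    by_contra! h
    exact hx2 (pow_eq_zero_of_le (by omega) hs)
  obtain ⟨s', rfl⟩ := Nat.exists_eq_add_of_le' (show 1 ≤ s by omega)
  let K : Submodule k L := LinearMap.ker (LinearMap.mulLeft k x)
  have hK : ∀ {a}, a ∈ K ↔ x * a = 0 := LinearMap.mem_ker
  have hKm : ∀ a ∈ K, a ∈ maximalIdeal L := fun a ha hu => by
    have : x = 0 := hu.mul_left_eq_zero.mp (hK.mp ha)
    exact hx2 (by rw [this, zero_pow two_ne_zero])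
  have hdec : ∀ a ∈ maximalIdeal L, ∃ b ∈ K, ∃ l, a = b + x * l := fun a ha => by
    obtain ⟨l, hl⟩ := hm x hxm a ha
    refine ⟨a - x * l, hK.mpr ?_, l, by ring⟩
    rw [mul_sub, hl]
    ring
  have hsoc : ∀ e, x * e = 0 → (∀ b ∈ K, b * e = 0) → ∀ r ∈ maximalIdeal L, r * e = 0 := by
    intro e he he' r hr
    obtain ⟨b, hb, l, rfl⟩ := hdec r hr
    rw [add_mul, he' b hb, zero_add, mul_right_comm, he, zero_mul]
  have hes : ∀ r ∈ maximalIdeal L, r * x ^ (s' + 1) = 0 := by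
    refine hsoc _ (by rw [← pow_succ', hs]) fun b hb => ?_
    rw [pow_succ', ← mul_assoc, mul_comm b, hK.mp hb, zero_mul]
  have hKK : ∀ a ∈ K, ∀ b ∈ K, ∀ r ∈ maximalIdeal L, r * (a * b) = 0 := by
    intro a ha b hb
    refine hsoc _ (by rw [← mul_assoc, hK.mp ha, zero_mul]) fun c hc => ?_
    obtain ⟨d, hd⟩ := hm b (hKm b hb) c (hKm c hc)
    linear_combination a * hd + x * d * hK.mp ha
  obtain ⟨μ, hμ⟩ := id hF
  have hμe := apply_ne_zero_of_mem_socle hμ hes hs0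
  let β : LinearMap.BilinForm k K :=
    ((LinearMap.mul k L).domRestrict₁₂ K K).compr₂ ((μ (x ^ (s' + 1)))⁻¹ • μ)
  have hβ : ∀ a b : K, β a b = (μ (x ^ (s' + 1)))⁻¹ * μ ((a : L) * b) := fun a b => rfl
  have hβ' : ∀ a b : K, (a : L) * b = β a b • x ^ (s' + 1) := fun a b => by
    obtain ⟨c, hc⟩ := hF.exists_smul_of_mem_socle (hKK a a.2 b b.2) hes hs0
    rw [hβ, hc, map_smul, smul_eq_mul, mul_comm c, inv_mul_cancel_left₀ hμe]
  have hsymm : LinearMap.IsSymm β := ⟨fun a b => by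
    rw [RingHom.id_apply, hβ, hβ, mul_comm (a : L)]⟩
  have : Invertible (2 : k) := invertibleOfNonzero h2
  obtain ⟨v, hv⟩ := LinearMap.BilinForm.exists_orthogonal_basis hsymm
  have hv' : ∀ i j, i ≠ j → β (v i) (v j) = 0 := fun i j hij => hv hij
  let J := {i // β (v i) (v i) ≠ 0}
  let ε : Fin (Fintype.card J) ≃ J := (Fintype.equivFin J).symm
  choose z hz using fun j : J => IsAlgClosed.exists_eq_mul_self (β (v j) (v j))
  have hz0 : ∀ j, z j ≠ 0 := fun j h => j.2 (by rw [hz, h, zero_mul])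
  let y : Fin (Fintype.card J) → L := fun j => (z (ε j))⁻¹ • (v (ε j) : L)
  have hyS : ∀ i, (v i : L) ∈
      Submodule.span k (Set.range y) ⊔ (Ideal.span {x}).restrictScalars k := by
    intro i
    -- An isotropic vector of an orthogonal basis is orthogonal to all of K, hence lies in the
    -- socle, which is contained in xL; it can be dropped.
    by_cases hi : β (v i) (v i) = 0
    · refine Submodule.mem_sup_right ?_
      have h0 : ∀ b ∈ K, b * (v i : L) = 0 := fun b hb => by
        have h1 : β (v i) ⟨b, hb⟩ = 0 := by
          rw [← v.sum_repr ⟨b, hb⟩, map_sum]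
          refine Finset.sum_eq_zero fun j _ => ?_
          rw [map_smul]
          by_cases hij : i = j
          · rw [← hij, hi, smul_zero]
          · rw [hv' i j hij, smul_zero]
        rw [mul_comm]
        exact (hβ' (v i) ⟨b, hb⟩).trans (by rw [h1, zero_smul])
      obtain ⟨c, hc⟩ := hF.exists_smul_of_mem_socle
        (hsoc (v i) (hK.mp (v i).2) h0) hes hs0
      change (v i : L) ∈ Ideal.span {x}
      rw [hc, Ideal.mem_span_singleton]
      exact (Dvd.intro _ (pow_succ' x s').symm).trans ⟨algebraMap k L c, by
        rw [Algebra.smul_def, mul_comm]⟩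
    · refine Submodule.mem_sup_left ?_
      have : (v i : L) = z ⟨i, hi⟩ • y (ε.symm ⟨i, hi⟩) := by
        simp only [y, Equiv.apply_symm_apply, smul_smul]
        rw [mul_inv_cancel₀ (hz0 _), one_smul]
      rw [this]
      exact Submodule.smul_mem _ _ (Submodule.subset_span ⟨_, rfl⟩)
  have hKS : ∀ b ∈ K, b ∈
      Submodule.span k (Set.range y) ⊔ (Ideal.span {x}).restrictScalars k := fun b hb => by
    have := congrArg Subtype.val (v.sum_repr ⟨b, hb⟩)
    rw [← show ((⟨b, hb⟩ : K) : L) = b from rfl, ← this, Submodule.coe_sum]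
    exact Submodule.sum_mem _ fun i _ => Submodule.smul_mem _ _ (hyS i)
  refine ⟨_, s' + 1, hs2, nonempty_algEquiv_A y (by omega) (fun j => ?_) (fun i j hij => ?_)
    (fun j => ?_) hs hs0 fun l => ?_⟩
  · rw [mul_smul_comm, hK.mp (v (ε j)).2, smul_zero]
  · have : (ε i).1 ≠ (ε j).1 := fun h => hij (ε.injective (Subtype.ext h))
    rw [smul_mul_smul_comm, hβ', hv' _ _ this, zero_smul, smul_zero]
  · rw [smul_mul_smul_comm, hβ', hz, smul_smul]
    have : (z (ε j))⁻¹ * (z (ε j))⁻¹ * (z (ε j) * z (ε j)) = 1 := by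
      field_simp [hz0 (ε j)]
    rw [this, one_smul]
  · obtain ⟨c, hc⟩ := exists_sub_algebraMap_mem (k := k) l
    obtain ⟨b, hb, l₁, hl⟩ := hdec _ hc
    obtain ⟨p, hp, q, hq, hpq⟩ := Submodule.mem_sup.mp (hKS b hb)
    obtain ⟨l₂, rfl⟩ := Ideal.mem_span_singleton.mp hq
    refine ⟨c, p, hp, l₁ + l₂, ?_⟩
    rw [sub_eq_iff_eq_add.mp hl, ← hpq]
    ring

end

end AGor
end

noncomputable section
namespace AGor
open IsLocalRing
attribute [local instance] quotientModule

/-! ### Powers of the maximal ideal -/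

section

variable {k : Type u} [Field k] {L : Type v} [CommRing L] [Algebra k L] [IsLocalRing L]

/-- The powers of the maximal ideal, as vector spaces. -/
def mpow (k : Type u) [Field k] (L : Type v) [CommRing L] [Algebra k L] [IsLocalRing L] (i : ℕ) :
    Submodule k L :=
  (maximalIdeal L ^ i).restrictScalars k

lemma mem_mpow {i : ℕ} {a : L} : a ∈ mpow k L i ↔ a ∈ maximalIdeal L ^ i := Iff.rfl

lemma mem_mpow_one {a : L} : a ∈ mpow k L 1 ↔ a ∈ maximalIdeal L := by
  rw [mem_mpow, pow_one]

lemma mul_mem_mpow {i j : ℕ} {a b : L} (ha : a ∈ mpow k L i) (hb : b ∈ mpow k L j) :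
    a * b ∈ mpow k L (i + j) := by
  rw [mem_mpow, pow_add]
  exact Ideal.mul_mem_mul ha hb

lemma mpow_mono {i j : ℕ} (h : i ≤ j) : mpow k L j ≤ mpow k L i :=
  fun _ ha => Ideal.pow_le_pow_right h ha

/-- A subspace contains the square of the maximal ideal if it contains the products. -/
lemma mpow_two_le {W : Submodule k L} (h : ∀ a ∈ mpow k L 1, ∀ b ∈ mpow k L 1, a * b ∈ W) :
    mpow k L 2 ≤ W := by
  intro q hq
  rw [mem_mpow, pow_two] at hq
  exact Submodule.mul_induction_on hq
    (fun a ha b hb => h a (mem_mpow_one.mpr ha) b (mem_mpow_one.mpr hb)) fun _ _ => W.add_mem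

lemma eq_zero_of_mpow_eq_bot {i : ℕ} (h : mpow k L i = ⊥) {j : ℕ} (hij : i ≤ j) {a : L}
    (ha : a ∈ mpow k L j) : a = 0 := by
  have := mpow_mono hij ha
  rwa [h, Submodule.mem_bot] at this

lemma mul_eq_zero_of_mem_mpow {i : ℕ} (h : mpow k L (i + 1) = ⊥) {a : L} (ha : a ∈ mpow k L i) :
    ∀ r ∈ maximalIdeal L, r * a = 0 := fun r hr => by
  refine eq_zero_of_mpow_eq_bot h le_rfl ?_
  rw [mul_comm]
  exact mul_mem_mpow ha (mem_mpow_one.mpr hr)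

variable [Module.Finite k L]

lemma mpow_eq_bot_of_le {i : ℕ} (h : mpow k L i ≤ mpow k L (i + 1)) : mpow k L i = ⊥ := by
  obtain ⟨N, hN⟩ := maximalIdeal_pow_eq_bot k L
  have key : ∀ j, maximalIdeal L ^ i ≤ maximalIdeal L ^ (i + j) := by
    intro j
    induction j with
    | zero => exact le_rfl
    | succ j ih =>
      refine le_trans (show maximalIdeal L ^ i ≤ maximalIdeal L ^ (i + 1) from h) ?_
      rw [pow_succ, ← add_assoc, pow_succ]
      exact Ideal.mul_mono_left ih
  rw [eq_bot_iff]
  intro a ha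
  have := Ideal.pow_le_pow_right (show N ≤ i + N by omega) (key N ha)
  rwa [hN] at this

/-- Nakayama: a generator of m^i modulo m^{i+1} generates m^i. -/
lemma maximalIdeal_pow_le_of_le_sup {i : ℕ} {x : L}
    (h : mpow k L i ≤ Submodule.span k {x} ⊔ mpow k L (i + 1)) :
    maximalIdeal L ^ i ≤ Ideal.span {x} := by
  have : IsNoetherianRing L := IsNoetherianRing.of_finite k L
  refine Submodule.le_of_le_smul_of_le_jacobson_bot (I := maximalIdeal L)
    (IsNoetherian.noetherian _) (maximalIdeal_le_jacobson ⊥) fun a ha => ?_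
  obtain ⟨c, n, hn, rfl⟩ := mem_span_singleton_sup_iff.mp (h ha)
  refine Submodule.add_mem_sup ?_ ?_
  · rw [Algebra.smul_def]
    exact Ideal.mul_mem_left _ _ (Ideal.mem_span_singleton_self x)
  · rw [smul_eq_mul, ← pow_succ']
    exact hn

/-- By polarization, 2ab = (a + b)² − a² − b², so if all squares were in m³ then m² = m³ and m²
would vanish. -/
lemma exists_sq_notMem (h2 : (2 : k) ≠ 0) (hm2 : mpow k L 2 ≠ ⊥) :
    ∃ x ∈ mpow k L 1, x ^ 2 ∉ mpow k L 3 := by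
  by_contra! h
  refine hm2 (mpow_eq_bot_of_le (mpow_two_le fun a ha b hb => ?_))
  have h1 : (2 : k) • (a * b) = (a + b) ^ 2 - a ^ 2 - b ^ 2 := by
    rw [two_smul]
    ring
  have h4 := sub_mem (sub_mem (h _ (add_mem ha hb)) (h _ ha)) (h _ hb)
  rw [← h1] at h4
  exact (Submodule.smul_mem_iff _ h2).mp h4

/-- If the square of the maximal ideal is not generated by a square, then the first two successive
quotients of its powers have dimension at least two. -/
lemma finrank_mpow_of_not_exists (h2 : (2 : k) ≠ 0) (hm2 : mpow k L 2 ≠ ⊥)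
    (h : ¬ ∃ x ∈ maximalIdeal L, ∀ a ∈ maximalIdeal L, ∀ b ∈ maximalIdeal L, ∃ c,
      a * b = x ^ 2 * c) :
    Module.finrank k (mpow k L 2) + 2 ≤ Module.finrank k (mpow k L 1) ∧
      Module.finrank k (mpow k L 3) + 2 ≤ Module.finrank k (mpow k L 2) := by
  constructor
  -- With m/m² at most a line, m is principal and m² is generated by the square of its generator.
  · by_contra! hlt
    obtain ⟨x, hx, hx2⟩ : ∃ x ∈ mpow k L 1, x ∉ mpow k L 2 := by
      by_contra! h'
      have := mpow_eq_bot_of_le h'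
      exact hm2 (eq_bot_iff.mpr (this ▸ mpow_mono (by omega)))
    have hle := maximalIdeal_pow_le_of_le_sup
      (le_span_sup (N := mpow k L 2) (mpow_mono (by omega)) hx hx2 (by omega))
    rw [pow_one] at hle
    refine h ⟨x, mem_mpow_one.mp hx, fun a ha b hb => ?_⟩
    obtain ⟨c, rfl⟩ := Ideal.mem_span_singleton.mp (hle ha)
    obtain ⟨d, rfl⟩ := Ideal.mem_span_singleton.mp (hle hb)
    exact ⟨c * d, by ring⟩
  -- With m²/m³ at most a line, any square outside m³ generates m².
  · by_contra! hlt
    obtain ⟨x, hx, hx2⟩ := exists_sq_notMem h2 hm2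
    have hxx : x ^ 2 ∈ mpow k L 2 := by
      rw [pow_two]
      exact mul_mem_mpow hx hx
    have hle := maximalIdeal_pow_le_of_le_sup
      (le_span_sup (N := mpow k L 3) (mpow_mono (by omega)) hxx hx2 (by omega))
    refine h ⟨x, mem_mpow_one.mp hx, fun a ha b hb => Ideal.mem_span_singleton.mp (hle ?_)⟩
    rw [pow_two]
    exact Ideal.mul_mem_mul ha hb

/-- A finite local Frobenius algebra with Hilbert function `(1, 2, 2, 1)`. -/
structure IsBalanced (k : Type u) [Field k] (L : Type v) [CommRing L] [Algebra k L]
    [IsLocalRing L] : Prop where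
  isFrobenius : IsFrobenius k L
  finrank_eq : Module.finrank k L = 6
  finrank_one : Module.finrank k (mpow k L 1) = 5
  finrank_two : Module.finrank k (mpow k L 2) = 3
  finrank_three : Module.finrank k (mpow k L 3) = 1
  four : mpow k L 4 = ⊥

/-- If m³ = 0, then m² is in the socle, a line, against its dimension being at least 2. So the
dimensions of m³, m², m and L are at least 1, 3, 5 and 6, and the bound 6 makes them equal; m⁴ is
then a proper subspace of the line m³. -/
lemma isBalanced_of_finrank [IsAlgClosed k] (hF : IsFrobenius k L) (h6 : Module.finrank k L ≤ 6)
    (h1 : Module.finrank k (mpow k L 2) + 2 ≤ Module.finrank k (mpow k L 1))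
    (h2 : Module.finrank k (mpow k L 3) + 2 ≤ Module.finrank k (mpow k L 2)) :
    IsBalanced k L := by
  have h3 : mpow k L 3 ≠ ⊥ := fun h3 => by
    have h0 : mpow k L 2 ≠ ⊥ := fun h0 => by
      rw [h0, finrank_bot] at h2
      omega
    obtain ⟨b, hb, hb0⟩ := Submodule.exists_mem_ne_zero_of_ne_bot h0
    have hle : mpow k L 2 ≤ Submodule.span k {b} := fun a ha => by
      obtain ⟨c, rfl⟩ := hF.exists_smul_of_mem_socle (mul_eq_zero_of_mem_mpow h3 ha)
        (mul_eq_zero_of_mem_mpow h3 hb) hb0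
      exact Submodule.smul_mem _ _ (Submodule.mem_span_singleton_self b)
    have := Submodule.finrank_mono hle
    rw [finrank_span_singleton hb0] at this
    omega
  have h3' : 1 ≤ Module.finrank k (mpow k L 3) := Submodule.one_le_finrank_iff.mpr h3
  have h1' : Module.finrank k (mpow k L 1) < Module.finrank k L := by
    refine Submodule.finrank_lt fun htop => ?_
    have : (1 : L) ∈ mpow k L 1 := htop ▸ Submodule.mem_top
    exact (maximalIdeal.isMaximal L).ne_top ((Ideal.eq_top_iff_one _).mpr (mem_mpow_one.mp this))
  refine ⟨hF, by omega, by omega, by omega, by omega, ?_⟩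
  by_contra h4
  have h4' := Submodule.one_le_finrank_iff.mpr h4
  have := Submodule.eq_of_le_of_finrank_le (mpow_mono (k := k) (L := L) (show 3 ≤ 4 by omega))
    (by omega)
  exact h3 (mpow_eq_bot_of_le this.ge)

end

end AGor
end

noncomputable section
namespace AGor
open IsLocalRing
attribute [local instance] quotientModule

/-! ### Algebras with Hilbert function (1, 2, 2, 1) -/

section

variable {k : Type u} [Field k]

lemma nonempty_algEquiv_of_socle [IsAlgClosed k] {C : Type*} [CommRing C] [Algebra k C]
    [IsLocalRing C] [Module.Finite k C] {L : Type v} [CommRing L] [Algebra k L] [Module.Finite k L]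
    (hC : IsFrobenius k C) {e : C}
    (he : ∀ r ∈ maximalIdeal C, r * e = 0) (f : C →ₐ[k] L) (hf : f e ≠ 0)
    (hd : Module.finrank k C = Module.finrank k L) : Nonempty (L ≃ₐ[k] C) := by
  have hinj := hC.injective_of_socle he f hf
  have hsurj : Function.Surjective f :=
    (LinearMap.injective_iff_surjective_of_finrank_eq_finrank (f := f.toLinearMap) hd).mp hinj
  exact ⟨(AlgEquiv.ofBijective f ⟨hinj, hsurj⟩).symm⟩

lemma IsSpecial.nonempty_algEquiv [IsAlgClosed k] {L : Type v} [CommRing L] [Algebra k L]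
    [Module.Finite k L] {I : Ideal (MvPolynomial (Fin 2) k)} {ε : k}
    (hI : IsSpecial I ε) (f : (MvPolynomial (Fin 2) k ⧸ I) →ₐ[k] L) (hf : f (mon I 2 1) ≠ 0)
    (hd : Module.finrank k L = 6) : Nonempty (L ≃ₐ[k] (MvPolynomial (Fin 2) k ⧸ I)) := by
  obtain ⟨_, _⟩ := hI.isLocalRing
  have := hI.finite
  exact nonempty_algEquiv_of_socle hI.isFrobenius hI.mul_top f hf (hI.finrank_eq.trans hd.symm)

variable {L : Type v} [CommRing L] [Algebra k L] [IsLocalRing L]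

namespace IsBalanced

lemma mul_eq_zero (h : IsBalanced k L) {i j : ℕ} (hij : 4 ≤ i + j) {a b : L} (ha : a ∈ mpow k L i)
    (hb : b ∈ mpow k L j) : a * b = 0 :=
  eq_zero_of_mpow_eq_bot h.four hij (mul_mem_mpow ha hb)

variable [Module.Finite k L]

/-- The annihilator of the square of the maximal ideal is contained in this square. -/
lemma mem_mpow_two (h : IsBalanced k L) {z : L} (hz : ∀ q ∈ mpow k L 2, z * q = 0) :
    z ∈ mpow k L 2 := by
  obtain ⟨μ, hμ⟩ := h.isFrobenius
  let Φ : L →ₗ[k] Module.Dual k L := (LinearMap.mul k L).compr₂ μ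
  have hΦ : ∀ a b, Φ a b = μ (a * b) := fun _ _ => rfl
  have hinj : Function.Injective Φ := by
    rw [injective_iff_map_eq_zero]
    exact fun a ha => hμ a fun b => by rw [← hΦ, ha, LinearMap.zero_apply]
  have hsurj : Function.Surjective Φ :=
    (LinearMap.injective_iff_surjective_of_finrank_eq_finrank
      Subspace.dual_finrank_eq.symm).mp hinj
  -- Ψ maps L onto the dual of m², so its kernel has dimension 6 − 3 = 3. It contains m², of
  -- dimension 3, hence equals it.
  let Ψ := (mpow k L 2).dualRestrict ∘ₗ Φ
  have hΨ : ∀ a (q : mpow k L 2), Ψ a q = μ (a * q) := fun _ _ => rfl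
  have hΨs : LinearMap.range Ψ = ⊤ :=
    LinearMap.range_eq_top.mpr (Subspace.dualRestrict_surjective.comp hsurj)
  have hrank := LinearMap.finrank_range_add_finrank_ker Ψ
  rw [hΨs, finrank_top, Subspace.dual_finrank_eq, h.finrank_two, h.finrank_eq] at hrank
  have hle : mpow k L 2 ≤ LinearMap.ker Ψ := fun a ha => LinearMap.mem_ker.mpr <| by
    ext q
    rw [hΨ, h.mul_eq_zero (by omega) ha q.2, map_zero, LinearMap.zero_apply]
  rw [Submodule.eq_of_le_of_finrank_le hle (by rw [h.finrank_two]; omega), LinearMap.mem_ker]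
  ext q
  rw [hΨ, hz q q.2, map_zero, LinearMap.zero_apply]

/-- Two elements of order one whose product has order at least three. -/
lemma exists_mul_mem [IsAlgClosed k] (h2 : (2 : k) ≠ 0) (h : IsBalanced k L) :
    ∃ u ∈ mpow k L 1, u ∉ mpow k L 2 ∧ ∃ w ∈ mpow k L 1, w ∉ mpow k L 2 ∧
      u * w ∈ mpow k L 3 := by
  obtain ⟨a, ha, ha2⟩ : ∃ a ∈ mpow k L 1, a ∉ mpow k L 2 := by
    by_contra! hle
    have := Submodule.finrank_mono hle
    rw [h.finrank_one, h.finrank_two] at this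
    omega
  obtain ⟨b, hb, hb2⟩ : ∃ b ∈ mpow k L 1, b ∉ Submodule.span k {a} ⊔ mpow k L 2 := by
    by_contra! hle
    have := Submodule.finrank_mono hle
    have h4 := Submodule.finrank_add_le_finrank_add_finrank (Submodule.span k {a}) (mpow k L 2)
    have h5 := finrank_span_le_card (R := k) ({a} : Set L)
    rw [h.finrank_one] at this
    rw [h.finrank_two] at h4
    simp only [Set.toFinset_singleton, Finset.card_singleton] at h5
    omega
  have hb2' : ∀ c : k, b - c • a ∉ mpow k L 2 := fun c hc =>
    hb2 (mem_span_singleton_sup_iff.mpr ⟨c, _, hc, by rw [add_sub_cancel]⟩)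
  have hbm : ∀ c : k, b - c • a ∈ mpow k L 1 := fun c =>
    sub_mem hb (Submodule.smul_mem _ _ ha)
  -- The products a², ab, b² satisfy a linear relation in the plane m²/m³, a binary quadratic form
  -- that factors over an algebraically closed field. The cases a² ≡ 0 and ab ≡ ca² have obvious
  -- factors.
  by_cases haa : a * a ∈ mpow k L 3
  · exact ⟨a, ha, ha2, a, ha, ha2, haa⟩
  by_cases hab : a * b ∈ Submodule.span k {a * a} ⊔ mpow k L 3
  · obtain ⟨c, n, hn, hc⟩ := mem_span_singleton_sup_iff.mp hab
    refine ⟨a, ha, ha2, b - c • a, hbm c, hb2' c, ?_⟩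
    rwa [mul_sub, mul_smul_comm, hc, add_sub_cancel_left]
  have hlt : mpow k L 3 < Submodule.span k {a * a} ⊔ mpow k L 3 :=
    lt_of_le_of_ne le_sup_right fun heq =>
      haa (heq ▸ Submodule.mem_sup_left (Submodule.mem_span_singleton_self _))
  have hfr := Submodule.finrank_lt_finrank_of_lt hlt
  rw [h.finrank_three] at hfr
  have hle := le_span_sup (sup_le ((Submodule.span_singleton_le_iff_mem _ _).mpr
    (mul_mem_mpow ha ha)) (mpow_mono (by omega))) (mul_mem_mpow ha hb) hab
    (by rw [show 1 + 1 = 2 from rfl, h.finrank_two]; omega)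
  obtain ⟨p, n', hn', hp⟩ := mem_span_singleton_sup_iff.mp (hle (mul_mem_mpow hb hb))
  obtain ⟨q, n, hn, hq⟩ := mem_span_singleton_sup_iff.mp hn'
  -- d is a square root of the discriminant of T² − pT − q, and (p ± d)/2 are its roots.
  obtain ⟨d, hd⟩ := IsAlgClosed.exists_pow_nat_eq (p ^ 2 + 4 * q) (n := 2) (by omega)
  refine ⟨b - ((p + d) / 2) • a, hbm _, hb2' _, b - ((p - d) / 2) • a, hbm _, hb2' _, ?_⟩
  have h5 : (p + d) / 2 + (p - d) / 2 = p := by field_simp; ring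
  have h6 : (p + d) / 2 * ((p - d) / 2) = -q := by
    have : (4 : k) = 2 * 2 := by norm_num
    field_simp
    linear_combination -hd - q * this
  have : (b - ((p + d) / 2) • a) * (b - ((p - d) / 2) • a) = b * b -
      ((p + d) / 2 + (p - d) / 2) • (a * b) + ((p + d) / 2 * ((p - d) / 2)) • (a * a) := by
    simp only [Algebra.smul_def, map_add, map_mul]
    ring
  rw [this, h5, h6, hp, hq]
  convert hn using 1
  rw [neg_smul]
  abel

/-- If multiplication by `u` on the maximal ideal is governed by `u * z`, then `u * z ^ 2` does
not vanish. -/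
lemma mul_sq_ne_zero (h : IsBalanced k L) {u z : L} (hu2 : u ∉ mpow k L 2)
    (hz : z ∈ mpow k L 1) (huz : ∀ a ∈ mpow k L 1, ∃ c : k, u * a - c • (u * z) ∈ mpow k L 3) :
    u * z ^ 2 ≠ 0 := fun h0 => by
  -- If u z² = 0, every product u a b is a multiple of it, so u annihilates m² and must lie in m².
  refine hu2 (h.mem_mpow_two fun q hq => ?_)
  have hle : mpow k L 2 ≤ LinearMap.ker (LinearMap.mulLeft k u) := by
    refine mpow_two_le fun a ha b hb => ?_
    rw [LinearMap.mem_ker, LinearMap.mulLeft_apply]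
    obtain ⟨c, hc⟩ := huz a ha
    obtain ⟨d, hd⟩ := huz b hb
    have h1 := h.mul_eq_zero (by omega) hc hb
    have h2 := h.mul_eq_zero (by omega) hd hz
    simp only [Algebra.smul_def] at h1 h2
    linear_combination h1 + algebraMap k L c * h2 + algebraMap k L c * algebraMap k L d * h0
  exact hle hq

end IsBalanced

namespace IsBalanced

variable [Module.Finite k L] [IsAlgClosed k]

lemma exists_smul (h : IsBalanced k L) {a b : L} (ha : a ∈ mpow k L 3) (hb : b ∈ mpow k L 3)
    (hb0 : b ≠ 0) : ∃ c : k, a = c • b :=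
  h.isFrobenius.exists_smul_of_mem_socle (mul_eq_zero_of_mem_mpow h.four ha)
    (mul_eq_zero_of_mem_mpow h.four hb) hb0

/-- Both u³ and w³ are nonzero in the line m³. Rescaling w and correcting it by a multiple of u²
gives y with uy = 0 and y³ = u³. Then y − u and y + u satisfy the relations of `A₂sp`, and the socle
monomial maps to y³ + u³ = 2u³ ≠ 0. -/
lemma nonempty_algEquiv_A₂sp (h2 : (2 : k) ≠ 0) (h : IsBalanced k L) {u w : L}
    (hu : u ∈ mpow k L 1) (hu2 : u ∉ mpow k L 2) (hw : w ∈ mpow k L 1) (hw2 : w ∉ mpow k L 2)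
    (huw : u * w ∈ mpow k L 3)
    (hle : mpow k L 1 ≤ Submodule.span k {w} ⊔ (Submodule.span k {u} ⊔ mpow k L 2)) :
    Nonempty (L ≃ₐ[k] A₂sp k) := by
  have hspan : ∀ a ∈ mpow k L 1, ∃ c d : k, ∃ q ∈ mpow k L 2, a = c • w + (d • u + q) := by
    intro a ha
    obtain ⟨c, n, hn, rfl⟩ := mem_span_singleton_sup_iff.mp (hle ha)
    obtain ⟨d, q, hq, rfl⟩ := mem_span_singleton_sup_iff.mp hn
    exact ⟨c, d, q, hq, rfl⟩
  have hu3 : u * u ^ 2 ≠ 0 := h.mul_sq_ne_zero hu2 hu fun a ha => by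
    obtain ⟨c, d, q, hq, rfl⟩ := hspan a ha
    refine ⟨d, ?_⟩
    rw [show u * (c • w + (d • u + q)) - d • (u * u) = c • (u * w) + u * q by
      simp only [Algebra.smul_def]; ring]
    exact add_mem (Submodule.smul_mem _ _ huw) (mul_mem_mpow hu hq)
  have hw3 : w * w ^ 2 ≠ 0 := h.mul_sq_ne_zero hw2 hw fun a ha => by
    obtain ⟨c, d, q, hq, rfl⟩ := hspan a ha
    refine ⟨c, ?_⟩
    rw [show w * (c • w + (d • u + q)) - c • (w * w) = d • (u * w) + w * q by
      simp only [Algebra.smul_def]; ring]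
    exact add_mem (Submodule.smul_mem _ _ huw) (mul_mem_mpow hw hq)
  have hcube : ∀ {a}, a ∈ mpow k L 1 → a * a ^ 2 ∈ mpow k L 3 := fun ha => by
    rw [pow_two]
    exact mul_mem_mpow (j := 2) ha (mul_mem_mpow ha ha)
  obtain ⟨t, ht⟩ := h.exists_smul (hcube hw) (hcube hu) hu3
  have ht0 : t ≠ 0 := fun h0 => hw3 (by rw [ht, h0, zero_smul])
  obtain ⟨τ, rfl⟩ := IsAlgClosed.exists_pow_nat_eq t (n := 3) (by omega)
  have hτ : τ ≠ 0 := fun h0 => ht0 (by rw [h0, zero_pow (by omega)])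
  obtain ⟨c, hc⟩ := h.exists_smul (Submodule.smul_mem _ τ⁻¹ huw) (hcube hu) hu3
  set y := τ⁻¹ • w - c • u ^ 2 with hy
  have hτ' : algebraMap k L τ * algebraMap k L τ⁻¹ = 1 := by
    rw [← map_mul, mul_inv_cancel₀ hτ, map_one]
  have huy : u * y = 0 := by
    rw [hy]
    simp only [Algebra.smul_def] at hc ⊢
    linear_combination hc
  have huu : u * u ∈ mpow k L 2 := mul_mem_mpow hu hu
  have huuw : u * u * w = 0 := by
    rw [mul_assoc]
    exact h.mul_eq_zero (by omega) hu huw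
  have hu4 : u * u * (u * u) = 0 := h.mul_eq_zero (by omega) huu huu
  have hy3 : y ^ 3 = u ^ 3 := by
    rw [hy]
    simp only [Algebra.smul_def, map_pow] at ht ⊢
    set T := algebraMap k L τ⁻¹
    set S := algebraMap k L τ
    set C := algebraMap k L c
    linear_combination T ^ 3 * ht + u ^ 3 * (S ^ 2 * T ^ 2 + S * T + 1) * hτ' +
      (-3 * T ^ 2 * C * w + 3 * T * C ^ 2 * u ^ 2) * huuw - C ^ 3 * u ^ 2 * hu4
  obtain ⟨f, hf⟩ := exists_algHom_A₂sp (k := k) (x := y - u) (y := y + u)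
    (by linear_combination 4 * huy) (by linear_combination hy3 + (3 * u - 3 * y) * huy)
  refine isSpecial_ideal₂sp.nonempty_algEquiv f ?_ h.finrank_eq
  rw [hf, show (y - u) ^ 2 * (y + u) = (2 : k) • (u * u ^ 2) by
    rw [two_smul]
    linear_combination hy3 - (y + u) * huy]
  exact smul_ne_zero h2 hu3

/-- Here uz² spans m³, with z³ = a·uz² and u² = c·uz². Replacing z by x = z − (a/3)u makes the cube
vanish, and replacing u by u − (c/2)x² makes the square vanish; x²u is still uz². -/
lemma nonempty_algEquiv_A₁sp (h3 : (3 : k) ≠ 0) (h2 : (2 : k) ≠ 0) (h : IsBalanced k L) {u z : L}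
    (hu : u ∈ mpow k L 1) (hu2 : u ∉ mpow k L 2) (hz : z ∈ mpow k L 1)
    (huu : u * u ∈ mpow k L 3)
    (hle : mpow k L 1 ≤ Submodule.span k {z} ⊔ (Submodule.span k {u} ⊔ mpow k L 2)) :
    Nonempty (L ≃ₐ[k] A₁sp k) := by
  have he : u * z ^ 2 ≠ 0 := h.mul_sq_ne_zero hu2 hz fun a ha => by
    obtain ⟨c, n, hn, rfl⟩ := mem_span_singleton_sup_iff.mp (hle ha)
    obtain ⟨d, q, hq, rfl⟩ := mem_span_singleton_sup_iff.mp hn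
    refine ⟨c, ?_⟩
    rw [show u * (c • z + (d • u + q)) - c • (u * z) = d • (u * u) + u * q by
      simp only [Algebra.smul_def]; ring]
    exact add_mem (Submodule.smul_mem _ _ huu) (mul_mem_mpow hu hq)
  have hzz : z * z ∈ mpow k L 2 := mul_mem_mpow hz hz
  have hem : u * z ^ 2 ∈ mpow k L 3 := by
    rw [pow_two]
    exact mul_mem_mpow hu hzz
  have huuz : u * u * z = 0 := h.mul_eq_zero (by omega) huu hz
  have huuu : u * u * u = 0 := h.mul_eq_zero (by omega) huu hu
  have hz4 : z * z * (z * z) = 0 := h.mul_eq_zero (by omega) hzz hzz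
  have huz3 : u * z * (z * z) = 0 := h.mul_eq_zero (by omega) (mul_mem_mpow hu hz) hzz
  obtain ⟨a, ha⟩ := h.exists_smul (mul_mem_mpow hz hzz) hem he
  obtain ⟨c, hc⟩ := h.exists_smul huu hem he
  simp only [Algebra.smul_def] at ha hc
  have h3' : 3 * algebraMap k L (a / 3) = algebraMap k L a := by
    rw [← map_ofNat (algebraMap k L) 3, ← map_mul, mul_div_cancel₀ _ h3]
  have h2' : 2 * algebraMap k L (c / 2) = algebraMap k L c := by
    rw [← map_ofNat (algebraMap k L) 2, ← map_mul, mul_div_cancel₀ _ h2]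
  set α := algebraMap k L (a / 3)
  set γ := algebraMap k L (c / 2)
  have hx2u : (z - α * u) ^ 2 * u = u * z ^ 2 := by
    linear_combination (-2 * α) * huuz + α ^ 2 * huuu
  have hx3 : (z - α * u) ^ 3 = 0 := by
    linear_combination ha + 3 * α ^ 2 * huuz - α ^ 3 * huuu - u * z ^ 2 * h3'
  have hx4 : (z - α * u) ^ 4 = 0 := by rw [pow_succ, hx3, zero_mul]
  obtain ⟨f, hf⟩ := exists_algHom_A₁sp (k := k) (x := z - α * u)
    (y := u - γ * (z - α * u) ^ 2)
    (by linear_combination hc - u * z ^ 2 * h2' - 2 * γ * hx2u + γ ^ 2 * hx4) hx3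
  refine isSpecial_ideal₁sp.nonempty_algEquiv f ?_ h.finrank_eq
  rw [hf, show (z - α * u) ^ 2 * (u - γ * (z - α * u) ^ 2) = u * z ^ 2 by
    linear_combination hx2u - γ * hx4]
  exact he

theorem nonempty_algEquiv (h3 : (3 : k) ≠ 0) (h2 : (2 : k) ≠ 0) (h : IsBalanced k L) :
    Nonempty (L ≃ₐ[k] A₁sp k) ∨ Nonempty (L ≃ₐ[k] A₂sp k) := by
  obtain ⟨u, hu, hu2, w, hw, hw2, huw⟩ := h.exists_mul_mem h2
  have hN : Submodule.span k {u} ⊔ mpow k L 2 ≤ mpow k L 1 :=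
    sup_le ((Submodule.span_singleton_le_iff_mem _ _).mpr hu) (mpow_mono (by omega))
  have hlt : mpow k L 2 < Submodule.span k {u} ⊔ mpow k L 2 :=
    lt_of_le_of_ne le_sup_right fun heq =>
      hu2 (heq ▸ Submodule.mem_sup_left (Submodule.mem_span_singleton_self _))
  have hfr := Submodule.finrank_lt_finrank_of_lt hlt
  rw [h.finrank_two] at hfr
  have hcover : ∀ z ∈ mpow k L 1, z ∉ Submodule.span k {u} ⊔ mpow k L 2 →
      mpow k L 1 ≤ Submodule.span k {z} ⊔ (Submodule.span k {u} ⊔ mpow k L 2) :=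
    fun z hz hz' => le_span_sup hN hz hz' (by rw [h.finrank_one]; omega)
  -- The two factors of the quadratic form are either proportional modulo m², and then u² ∈ m³, or
  -- independent.
  by_cases hwu : w ∈ Submodule.span k {u} ⊔ mpow k L 2
  · left
    obtain ⟨c, q, hq, rfl⟩ := mem_span_singleton_sup_iff.mp hwu
    have hc : c ≠ 0 := by
      rintro rfl
      exact hw2 (by rwa [zero_smul, zero_add])
    have huu : u * u ∈ mpow k L 3 := by
      rw [← Submodule.smul_mem_iff _ hc]
      have := sub_mem huw (mul_mem_mpow (j := 2) hu hq)
      rwa [mul_add, add_sub_cancel_right, mul_smul_comm] at this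
    obtain ⟨z, hz, hz2⟩ : ∃ z ∈ mpow k L 1, z ∉ Submodule.span k {u} ⊔ mpow k L 2 := by
      by_contra! hle
      have := Submodule.finrank_mono hle
      have h4 := Submodule.finrank_add_le_finrank_add_finrank (Submodule.span k {u}) (mpow k L 2)
      have h5 := finrank_span_le_card (R := k) ({u} : Set L)
      rw [h.finrank_one] at this
      rw [h.finrank_two] at h4
      simp only [Set.toFinset_singleton, Finset.card_singleton] at h5
      omega
    exact h.nonempty_algEquiv_A₁sp h3 h2 hu hu2 hz huu (hcover z hz hz2)
  · exact Or.inr (h.nonempty_algEquiv_A₂sp h2 hu hu2 hw hw2 huw (hcover w hw hwu))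

end IsBalanced

/-- The classification of the local Frobenius algebras of dimension at most six. -/
theorem exists_localModel_algEquiv [Module.Finite k L] [IsAlgClosed k] (h3 : (3 : k) ≠ 0)
    (h2 : (2 : k) ≠ 0) (hF : IsFrobenius k L) (h6 : Module.finrank k L ≤ 6) :
    ∃ t, Nonempty (L ≃ₐ[k] localModel k t) := by
  -- With m² = 0 the whole of m is socle, so it is zero or a line.
  by_cases hm2 : mpow k L 2 = ⊥
  · have hsoc : ∀ a ∈ maximalIdeal L, ∀ r ∈ maximalIdeal L, r * a = 0 := fun a ha =>
      mul_eq_zero_of_mem_mpow (i := 1) hm2 (mem_mpow_one.mpr ha)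
    by_cases hm : ∃ x ∈ maximalIdeal L, x ≠ 0
    · obtain ⟨x, hx, hx0⟩ := hm
      refine ⟨1, nonempty_algEquiv_A (x := x) (r := 0) (s := 1) Fin.elim0 one_pos
        (fun j => j.elim0) (fun j => j.elim0) (fun j => j.elim0) ?_ (by rwa [pow_one])
        fun l => ?_⟩
      · rw [pow_two]
        exact hsoc x hx x hx
      · obtain ⟨c, hc⟩ := exists_sub_algebraMap_mem (k := k) l
        obtain ⟨d, hd⟩ := hF.exists_smul_of_mem_socle (hsoc _ hc) (hsoc x hx) hx0
        refine ⟨c, 0, zero_mem _, algebraMap k L d, ?_⟩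
        rw [Algebra.smul_def] at hd
        linear_combination hd
    · push Not at hm
      refine ⟨0, ⟨(AlgEquiv.ofBijective (Algebra.ofId k L)
        ⟨(algebraMap k L).injective, fun l => ?_⟩).symm⟩⟩
      obtain ⟨c, hc⟩ := exists_sub_algebraMap_mem (k := k) l
      exact ⟨c, (sub_eq_zero.mp (hm _ hc)).symm⟩
  by_cases hx : ∃ x ∈ maximalIdeal L, ∀ a ∈ maximalIdeal L, ∀ b ∈ maximalIdeal L, ∃ c,
      a * b = x ^ 2 * c
  · obtain ⟨x, hx, hxm⟩ := hx
    have hx2 : x ^ 2 ≠ 0 := fun h0 => hm2 (eq_bot_iff.mpr (mpow_two_le fun a ha b hb => by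
      obtain ⟨c, hc⟩ := hxm a (mem_mpow_one.mp ha) b (mem_mpow_one.mp hb)
      rw [hc, h0, zero_mul]
      exact zero_mem _))
    obtain ⟨r, s, hs, ⟨g⟩⟩ := exists_algEquiv_A_of_sq_le h2 hF hx2 hx hxm
    have hd := g.toLinearEquiv.finrank_eq
    rw [finrank_A (by omega)] at hd
    obtain ⟨rfl, rfl⟩ | ⟨rfl, rfl⟩ | ⟨rfl, rfl⟩ | ⟨rfl, rfl⟩ | ⟨rfl, rfl⟩ | ⟨rfl, rfl⟩ |
      ⟨rfl, rfl⟩ | ⟨rfl, rfl⟩ | ⟨rfl, rfl⟩ | ⟨rfl, rfl⟩ :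
        r = 0 ∧ s = 2 ∨ r = 0 ∧ s = 3 ∨ r = 0 ∧ s = 4 ∨ r = 0 ∧ s = 5 ∨ r = 1 ∧ s = 2 ∨
        r = 1 ∧ s = 3 ∨ r = 1 ∧ s = 4 ∨ r = 2 ∧ s = 2 ∨ r = 2 ∧ s = 3 ∨ r = 3 ∧ s = 2 := by
      omega
    exacts [⟨2, ⟨g⟩⟩, ⟨3, ⟨g⟩⟩, ⟨5, ⟨g⟩⟩, ⟨8, ⟨g⟩⟩, ⟨4, ⟨g⟩⟩, ⟨6, ⟨g⟩⟩, ⟨9, ⟨g⟩⟩, ⟨7, ⟨g⟩⟩,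
      ⟨10, ⟨g⟩⟩, ⟨11, ⟨g⟩⟩]
  · obtain ⟨hd1, hd2⟩ := finrank_mpow_of_not_exists h2 hm2 hx
    rcases (isBalanced_of_finrank hF h6 hd1 hd2).nonempty_algEquiv h3 h2 with g | g
    exacts [⟨12, g⟩, ⟨13, g⟩]

end

end AGor
end

noncomputable section
namespace AGor
open IsLocalRing

/-! ### Products of local algebras -/

section Products

variable {k : Type*} [CommRing k] {ι κ : Type*} {L : ι → Type*} {M : κ → Type*}
  [∀ i, CommRing (L i)] [∀ i, Algebra k (L i)] [∀ j, CommRing (M j)] [∀ j, Algebra k (M j)]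

lemma eq_zero_or_one_of_mul_self {R : Type*} [CommRing R] [IsLocalRing R] {e : R}
    (he : e * e = e) : e = 0 ∨ e = 1 := by
  rcases IsLocalRing.isUnit_or_isUnit_one_sub_self e with h | h
  · exact Or.inr (h.mul_left_cancel (by rw [he, mul_one]))
  · exact Or.inl (h.mul_left_cancel (by rw [sub_mul, one_mul, he, sub_self, mul_zero]))

variable [DecidableEq ι]

lemma single_mul_eq (i : ι) (b : Π i, L i) : Pi.single i (1 : L i) * b = Pi.single i (b i) := by
  ext j
  by_cases h : j = i
  · subst h
    simp
  · simp [h]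

lemma apply_single_eq_zero_or_one [∀ j, IsLocalRing (M j)] (φ : (Π i, L i) ≃ₐ[k] Π j, M j)
    (i : ι) (j : κ) : φ (Pi.single i 1) j = 0 ∨ φ (Pi.single i 1) j = 1 := by
  apply eq_zero_or_one_of_mul_self
  rw [← Pi.mul_apply, ← map_mul, single_mul_eq, Pi.single_eq_same]

lemma existsUnique_apply_single [Fintype ι] [∀ j, IsLocalRing (M j)]
    (φ : (Π i, L i) ≃ₐ[k] Π j, M j) (j : κ) : ∃! i, φ (Pi.single i 1) j = 1 := by
  have hsum : ∑ i, φ (Pi.single i (1 : L i)) j = 1 := by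
    rw [← Finset.sum_apply, ← map_sum, Finset.univ_sum_single, ← Pi.one_def, map_one, Pi.one_apply]
  obtain ⟨i, hi⟩ : ∃ i, φ (Pi.single i 1) j = 1 := by
    by_contra! h
    rw [Finset.sum_eq_zero fun i _ => (apply_single_eq_zero_or_one φ i j).resolve_right (h i)]
      at hsum
    exact zero_ne_one hsum
  refine ⟨i, hi, fun i' hi' => ?_⟩
  by_contra hne
  have h1 : Pi.single i (1 : L i) * Pi.single i' (1 : L i') = 0 := by
    rw [single_mul_eq, Pi.single_eq_of_ne (Ne.symm hne), Pi.single_zero]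
  have h2 := congrFun (congrArg φ h1) j
  rw [map_mul, Pi.mul_apply, hi, hi', map_zero, mul_one, Pi.zero_apply] at h2
  exact one_ne_zero h2

variable [DecidableEq κ]

lemma symm_apply_single_eq_one [∀ i, IsLocalRing (L i)] [∀ j, IsLocalRing (M j)]
    (φ : (Π i, L i) ≃ₐ[k] Π j, M j) {i : ι} {j : κ} (h : φ (Pi.single i 1) j = 1) :
    φ.symm (Pi.single j 1) i = 1 := by
  refine (apply_single_eq_zero_or_one φ.symm j i).resolve_left fun h0 => ?_
  have h1 : Pi.single i (1 : L i) * φ.symm (Pi.single j 1) = 0 := by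
    rw [single_mul_eq, h0, Pi.single_zero]
  have h2 := congrArg φ h1
  rw [map_mul, φ.apply_symm_apply, map_zero, mul_comm, single_mul_eq, h] at h2
  have := congrFun h2 j
  rw [Pi.single_eq_same] at this
  exact one_ne_zero this

/-- The factors of a finite product of local algebras are determined by the product. -/
theorem exists_equiv_of_pi_algEquiv [Fintype ι] [Fintype κ] [∀ i, IsLocalRing (L i)]
    [∀ j, IsLocalRing (M j)] (φ : (Π i, L i) ≃ₐ[k] Π j, M j) :
    ∃ σ : κ ≃ ι, ∀ j, Nonempty (L (σ j) ≃ₐ[k] M j) := by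
  choose f hf hf' using fun j => existsUnique_apply_single φ j
  choose g hg hg' using fun i => existsUnique_apply_single φ.symm i
  have hfg : ∀ i, f (g i) = i := fun i => by
    refine (hf' (g i) i ?_).symm
    exact symm_apply_single_eq_one φ.symm (hg i)
  have hgf : ∀ j, g (f j) = j := fun j =>
    (hg' (f j) j (symm_apply_single_eq_one φ (hf j))).symm
  refine ⟨⟨f, g, hgf, hfg⟩, fun j => ?_⟩
  change Nonempty (L (f j) ≃ₐ[k] M j)
  -- Idempotents of a local ring are 0 and 1, so φ matches the primitive idempotents of the two
  -- products and thereby the factors they cut out.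
  have he : φ (Pi.single (f j) 1) = Pi.single j 1 := by
    ext j'
    by_cases h : j' = j
    · subst h
      rw [Pi.single_eq_same, hf]
    · rw [Pi.single_eq_of_ne h]
      refine (apply_single_eq_zero_or_one φ (f j) j').resolve_right fun h1 => h ?_
      rw [← hgf j', hgf, ← hgf j]
      exact hg' (f j) j' (symm_apply_single_eq_one φ h1)
  have hsupp : ∀ x : L (f j), φ (Pi.single (f j) x) = Pi.single j (φ (Pi.single (f j) x) j) := by
    intro x
    have : Pi.single (f j) x = Pi.single (f j) 1 * Pi.single (f j) x := by
      rw [single_mul_eq, Pi.single_eq_same]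
    conv_lhs => rw [this, map_mul, he, single_mul_eq]
  let h : L (f j) →ₐ[k] M j :=
    { toFun := fun x => φ (Pi.single (f j) x) j
      map_one' := hf j
      map_mul' := fun x y => by rw [← Pi.mul_apply, ← map_mul, ← Pi.single_mul]
      map_zero' := by rw [Pi.single_zero, map_zero, Pi.zero_apply]
      map_add' := fun x y => by rw [Pi.single_add, map_add, Pi.add_apply]
      commutes' := fun c => by
        rw [Algebra.algebraMap_eq_smul_one, Pi.single_smul, map_smul, Pi.smul_apply, hf,
          Algebra.algebraMap_eq_smul_one] }
  have hh : ∀ x, h x = φ (Pi.single (f j) x) j := fun x => rfl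
  refine ⟨AlgEquiv.ofBijective h ⟨?_, fun y => ?_⟩⟩
  · rw [injective_iff_map_eq_zero]
    intro x hx
    have h0 := hsupp x
    rw [← hh, hx, Pi.single_zero, EmbeddingLike.map_eq_zero_iff, Pi.single_eq_zero_iff] at h0
    exact h0
  · have h1 : Pi.single (f j) (1 : L (f j)) * φ.symm (Pi.single j y) = φ.symm (Pi.single j y) := by
      apply φ.injective
      rw [map_mul, he, φ.apply_symm_apply, single_mul_eq, Pi.single_eq_same]
    rw [single_mul_eq] at h1
    exact ⟨φ.symm (Pi.single j y) (f j), by rw [hh, h1, φ.apply_symm_apply, Pi.single_eq_same]⟩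

end Products

/-! ### Products of local models and their multisets -/

section HasType

variable (k : Type u) [Field k]

/-- The algebra `B` is the product of the local models in the multiset `s`. -/
def HasType (B : Type*) [CommRing B] [Algebra k B] (s : Multiset (Fin 14)) : Prop :=
  ∃ (N : ℕ) (w : Fin N → Fin 14), Finset.univ.val.map w = s ∧
    Nonempty (B ≃ₐ[k] Π i, localModel k (w i))

variable {k}

lemma HasType.of_fintype {B : Type*} [CommRing B] [Algebra k B] {ι : Type*} [Fintype ι]
    (w : ι → Fin 14) (f : B ≃ₐ[k] Π i, localModel k (w i)) :
    HasType k B (Finset.univ.val.map w) := by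
  let e := Fintype.equivFin ι
  refine ⟨Fintype.card ι, w ∘ e.symm, ?_, ⟨f.trans
    (AlgEquiv.piCongrLeft k (fun i => localModel k (w i)) e.symm).symm⟩⟩
  rw [← Multiset.map_univ_val_equiv e.symm, Multiset.map_map]

lemma HasType.congr {B C : Type*} [CommRing B] [Algebra k B] [CommRing C] [Algebra k C]
    {s : Multiset (Fin 14)} (h : HasType k C s) (f : B ≃ₐ[k] C) : HasType k B s := by
  obtain ⟨N, w, hw, ⟨g⟩⟩ := h
  exact ⟨N, w, hw, ⟨f.trans g⟩⟩

lemma hasType_pi (N : ℕ) (t : Fin 14) :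
    HasType k (Fin N → localModel k t) (Multiset.replicate N t) :=
  ⟨N, fun _ => t, by simp, ⟨AlgEquiv.refl⟩⟩

lemma hasType_localModel (t : Fin 14) : HasType k (localModel k t) {t} :=
  ⟨1, fun _ => t, rfl, ⟨(AlgEquiv.funUnique k (Fin 1) (localModel k t)).symm⟩⟩

/-- A product indexed by a sum. -/
def sumPiAlgEquiv {ι κ : Type*} (L : ι ⊕ κ → Type*) [∀ i, CommRing (L i)] [∀ i, Algebra k (L i)] :
    (Π i, L i) ≃ₐ[k] (Π i, L (Sum.inl i)) × Π j, L (Sum.inr j) :=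
  { Equiv.sumPiEquivProdPi L with
    map_mul' := fun _ _ => rfl
    map_add' := fun _ _ => rfl
    commutes' := fun _ => rfl }

lemma HasType.prod {B C : Type*} [CommRing B] [Algebra k B] [CommRing C] [Algebra k C]
    {s t : Multiset (Fin 14)} (hB : HasType k B s) (hC : HasType k C t) :
    HasType k (B × C) (s + t) := by
  obtain ⟨N, w, rfl, ⟨f⟩⟩ := hB
  obtain ⟨N', w', rfl, ⟨f'⟩⟩ := hC
  have h := HasType.of_fintype (B := B × C) (Sum.elim w w') ((AlgEquiv.prodCongr f f').trans
    (sumPiAlgEquiv (k := k) fun i => localModel k (Sum.elim w w' i)).symm)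
  rw [← Finset.univ_disjSum_univ, Finset.val_disjSum] at h
  simpa [Multiset.disjSum, Multiset.map_add, Multiset.map_map] using h

lemma HasType.eq (h3 : (3 : k) ≠ 0) (h2 : (2 : k) ≠ 0) {B : Type*} [CommRing B] [Algebra k B]
    {s t : Multiset (Fin 14)} (hs : HasType k B s) (ht : HasType k B t) : s = t := by
  obtain ⟨N, w, rfl, ⟨f⟩⟩ := hs
  obtain ⟨N', w', rfl, ⟨f'⟩⟩ := ht
  have := fun i => (isLocalModel_localModel h3 h2 (w i)).isLocalRing
  have := fun i => (isLocalModel_localModel h3 h2 (w' i)).isLocalRing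
  obtain ⟨σ, hσ⟩ := exists_equiv_of_pi_algEquiv (f.symm.trans f')
  have h : w ∘ σ = w' := by
    ext1 j
    obtain ⟨g⟩ := hσ j
    exact eq_of_localModel_algEquiv h3 h2 g
  rw [← h, ← Multiset.map_univ_val_equiv σ, Multiset.map_map]

lemma HasType.algEquiv {B C : Type*} [CommRing B] [Algebra k B] [CommRing C] [Algebra k C]
    {s : Multiset (Fin 14)} (hB : HasType k B s) (hC : HasType k C s) :
    Nonempty (B ≃ₐ[k] C) := by
  obtain ⟨N, w, rfl, ⟨f⟩⟩ := hB
  obtain ⟨N', w', h, ⟨f'⟩⟩ := hC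
  have hN : N' = N := by simpa using congrArg Multiset.card h
  subst hN
  rw [Fin.univ_val_map, Fin.univ_val_map, Multiset.coe_eq_coe] at h
  -- Two families with the same multiset of values agree after sorting, so the two sorting
  -- permutations combine to σ.
  obtain ⟨σ, hσ⟩ : ∃ σ : Fin N' ≃ Fin N', w ∘ σ = w' := by
    have h1 : w ∘ Tuple.sort w = w' ∘ Tuple.sort w' := List.ofFn_injective
      ((((Tuple.sort w).ofFn_comp_perm w).trans (h.symm.trans
        ((Tuple.sort w').ofFn_comp_perm w').symm)).eq_of_pairwise'
        (Tuple.monotone_sort w).sortedLE_ofFn.pairwise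
        (Tuple.monotone_sort w').sortedLE_ofFn.pairwise)
    refine ⟨(Tuple.sort w').symm.trans (Tuple.sort w), ?_⟩
    ext1 i
    simpa using congrFun h1 ((Tuple.sort w').symm i)
  subst hσ
  exact ⟨f.trans ((AlgEquiv.piCongrLeft k (fun i => localModel k (w i)) σ).symm.trans f'.symm)⟩

lemma HasType.finrank_eq (h3 : (3 : k) ≠ 0) (h2 : (2 : k) ≠ 0) {B : Type*} [CommRing B]
    [Algebra k B] {s : Multiset (Fin 14)} (h : HasType k B s) :
    Module.finrank k B = (s.map localDim).sum := by
  obtain ⟨N, w, rfl, ⟨f⟩⟩ := h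
  have hd := fun i => (isLocalModel_localModel h3 h2 (w i)).finrank_eq
  have : ∀ i, Module.Finite k (localModel k (w i)) := fun i =>
    Module.finite_of_finrank_pos (by
      rw [hd]
      have : ∀ t, 0 < localDim t := by decide
      exact this _)
  rw [f.toLinearEquiv.finrank_eq, Module.finrank_pi_fintype, Multiset.map_map]
  exact Finset.sum_congr rfl fun i _ => hd i

lemma IsFrobenius.congr {B : Type*} {C : Type*} [CommRing B] [Algebra k B] [CommRing C]
    [Algebra k C] (h : IsFrobenius k C) (f : B ≃ₐ[k] C) : IsFrobenius k B := by
  obtain ⟨μ, hμ⟩ := h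
  refine ⟨μ ∘ₗ f.toLinearMap, fun a ha => ?_⟩
  rw [← map_eq_zero_iff f f.injective]
  refine hμ _ fun b => ?_
  simpa using ha (f.symm b)

lemma HasType.isFrobenius (h3 : (3 : k) ≠ 0) (h2 : (2 : k) ≠ 0) {B : Type*} [CommRing B]
    [Algebra k B] {s : Multiset (Fin 14)} (h : HasType k B s) : IsFrobenius k B := by
  obtain ⟨N, w, rfl, ⟨f⟩⟩ := h
  refine IsFrobenius.congr ?_ f
  choose μ hμ using fun i => (isLocalModel_localModel h3 h2 (w i)).isFrobenius
  refine ⟨∑ i, μ i ∘ₗ LinearMap.proj i, fun a ha => ?_⟩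
  ext i
  refine hμ i _ fun b => ?_
  have := ha (Pi.single i b)
  rw [mul_comm, LinearMap.sum_apply, Finset.sum_eq_single i] at this
  · simpa [mul_comm] using this
  · intro j _ hj
    simp [hj]
  · simp

/-- The multisets of local models of the twenty algebras. -/
def modelType : Fin 20 → Multiset (Fin 14) :=
  ![{0, 0, 0, 0, 0, 0}, {0, 0, 0, 0, 1}, {0, 0, 0, 2}, {0, 0, 1, 1}, {0, 0, 3}, {0, 0, 4},
    {0, 1, 2}, {1, 1, 1}, {0, 5}, {0, 6}, {0, 7}, {1, 3}, {1, 4}, {2, 2}, {8}, {9}, {10}, {11},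
    {12}, {13}]

lemma hasType_models (i : Fin 20) : HasType k (models k i) (modelType i) := by
  have h1 := fun t => hasType_localModel (k := k) t
  have hp := fun N t => hasType_pi (k := k) N t
  fin_cases i
  · exact hp 6 0
  · exact (hp 4 0).prod (h1 1)
  · exact (hp 3 0).prod (h1 2)
  · exact (hp 2 0).prod (hp 2 1)
  · exact (hp 2 0).prod (h1 3)
  · exact (hp 2 0).prod (h1 4)
  · exact (h1 0).prod ((h1 1).prod (h1 2))
  · exact hp 3 1
  · exact (h1 0).prod (h1 5)
  · exact (h1 0).prod (h1 6)
  · exact (h1 0).prod (h1 7)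
  · exact (h1 1).prod (h1 3)
  · exact (h1 1).prod (h1 4)
  · exact hp 2 2
  · exact h1 8
  · exact h1 9
  · exact h1 10
  · exact h1 11
  · exact h1 12
  · exact h1 13

/-- The lists of at most `N` local models of total dimension `d`. -/
def typeLists : ℕ → ℕ → List (List (Fin 14))
  | 0, d => if d = 0 then [[]] else []
  | N + 1, d => (if d = 0 then [[]] else []) ++ (List.finRange 14).flatMap fun t =>
      if localDim t ≤ d then (typeLists N (d - localDim t)).map (t :: ·) else []

lemma mem_typeLists (l : List (Fin 14)) {N : ℕ} (hN : l.length ≤ N) :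
    l ∈ typeLists N (l.map localDim).sum := by
  induction l generalizing N with
  | nil => cases N <;> simp [typeLists]
  | cons t l ih =>
    obtain ⟨N, rfl⟩ := Nat.exists_eq_add_of_le' (Nat.succ_le_iff.mpr (Nat.zero_lt_of_lt hN))
    simp only [typeLists, List.map_cons, List.sum_cons, List.mem_append, List.mem_flatMap,
      List.mem_finRange, true_and]
    refine Or.inr ⟨t, ?_⟩
    rw [if_pos (Nat.le_add_right _ _), Nat.add_sub_cancel_left]
    exact List.mem_map_of_mem (ih (by simpa using hN))

lemma exists_modelType_eq {s : Multiset (Fin 14)} (hs : (s.map localDim).sum = 6) :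
    ∃ i, modelType i = s := by
  obtain ⟨l, rfl⟩ := Quot.exists_rep s
  change ((l.map localDim : List ℕ) : Multiset ℕ).sum = 6 at hs
  rw [Multiset.sum_coe] at hs
  -- Each factor has dimension at least 1, so six factors suffice and the search is finite.
  have hlen : l.length ≤ (l.map localDim).sum := by
    have := List.length_le_sum_of_one_le (l.map localDim) fun i hi => by
      obtain ⟨t, _, rfl⟩ := List.mem_map.mp hi
      have : ∀ t, 1 ≤ localDim t := by decide
      exact this t
    simpa using this
  have hmem := mem_typeLists l hlen
  rw [hs] at hmem
  have : ∀ l ∈ typeLists 6 6, ∃ i, modelType i = (l : Multiset (Fin 14)) := by decide +kernel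
  exact this l hmem

lemma modelType_injective : Function.Injective modelType := by
  have : ∀ i j, modelType i = modelType j → i = j := by decide +kernel
  exact fun i j => this i j

end HasType

end AGor
end

noncomputable section
namespace AGor

/-! ### Classification -/

section

variable {k : Type u} [Field k]

/-- An Artinian ring is the product of its localizations at maximal ideals; each is a quotient of B,
so of dimension at most 6, and is Frobenius by finite injective dimension. -/
lemma IsGorensteinRing.exists_hasType [IsAlgClosed k] (h3 : (3 : k) ≠ 0)
    (h2 : (2 : k) ≠ 0) {B : Type v} [CommRing B] [Algebra k B] [Module.Finite k B] (hB : IsGorensteinRing B)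
    (h6 : Module.finrank k B ≤ 6) : ∃ s, HasType k B s := by
  have : IsArtinianRing B := IsArtinianRing.of_finite k B
  have hsurj (p : Ideal B) [p.IsPrime] :
      Function.Surjective (Algebra.algHom k B (Localization.AtPrime p)).toLinearMap :=
    IsArtinianRing.localization_surjective p.primeCompl (Localization.AtPrime p)
  have (p : Ideal B) [p.IsPrime] : Module.Finite k (Localization.AtPrime p) :=
    Module.Finite.of_surjective _ (hsurj p)
  have key (m : MaximalSpectrum B) :
      ∃ t, Nonempty (Localization.AtPrime m.asIdeal ≃ₐ[k] localModel k t) := by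
    obtain ⟨n, hn⟩ := hB.finite_injectiveDimension m.asIdeal
    exact exists_localModel_algEquiv h3 h2 (isFrobenius_of_hasInjectiveDimensionLE hn)
      ((LinearMap.finrank_le_finrank_of_surjective (hsurj m.asIdeal)).trans h6)
  choose w f using key
  have := Fintype.ofFinite (MaximalSpectrum B)
  exact ⟨_, HasType.of_fintype w
    (((MaximalSpectrum.toPiLocalizationEquiv B).restrictScalars k).trans
      (AlgEquiv.piCongrRight fun m => (f m).some))⟩

lemma sum_modelType (i : Fin 20) : ((modelType i).map localDim).sum = 6 := by
  revert i
  decide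

lemma finrank_models (h3 : (3 : k) ≠ 0) (h2 : (2 : k) ≠ 0) (i : Fin 20) :
    Module.finrank k (models k i) = 6 :=
  ((hasType_models i).finrank_eq h3 h2).trans (sum_modelType i)

lemma finite_models (h3 : (3 : k) ≠ 0) (h2 : (2 : k) ≠ 0) (i : Fin 20) :
    Module.Finite k (models k i) :=
  Module.finite_of_finrank_pos (by rw [finrank_models h3 h2]; omega)

lemma IsGorensteinRing.existsUnique_models [IsAlgClosed k] (h3 : (3 : k) ≠ 0)
    (h2 : (2 : k) ≠ 0) {B : Type v} [CommRing B] [Algebra k B] (hB : IsGorensteinRing B) (h6 : Module.finrank k B = 6) :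
    ∃! i : Fin 20, Nonempty (B ≃ₐ[k] models k i) := by
  have : Module.Finite k B := Module.finite_of_finrank_pos (by omega)
  obtain ⟨s, hs⟩ := hB.exists_hasType h3 h2 h6.le
  obtain ⟨i, rfl⟩ := exists_modelType_eq ((hs.finrank_eq h3 h2).symm.trans h6)
  refine ⟨i, hs.algEquiv (hasType_models i), fun j ⟨f⟩ => ?_⟩
  exact modelType_injective (((hasType_models j).congr f).eq h3 h2 hs)

lemma natCast_ne_zero_of_prime {p : ℕ} (hp : p.Prime) (h : ringChar k ≠ p) : (p : k) ≠ 0 := by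
  rw [Ne, ringChar.spec]
  intro hd
  rcases (Nat.dvd_prime hp).mp hd with h1 | h1
  exacts [CharP.ringChar_ne_one h1, h h1]

end

end AGor
end

theorem theoremB (k : Type u) [Field k] [IsAlgClosed k]
    (h2 : ringChar k ≠ 2) (h3 : ringChar k ≠ 3) :
    -- projective equivalence is the same as abstract isomorphism
    (∀ Z W : AGor.ClosedSubscheme k 4, AGor.IsAGPoint 6 Z → AGor.IsAGPoint 6 W →
      (Z.ProjectivelyEquivalent W ↔ Nonempty (Z.toOver ≅ W.toOver))) ∧
    -- the isomorphism classes of these schemes are those of the spectra of the twenty algebras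
    (∀ Z : AGor.ClosedSubscheme k 4, AGor.IsAGPoint 6 Z →
      ∃! i : Fin 20, Nonempty (Z.toOver ≅ AGor.specOver (AGor.models k i))) ∧
    (∀ i : Fin 20, ∃ Z : AGor.ClosedSubscheme k 4, AGor.IsAGPoint 6 Z ∧
      Nonempty (Z.toOver ≅ AGor.specOver (AGor.models k i))) ∧
    -- the isomorphism classes of Gorenstein algebras of degree six are those of the twenty algebras
    (∀ (B : Type v) [CommRing B] [Algebra k B], AGor.IsGorensteinRing B →
      Module.finrank k B = 6 → ∃! i : Fin 20, Nonempty (B ≃ₐ[k] AGor.models k i)) ∧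
    (∀ i : Fin 20, AGor.IsGorensteinRing (AGor.models k i) ∧
      Module.finrank k (AGor.models k i) = 6) ∧
    -- in particular
    IsEmpty (AGor.A₁sp k ≃ₐ[k] AGor.A₂sp k) := by
  have h2' : (2 : k) ≠ 0 := by
    exact_mod_cast AGor.natCast_ne_zero_of_prime Nat.prime_two h2
  have h3' : (3 : k) ≠ 0 := by
    exact_mod_cast AGor.natCast_ne_zero_of_prime Nat.prime_three h3
  have hfin := AGor.finite_models (k := k) h3' h2'
  have hFr := fun i => (AGor.hasType_models (k := k) i).isFrobenius h3' h2'
  refine ⟨fun Z W hZ hW => hZ.projectivelyEquivalent_iff (n := 4) hW, fun Z hZ => ?_, fun i => ?_,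
    fun B _ _ hB h6 => hB.existsUnique_models h3' h2' h6,
    fun i => ⟨(hFr i).isGorensteinRing, AGor.finrank_models h3' h2' i⟩, ⟨fun f => ?_⟩⟩
  · obtain ⟨B, _, _, v, μ, hv, h6, -, -, hμ⟩ := AGor.IsAGPoint.exists_isChart (n := 4) hZ
    have : Module.Finite k B := Module.finite_of_finrank_pos (by omega)
    obtain ⟨e⟩ := hv.nonempty_iso
    -- The functional cut out by the embedding shows that the abstract algebra B is Gorenstein, so
    -- the classification of algebras applies to it.
    have hB : AGor.IsFrobenius k B := ⟨μ, hμ⟩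
    obtain ⟨i, ⟨f⟩, hi⟩ := hB.isGorensteinRing.existsUnique_models h3' h2' h6
    obtain ⟨g⟩ := AGor.nonempty_specOver_iso_iff (B := .of k B) (C := AGor.models k i) |>.mpr ⟨f⟩
    refine ⟨i, ⟨e ≪≫ g⟩, fun j ⟨e'⟩ => hi j ?_⟩
    exact AGor.nonempty_specOver_iso_iff (B := .of k B).mp ⟨e.symm ≪≫ e'⟩
  · obtain ⟨Z, v, hv, hZ⟩ := AGor.exists_isChart_of_isFrobenius (n := 4) (hFr i) (by omega)
      (AGor.finrank_models h3' h2' i)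
    exact ⟨Z, hZ, hv.nonempty_iso⟩
  · have : (12 : Fin 14) = 13 := AGor.eq_of_localModel_algEquiv h3' h2' f
    exact absurd this (by decide)
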